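/- **Setting.** Let $r>0$ and $d=2r/(\sqrt3-1)$. Robots are disks of radius $r$ in the plane. Let $L$ be the hexagonal (triangular) lattice of points $d(a+be^{i\pi/3})$, $a,b\in\mathbb Z$, with origin $O$, and let $\Gamma$ be the graph on $L$ joining points at distance $d$. The *row* of $d(a+be^{i\pi/3})$ is $b$. Let $p_1,\dots,p_6$ be the neighbours of $O$, numbered clockwise, with $p_1,p_2$ in row $1$, $p_3,p_6$ in row $0$ and $p_4,p_5$ in row $-1$. Five stationary seed robots occupy $O,p_1,p_2,p_4,p_5$. The formation half-plane $H_1$ (idle half-plane $H_2$) consists of the lattice points in rows $\ge 2$ (rows $\le -2$). **Ribbons.** For $P\subseteq L$ the hop count $h(x)$ is the length of a shortest path in $\Gamma$ from $x$ to $O$ through points of $P\cup\{p_1,\dots,p_6\}$, and $-1$ if there is none. A *ribbon* of $P$ is a connected component of the subgraph of $\Gamma$ formed by the points of $P$ with a given hop count, called the gradient of the ribbon; its length is its number of points. Its edges are directed clockwise around common neighbours whose hop count is smaller by one. In the *ribbon order*, $x<y$ if a directed path leads from $y$ to $x$. A ribbon $R$ is the *parent* of $R'$ if its gradient is smaller by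 one and every point of $R'$ is adjacent to a point of $R$. In the *tree order*, $R<R'$ if $R$ is an ancestor of $R'$. A *complete tree order* is a strict total order on the ribbons extending the tree order. **Shape.** Let $S\subseteq H_1$ be a finite set of $N$ lattice points, disjoint from $\{O,p_1,\dots,p_6\}$, whose complement $L\setminus S$ is connected in $\Gamma$ (no lattice holes), and whose ribbonization is proper: all hop counts of points of $S$ are positive; all ribbons have length at least $2$; there is exactly one ribbon of gradient $2$ and it has length $3$; for $x,y\in S$ with $\|x-y\|=2d$ the lattice point between them is in $S$; for $x,y\in S$ with $\|x-y\|=\sqrt3\,d$ at least one of the two common neighbours is in $S$. Fix a complete tree order on the ribbons of $S$. **Algorithm.** Initially at least $N$ (finitely many) idle robots occupy lattice points of $H_2$, such that every ribbon of $H_2$ is empty or filled and, with a filled one, all ribbons of $H_2$ of smaller gradient are filled. The activation sequence $s[1],\dots,s[N]$: $s[n]$ is the largest point (ribbon order) on the largest ribbon of $H_2$ (tree order) among the points initially occupied by idle robots and not in $s[1],\dots,s[n-1]$. The assembly sequence $t[1],\dots,t[N]$: $t[n]$ is the smallest point (ribbon order) on the smallest ribbon (complete tree order) among the points of $S$ not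 in $t[1],\dots,t[n-1]$. In epoch $n\le N$ the robot $u_n$ leaves $s[n]$ (sub-epoch $n^-$: $u_n$ is moving) and stops at $t[n]$ (sub-epoch $n^+$); all other robots are at rest. The sub-epoch $0^+$ is the initial configuration. At a given sub-epoch, a lattice point is *occupied* if a non-moving robot is there. At a sub-epoch: a boundary robot is a non-moving robot adjacent to an unoccupied lattice point; the set $B$ of boundary robots is *proper* if two boundary robots at distance $\sqrt3\,d$ have at most one unoccupied common neighbour and the point between two boundary robots at distance $2d$ is occupied. The *edge-following set* $EFS$ is the set of unoccupied lattice points adjacent to an occupied one. The *edge-following path* $EFP$ is the set of points of the plane at distance exactly $d$ from the nearest non-moving robot. A robot *edge-follows* if it moves continuously along $EFP$, at each moment rotating clockwise with radius $d$ (and unit angular speed) around some non-moving robot. **Proposition.** The activation and assembly sequences exist, and: 1. At each sub-epoch ($n^+$ for $0\le n\le N$, $n^-$ for $1\le n\le N$) the set of boundary robots is proper, $EFP$ is homeomorphic to a circle, and $EFP$ contains all points of $EFS$. 2. For $1\le n\le N$ the points $s[n]$ and $t[n]$ lie in $EFS_{n^-}$, and the path of $u_n$ is well defined and unobstructed: there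 is exactly one simple arc along which $u_n$ edge-follows from $s[n]$ to $t[n]$ at sub-epoch $n^-$ (the segment of $EFP_{n^-}$ from $s[n]$ to $t[n]$, run through clockwise), and the closed disk of radius $r$ centred at any point of this arc is disjoint from the closed disk of radius $r$ of every non-moving robot. -/

import Mathlib

open Set

/-! ## The hexagonal lattice -/

/-- The lattice `L`: the pair `(a, b)` stands for the point `d * (a + b * e^{iπ/3})` of the plane,
where `d > 0` is the lattice constant (see `pos`). The origin `O` is `(0, 0)`. -/
abbrev LPt : Type := ℤ × ℤ

/-- The squared Euclidean length of the lattice vector `v`, in units of `d ^ 2`. -/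
def nsq (v : LPt) : ℤ := v.1 ^ 2 + v.1 * v.2 + v.2 ^ 2

/-- The position in the plane of a lattice point. -/
noncomputable def pos (d : ℝ) (v : LPt) : ℂ :=
  ⟨d * ((v.1 : ℝ) + (v.2 : ℝ) / 2), d * ((v.2 : ℝ) * (Real.sqrt 3 / 2))⟩

/-- Two lattice points are at distance `d * √(nsq (x - y))`: at distance `d`, `√3 d`, `2 d` iff
`nsq (x - y)` is `1`, `3`, `4` respectively. -/
theorem dist_pos_sq (d : ℝ) (x y : LPt) :
    dist (pos d x) (pos d y) ^ 2 = d ^ 2 * (nsq (x - y) : ℝ) := by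
  have h3 : Real.sqrt 3 ^ 2 = 3 := Real.sq_sqrt (by norm_num)
  rw [Complex.dist_eq, Complex.sq_norm, Complex.normSq_apply]
  simp only [pos, nsq, Complex.sub_re, Complex.sub_im, Prod.fst_sub, Prod.snd_sub]
  push_cast
  linear_combination (d ^ 2 * ((x.2 : ℝ) - (y.2 : ℝ)) ^ 2 / 4) * h3

/-- The graph `Γ` on the lattice: two lattice points are adjacent iff they are at distance `d`. -/
def hexGraph : SimpleGraph LPt where
  Adj x y := nsq (x - y) = 1
  symm := ⟨fun x y h => by
    have e : nsq (y - x) = nsq (x - y) := by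
      simp only [nsq, Prod.fst_sub, Prod.snd_sub]; ring
    rw [e]; exact h⟩
  loopless := ⟨fun x h => by simp [nsq] at h⟩

/-- Clockwise rotation of a lattice vector by the angle `π / 3`. -/
def rotCW (v : LPt) : LPt := (v.1 + v.2, -v.1)

theorem pos_rotCW (d : ℝ) (v : LPt) :
    pos d (rotCW v) = Complex.exp (-((Real.pi / 3 : ℝ) : ℂ) * Complex.I) * pos d v := by
  have h3 : Real.sqrt 3 * Real.sqrt 3 = 3 := Real.mul_self_sqrt (by norm_num)
  have hre : (Complex.exp (-((Real.pi / 3 : ℝ) : ℂ) * Complex.I)).re = 1 / 2 := by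
    rw [← Complex.ofReal_neg, Complex.exp_ofReal_mul_I_re, Real.cos_neg, Real.cos_pi_div_three]
  have him : (Complex.exp (-((Real.pi / 3 : ℝ) : ℂ) * Complex.I)).im = -(Real.sqrt 3 / 2) := by
    rw [← Complex.ofReal_neg, Complex.exp_ofReal_mul_I_im, Real.sin_neg, Real.sin_pi_div_three]
  apply Complex.ext
  · rw [Complex.mul_re, hre, him]
    simp only [pos, rotCW]
    push_cast
    linear_combination (-(d * (v.2 : ℝ) / 4)) * h3
  · rw [Complex.mul_im, hre, him]
    simp only [pos, rotCW]
    push_cast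
    ring

/-- The origin `O` and its six neighbours, in the order `O, p₁, p₂, p₃, p₄, p₅, p₆`. The points
`p₁, …, p₆` are numbered clockwise. -/
def hexagon : Set LPt := {(0, 0), (-1, 1), (0, 1), (1, 0), (1, -1), (0, -1), (-1, 0)}

/-- The seed robots `v₀, …, v₄` occupy `O, p₁, p₂, p₄, p₅`. -/
def seeds : Set LPt := {(0, 0), (-1, 1), (0, 1), (1, -1), (0, -1)}

/-- Lattice points of the formation half-plane: the open half-plane beyond the line `p₁ p₂`. -/
def H₁ : Set LPt := {x | 2 ≤ x.2}

/-- Lattice points of the idle half-plane: the open half-plane beyond the line `p₄ p₅`. -/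
def H₂ : Set LPt := {x | x.2 ≤ -2}

/-! ## Hop counts and ribbons -/

/-- The subgraph of `Γ` formed by the points of `P` and of `{O, p₁, …, p₆}`. -/
def hopGraph (P : Set LPt) : SimpleGraph LPt where
  Adj x y := hexGraph.Adj x y ∧ x ∈ P ∪ hexagon ∧ y ∈ P ∪ hexagon
  symm := ⟨fun _ _ h => ⟨h.1.symm, h.2.2, h.2.1⟩⟩
  loopless := ⟨fun x h => hexGraph.loopless.irrefl x h.1⟩

open Classical in
/-- The hop count: the length of a shortest path to `O` through points of `P ∪ {p₁, …, p₆}`, and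
`-1` if there is none. -/
noncomputable def hop (P : Set LPt) (x : LPt) : ℤ :=
  if (hopGraph P).Reachable x (0, 0) then ((hopGraph P).dist x (0, 0) : ℤ) else -1

/-- Adjacency in `Γ` between points of `P` with the same hop count. -/
def levelGraph (P : Set LPt) : SimpleGraph LPt where
  Adj x y := hexGraph.Adj x y ∧ x ∈ P ∧ y ∈ P ∧ hop P x = hop P y
  symm := ⟨fun _ _ h => ⟨h.1.symm, h.2.2.1, h.2.1, h.2.2.2.symm⟩⟩
  loopless := ⟨fun x h => hexGraph.loopless.irrefl x h.1⟩

/-- (The vertex set of) the ribbon `R(x)` of a point `x` of `P`: its component in the graph of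
points of `P` of equal hop count. -/
def ribbonOf (P : Set LPt) (x : LPt) : Set LPt := {y | y ∈ P ∧ (levelGraph P).Reachable x y}

/-- The ribbonization of `P`: the set of all its ribbons. -/
def ribbonization (P : Set LPt) : Set (Set LPt) := {R | ∃ x ∈ P, R = ribbonOf P x}

/-- The gradient of the ribbon `R` is `g`. -/
def HasGradient (P : Set LPt) (R : Set LPt) (g : ℤ) : Prop := ∀ x ∈ R, hop P x = g

/-- The arcs of the directed ribbons: from `x` to the next point `x'` clockwise around a common
neighbour `y` whose hop count is smaller by one. -/
def Arc (P : Set LPt) (x x' : LPt) : Prop :=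
  x ∈ P ∧ x' ∈ P ∧ hop P x = hop P x' ∧
    ∃ y, hexGraph.Adj x y ∧ hop P y = hop P x - 1 ∧ x' = y + rotCW (x - y)

/-- The ribbon order: `x < y` iff a directed path leads from `y` to `x` along the ribbon, that is,
iff `x` is in front of `y`. -/
def RibbonLT (P : Set LPt) (x y : LPt) : Prop := Relation.TransGen (Arc P) y x

/-- `R` is the parent ribbon of `R'`: its gradient is smaller by one, and every vertex of `R'` is
adjacent to a vertex of `R`. -/
def IsParent (P : Set LPt) (R R' : Set LPt) : Prop :=
  R ∈ ribbonization P ∧ R' ∈ ribbonization P ∧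
    (∃ g, HasGradient P R g ∧ HasGradient P R' (g + 1)) ∧
    ∀ x ∈ R', ∃ y ∈ R, hexGraph.Adj x y

/-- The tree order: `R < R'` iff `R` is an ancestor of `R'`. -/
def TreeLT (P : Set LPt) (R R' : Set LPt) : Prop := Relation.TransGen (IsParent P) R R'

/-- A complete tree order: a strict total order on the ribbons that extends the tree order. -/
structure IsCompleteTreeOrder (P : Set LPt) (lt : Set LPt → Set LPt → Prop) : Prop where
  irrefl : ∀ R ∈ ribbonization P, ¬ lt R R
  trans : ∀ R ∈ ribbonization P, ∀ R' ∈ ribbonization P, ∀ R'' ∈ ribbonization P,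
    lt R R' → lt R' R'' → lt R R''
  total : ∀ R ∈ ribbonization P, ∀ R' ∈ ribbonization P, lt R R' ∨ R = R' ∨ lt R' R
  extend : ∀ R R', TreeLT P R R' → lt R R'

/-- The order of the points of `P` by their ribbons (compared by `lt`) and, on one ribbon, by the
ribbon order. -/
def PointLT (P : Set LPt) (lt : Set LPt → Set LPt → Prop) (x y : LPt) : Prop :=
  lt (ribbonOf P x) (ribbonOf P y) ∨ (ribbonOf P x = ribbonOf P y ∧ RibbonLT P x y)

/-- The shape `S` has a proper ribbonization. -/
structure IsProperRibbonization (S : Set LPt) : Prop where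
  /-- proper placement -/
  subset_H₁ : S ⊆ H₁
  disjoint_hexagon : Disjoint S hexagon
  hop_pos : ∀ x ∈ S, 0 < hop S x
  two_le_length : ∀ R ∈ ribbonization S, 2 ≤ R.ncard
  /-- there is exactly one ribbon of gradient two, and it has length three -/
  root : ∃ R₀ ∈ ribbonization S, HasGradient S R₀ 2 ∧ R₀.ncard = 3 ∧
    ∀ R ∈ ribbonization S, HasGradient S R 2 → R = R₀
  /-- smooth boundary -/
  smooth_two : ∀ x ∈ S, ∀ y ∈ S, nsq (x - y) = 4 →
    ∀ z, hexGraph.Adj x z → hexGraph.Adj y z → z ∈ S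
  smooth_sqrt_three : ∀ x ∈ S, ∀ y ∈ S, nsq (x - y) = 3 →
    ¬ ∀ z, hexGraph.Adj x z → hexGraph.Adj y z → z ∉ S

/-- The set `S` of lattice points has no lattice holes: its complement is connected in `Γ`. This is
what it means for (the discrete representation of) a shape to be without holes. -/
def NoLatticeHoles (S : Set LPt) : Prop := (hexGraph.induce Sᶜ).Preconnected

/-- Initial placement of the idle robots: they are in `H₂`, every idle ribbon (ribbon of `H₂`) is
empty or filled, and with a filled idle ribbon all those closer to the root are filled. -/
structure IsIdlePlacement (I : Set LPt) : Prop where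
  subset_H₂ : I ⊆ H₂
  empty_or_filled : ∀ R ∈ ribbonization H₂, Disjoint R I ∨ R ⊆ I
  layer_by_layer : ∀ R ∈ ribbonization H₂, ∀ R' ∈ ribbonization H₂, R ⊆ I →
    ∀ g g', HasGradient H₂ R g → HasGradient H₂ R' g' → g' < g → R' ⊆ I

/-! ## The additive stage -/

/-- `x` is the largest element of `A` for `lt`. -/
def IsLargest (lt : LPt → LPt → Prop) (A : Set LPt) (x : LPt) : Prop :=
  x ∈ A ∧ ∀ y ∈ A, y ≠ x → lt y x

/-- `x` is the smallest element of `A` for `lt`. -/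
def IsSmallest (lt : LPt → LPt → Prop) (A : Set LPt) (x : LPt) : Prop :=
  x ∈ A ∧ ∀ y ∈ A, y ≠ x → lt x y

/-- The activation sequence `s[1], …, s[N]`: `s[n]` is the largest point on the largest idle ribbon,
among the points occupied by idle robots that do not occur in `s[1], …, s[n-1]`. -/
def IsActivationSequence (I : Set LPt) (N : ℕ) (s : ℕ → LPt) : Prop :=
  ∀ n, 1 ≤ n → n ≤ N → IsLargest (PointLT H₂ (TreeLT H₂)) (I \ s '' Ico 1 n) (s n)

/-- The assembly sequence `t[1], …, t[N]`: `t[n]` is the smallest point on the smallest ribbon (for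
the complete tree order `lt`), among the points of `S` that do not occur in `t[1], …, t[n-1]`. -/
def IsAssemblySequence (S : Set LPt) (lt : Set LPt → Set LPt → Prop) (N : ℕ) (t : ℕ → LPt) : Prop :=
  ∀ n, 1 ≤ n → n ≤ N → IsSmallest (PointLT S lt) (S \ t '' Ico 1 n) (t n)

/-- The points occupied by non-moving robots at sub-epoch `n⁺`: the robots `u₁, …, u_n` have stopped
at `t[1], …, t[n]`, and the next one has not started to move. -/
def occPlus (I : Set LPt) (s t : ℕ → LPt) (n : ℕ) : Set LPt :=
  seeds ∪ (I \ s '' Icc 1 n) ∪ t '' Icc 1 n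

/-- The points occupied by non-moving robots at sub-epoch `n⁻` (`n ≥ 1`): the robot `u_n` has left
`s[n]` and is moving. -/
def occMinus (I : Set LPt) (s t : ℕ → LPt) (n : ℕ) : Set LPt :=
  seeds ∪ (I \ s '' Icc 1 n) ∪ t '' Ico 1 n

/-- The boundary robots: those adjacent to an unoccupied lattice point. -/
def boundaryRobots (occ : Set LPt) : Set LPt := {x | x ∈ occ ∧ ∃ y, hexGraph.Adj x y ∧ y ∉ occ}

/-- The set of boundary robots is proper. -/
structure IsProperBoundary (occ : Set LPt) : Prop where
  sqrt_three : ∀ x ∈ boundaryRobots occ, ∀ y ∈ boundaryRobots occ, nsq (x - y) = 3 →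
    {z | z ∉ occ ∧ hexGraph.Adj x z ∧ hexGraph.Adj y z}.Subsingleton
  two : ∀ x ∈ boundaryRobots occ, ∀ y ∈ boundaryRobots occ, nsq (x - y) = 4 →
    ∀ z, hexGraph.Adj x z → hexGraph.Adj y z → z ∈ occ

/-- The edge-following set: unoccupied lattice points adjacent to a non-moving robot. -/
def edgeFollowingSet (occ : Set LPt) : Set LPt := {x | x ∉ occ ∧ ∃ y ∈ occ, hexGraph.Adj x y}

/-- The edge-following path: the points of the plane at distance exactly `d` from the nearest
non-moving robot. -/
def edgeFollowingPath (d : ℝ) (occ : Set LPt) : Set ℂ :=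
  {z | (∃ c ∈ occ, dist z (pos d c) = d) ∧ ∀ c ∈ occ, d ≤ dist z (pos d c)}

/-- `γ` is the motion, during the time interval `[0, ℓ]`, of a robot that executes edge-following
among the non-moving robots `occ`: it stays on the edge-following path, and at each moment it
rotates clockwise, with radius `d` (and unit angular speed), around some non-moving robot `c`. -/
structure IsEdgeFollowing (d : ℝ) (occ : Set LPt) (ℓ : ℝ) (γ : ℝ → ℂ) : Prop where
  continuousOn : ContinuousOn γ (Icc 0 ℓ)
  mem_path : ∀ τ ∈ Icc 0 ℓ, γ τ ∈ edgeFollowingPath d occ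
  rotates : ∀ τ ∈ Ico 0 ℓ, ∃ c ∈ occ, dist (γ τ) (pos d c) = d ∧ ∃ ε > 0, ∀ u ∈ Icc 0 ε, τ + u ≤ ℓ →
    γ (τ + u) = pos d c + Complex.exp (-(u : ℂ) * Complex.I) * (γ τ - pos d c)

/-- `γ` on `[0, ℓ]` is the assembly path from the lattice point `a` to the lattice point `b`: the
segment of the edge-following path from `a` to `b`, run through clockwise. -/
structure IsAssemblyPath (d : ℝ) (occ : Set LPt) (a b : LPt) (ℓ : ℝ) (γ : ℝ → ℂ) : Prop where
  pos_time : 0 < ℓ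
  follows : IsEdgeFollowing d occ ℓ γ
  source : γ 0 = pos d a
  target : γ ℓ = pos d b
  injOn : InjOn γ (Icc 0 ℓ)

/-- The path `γ` on `[0, ℓ]` is unobstructed: a disk-shaped robot of radius `r` whose centre moves
along it never touches a non-moving robot. -/
def IsUnobstructed (d r : ℝ) (occ : Set LPt) (ℓ : ℝ) (γ : ℝ → ℂ) : Prop :=
  ∀ τ ∈ Icc 0 ℓ, ∀ c ∈ occ, Disjoint (Metric.closedBall (γ τ) r) (Metric.closedBall (pos d c) r)

/-!
The proof rests on a discrete convexity of hop counts.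

Let `P` be the shape or the idle half-plane. By `holeFree_shape` and `holeFree_idle` every finite
region enclosed by `P` and the central hexagon is contained in `P` (`HoleFree`). For such a `P` two
statements are proved together by induction on the hop count (`lowerClique_and_edgeLower`): two
lower neighbours of a point (those with hop count smaller by one) are adjacent, and two adjacent
points of equal hop count have a common lower neighbour. If one of them failed for the first time at
hop count `g + 1`, a closed walk through the ball of radius `g` and one or two points of the next
sphere would separate two points outside of the ball; winding numbers (`exists_pocket`) then give a
finite region enclosed by the ball and these points. The point of this region that is farthest from
them has three consecutive neighbours in the sphere of radius `g` (`exists_extremal`), and the two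
statements for `g` exclude this (`not_three_consecutive`).

It follows that every ribbon is a directed path without cycles (`HoleFree.acyclic`,
`HoleFree.ribbon_total`) with a unique parent (`HoleFree.isParent`), so that the points of `P` are
strictly totally ordered, each after its lower neighbours. Hence the activation and assembly
sequences exist, and at each sub-epoch the occupied points are the seeds, an initial segment of the
idle half-plane and an initial segment of the shape. By `IsInitial.common_neighbour` an initial
segment inherits the smoothness of `P`, so the occupied set is tight (`isTight_occ`): two occupied
points at distance `√3 d` or `2 d` have an occupied point between them. This makes the set of
boundary robots proper, and it makes the step of an edge-following robot from one lattice point to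
the next one unique (`IsTight.step_unique`). These steps form a single cycle (`isCycle_occ`): this is
clear for one robot, and it is preserved when a point of the edge-following set of a tight set is
filled (`IsCycle.insert`), in particular when a configuration grows along an initial segment.

In the plane every step is an arc of `π / 3` around an occupied point. In coordinates adapted to the
arc its distances from the lattice points are given by the quadratic form of the lattice
(`arcPoint_dist_ge`, `arcPoint_dist_lt`); the arcs of the cycle therefore cover the edge-following
path, and they meet in their end points only. The curve formed by them identifies
`ℝ / (m * π / 3) ℤ` with the edge-following path, where `m` is the number of steps
(`BoundaryOrbit.nonempty_homeomorph_circle`). A robot that edge-follows is on this curve at every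
time (`BoundaryOrbit.eqOn_curve`), which gives existence and uniqueness of the assembly path
(`exists_unique_assemblyPath`). The path is unobstructed because its distance from the non-moving
robots is at least `d > 2 * r`.
-/

/-! ### Lattice geometry -/

theorem nsq_nonneg_form (v : LPt) : 4 * nsq v = (2 * v.1 + v.2) ^ 2 + 3 * v.2 ^ 2 := by
  simp only [nsq]; ring

theorem nsq_form_fst (v : LPt) : 4 * nsq v = (2 * v.2 + v.1) ^ 2 + 3 * v.1 ^ 2 := by
  simp only [nsq]; ring

theorem abs_le_two_of_nsq_le {v : LPt} (h : nsq v ≤ 4) :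
    (-2 ≤ v.1 ∧ v.1 ≤ 2) ∧ (-2 ≤ v.2 ∧ v.2 ≤ 2) := by
  have h1 := nsq_nonneg_form v
  have h2 := nsq_form_fst v
  have h3 := sq_nonneg (2 * v.1 + v.2)
  have h4 := sq_nonneg (2 * v.2 + v.1)
  refine ⟨⟨?_, ?_⟩, ?_, ?_⟩ <;> nlinarith

theorem nsq_eq_one_iff (v : LPt) : nsq v = 1 ↔ v = (1, 0) ∨ v = (0, 1) ∨ v = (-1, 1) ∨
    v = (-1, 0) ∨ v = (0, -1) ∨ v = (1, -1) := by
  constructor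
  · intro h
    obtain ⟨⟨h1, h2⟩, h3, h4⟩ := abs_le_two_of_nsq_le (v := v) (by omega)
    obtain ⟨a, b⟩ := v
    simp only [nsq] at *
    interval_cases a <;> interval_cases b <;> simp_all
  · rintro (rfl | rfl | rfl | rfl | rfl | rfl) <;> decide

theorem nsq_eq_three_iff (v : LPt) : nsq v = 3 ↔ v = (1, 1) ∨ v = (-1, 2) ∨ v = (-2, 1) ∨
    v = (-1, -1) ∨ v = (1, -2) ∨ v = (2, -1) := by
  constructor
  · intro h
    obtain ⟨⟨h1, h2⟩, h3, h4⟩ := abs_le_two_of_nsq_le (v := v) (by omega)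
    obtain ⟨a, b⟩ := v
    simp only [nsq] at *
    interval_cases a <;> interval_cases b <;> simp_all
  · rintro (rfl | rfl | rfl | rfl | rfl | rfl) <;> decide

theorem nsq_eq_four_iff (v : LPt) : nsq v = 4 ↔ v = (2, 0) ∨ v = (0, 2) ∨ v = (-2, 2) ∨
    v = (-2, 0) ∨ v = (0, -2) ∨ v = (2, -2) := by
  constructor
  · intro h
    obtain ⟨⟨h1, h2⟩, h3, h4⟩ := abs_le_two_of_nsq_le (v := v) (by omega)
    obtain ⟨a, b⟩ := v
    simp only [nsq] at *
    interval_cases a <;> interval_cases b <;> simp_all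
  · rintro (rfl | rfl | rfl | rfl | rfl | rfl) <;> decide

theorem nsq_neg (v : LPt) : nsq (-v) = nsq v := by
  simp only [nsq, Prod.fst_neg, Prod.snd_neg]; ring

theorem nsq_sub_comm (x y : LPt) : nsq (x - y) = nsq (y - x) := by
  rw [← nsq_neg, neg_sub]

theorem nsq_rotCW (v : LPt) : nsq (rotCW v) = nsq v := by
  simp only [nsq, rotCW]; ring

theorem adj_iff (x y : LPt) : hexGraph.Adj x y ↔ nsq (x - y) = 1 := Iff.rfl

theorem adj_add_iff (x e : LPt) : hexGraph.Adj x (x + e) ↔ nsq e = 1 := by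
  rw [adj_iff, nsq_sub_comm, add_sub_cancel_left]

/-- Adjacency in coordinates. -/
theorem adj_coord (x y : LPt) : hexGraph.Adj x y ↔
    (y.1 = x.1 + 1 ∧ y.2 = x.2) ∨ (y.1 = x.1 ∧ y.2 = x.2 + 1) ∨ (y.1 = x.1 - 1 ∧ y.2 = x.2 + 1) ∨
    (y.1 = x.1 - 1 ∧ y.2 = x.2) ∨ (y.1 = x.1 ∧ y.2 = x.2 - 1) ∨
    (y.1 = x.1 + 1 ∧ y.2 = x.2 - 1) := by
  rw [adj_iff, nsq_sub_comm, nsq_eq_one_iff]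
  simp only [Prod.ext_iff, Prod.fst_sub, Prod.snd_sub]
  omega

theorem sqrt_three_coord (x y : LPt) : nsq (x - y) = 3 ↔
    (y.1 = x.1 + 1 ∧ y.2 = x.2 + 1) ∨ (y.1 = x.1 - 1 ∧ y.2 = x.2 + 2) ∨
    (y.1 = x.1 - 2 ∧ y.2 = x.2 + 1) ∨ (y.1 = x.1 - 1 ∧ y.2 = x.2 - 1) ∨
    (y.1 = x.1 + 1 ∧ y.2 = x.2 - 2) ∨ (y.1 = x.1 + 2 ∧ y.2 = x.2 - 1) := by
  rw [nsq_sub_comm, nsq_eq_three_iff]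
  simp only [Prod.ext_iff, Prod.fst_sub, Prod.snd_sub]
  omega

theorem two_coord (x y : LPt) : nsq (x - y) = 4 ↔
    (y.1 = x.1 + 2 ∧ y.2 = x.2) ∨ (y.1 = x.1 ∧ y.2 = x.2 + 2) ∨ (y.1 = x.1 - 2 ∧ y.2 = x.2 + 2) ∨
    (y.1 = x.1 - 2 ∧ y.2 = x.2) ∨ (y.1 = x.1 ∧ y.2 = x.2 - 2) ∨
    (y.1 = x.1 + 2 ∧ y.2 = x.2 - 2) := by
  rw [nsq_sub_comm, nsq_eq_four_iff]
  simp only [Prod.ext_iff, Prod.fst_sub, Prod.snd_sub]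
  omega

/-! ### Winding numbers of closed lattice walks -/

/-- The signed number of times (`-1`, `0` or `1`) that the step from `a` to `b` crosses the
horizontal ray that starts just above the lattice point `p` and runs to the right. -/
def cross (p a b : LPt) : ℤ :=
  if a.2 = p.2 ∧ b.2 = p.2 + 1 ∧ p.1 < a.1 then 1
  else if b.2 = p.2 ∧ a.2 = p.2 + 1 ∧ p.1 < b.1 then -1 else 0

/-- The signed number of crossings of a walk with the ray to the right of `p`; for a closed walk
that avoids `p` this is its winding number around `p`. -/
def wind (p : LPt) : {u v : LPt} → hexGraph.Walk u v → ℤ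
  | _, _, .nil => 0
  | _, _, .cons (u := u) (v := v) _ w => cross p u v + wind p w

/-- The indicator of the part of the upper of the rows of `p` and `p'` that lies to the right of
the point in this row, with the sign `+1` if this point is `p'` and `-1` if it is `p`. -/
def jump (p p' c : LPt) : ℤ :=
  if p'.2 = p.2 + 1 then (if c.2 = p'.2 ∧ p'.1 < c.1 then 1 else 0)
  else if p.2 = p'.2 + 1 then (if c.2 = p.2 ∧ p.1 < c.1 then -1 else 0) else 0

set_option maxHeartbeats 1000000 in
/-- A step changes the crossing number by a coboundary when the base point moves to a neighbour. -/
theorem cross_sub_cross {p p' a b : LPt} (hp : hexGraph.Adj p p') (hab : hexGraph.Adj a b)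
    (h1 : a ≠ p) (h2 : a ≠ p') (h3 : b ≠ p) (h4 : b ≠ p') :
    cross p a b - cross p' a b = jump p p' b - jump p p' a := by
  rw [adj_coord] at hp hab
  obtain ⟨p1, p2⟩ := p
  obtain ⟨p1', p2'⟩ := p'
  obtain ⟨a1, a2⟩ := a
  obtain ⟨b1, b2⟩ := b
  simp only [ne_eq, Prod.mk.injEq, not_and] at *
  rcases hp with ⟨rfl, rfl⟩ | ⟨rfl, rfl⟩ | ⟨rfl, rfl⟩ | ⟨rfl, rfl⟩ | ⟨rfl, rfl⟩ | ⟨rfl, rfl⟩ <;>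
  rcases hab with ⟨rfl, rfl⟩ | ⟨rfl, rfl⟩ | ⟨rfl, rfl⟩ | ⟨rfl, rfl⟩ | ⟨rfl, rfl⟩ | ⟨rfl, rfl⟩ <;>
  simp [cross, jump] <;> split_ifs <;> omega

/-- The winding number of a closed walk is constant on the components of its complement. -/
theorem wind_sub_wind {p p' : LPt} (hp : hexGraph.Adj p p') :
    ∀ {u v : LPt} (w : hexGraph.Walk u v), p ∉ w.support → p' ∉ w.support →
      wind p w - wind p' w = jump p p' v - jump p p' u
  | _, _, .nil, _, _ => by simp [wind]
  | u, v, .cons (v := u') h w, h1, h2 => by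
    simp only [SimpleGraph.Walk.support_cons, List.mem_cons, not_or] at h1 h2
    have ih := wind_sub_wind hp w h1.2 h2.2
    have hu' : u' ∈ w.support := w.start_mem_support
    have := cross_sub_cross hp h (Ne.symm h1.1) (Ne.symm h2.1)
      (fun e => h1.2 (e ▸ hu')) (fun e => h2.2 (e ▸ hu'))
    simp only [wind]
    omega

theorem wind_append (p : LPt) : ∀ {u v x : LPt} (w : hexGraph.Walk u v) (w' : hexGraph.Walk v x),
    wind p (w.append w') = wind p w + wind p w'
  | _, _, _, .nil, _ => by simp [wind]
  | _, _, _, .cons h w, w' => by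
    simp only [SimpleGraph.Walk.cons_append, wind, wind_append p w w']; ring

/-- A walk without points to the right of `p` in the row of `p` does not cross the ray. -/
theorem wind_eq_zero_of_above (p : LPt) : ∀ {u v : LPt} (w : hexGraph.Walk u v),
    (∀ a ∈ w.support, a.2 ≠ p.2 ∨ a.1 ≤ p.1) → wind p w = 0
  | _, _, .nil, _ => by simp [wind]
  | u, v, .cons (v := u') h w, hw => by
    have ih := wind_eq_zero_of_above p w (fun a ha => hw a (by simp [ha]))
    have h1 := hw u (by simp)
    have h2 := hw u' (by simp)
    simp only [wind, ih, cross]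
    split_ifs <;> omega

/-- Far to the left of a walk the ray meets every step between two rows. -/
theorem wind_of_left (p : LPt) : ∀ {u v : LPt} (w : hexGraph.Walk u v),
    (∀ a ∈ w.support, p.1 < a.1) →
      wind p w = (if p.2 < v.2 then 1 else 0) - (if p.2 < u.2 then 1 else 0)
  | _, _, .nil, _ => by simp [wind]
  | u, v, .cons (v := u') h w, hw => by
    have ih := wind_of_left p w (fun a ha => hw a (by simp [ha]))
    have h1 := hw u (by simp)
    have h2 := hw u' (by simp)
    rw [adj_coord] at h
    simp only [wind, ih, cross]
    split_ifs <;> omega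

theorem finite_wind_ne_zero {z : LPt} (w : hexGraph.Walk z z) : {p | wind p w ≠ 0}.Finite := by
  obtain ⟨M, hM⟩ : ∃ M : ℤ, ∀ a ∈ w.support, |a.1| + |a.2| ≤ M := by
    obtain ⟨M, hM⟩ :=
      (w.support.toFinset.finite_toSet.image (fun a : LPt => |a.1| + |a.2|)).bddAbove
    exact ⟨M, fun a ha => hM ⟨a, by simpa using ha, rfl⟩⟩
  have hM' : ∀ a ∈ w.support, (-M ≤ a.1 ∧ a.1 ≤ M) ∧ (-M ≤ a.2 ∧ a.2 ≤ M) := by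
    intro a ha
    have := hM a ha
    have h1 := abs_le.1 (le_trans (le_add_of_nonneg_right (abs_nonneg a.2)) this)
    have h2 := abs_le.1 (le_trans (le_add_of_nonneg_left (abs_nonneg a.1)) this)
    exact ⟨h1, h2⟩
  refine ((Set.finite_Icc (-M) M).prod (Set.finite_Icc (-M) M)).subset fun p hp => ?_
  by_contra hcon
  simp only [Set.mem_prod, Set.mem_Icc] at hcon
  apply hp
  by_cases h : p.1 < -M
  · rw [wind_of_left p w fun a ha => by have := (hM' a ha).1.1; omega]
    simp
  · apply wind_eq_zero_of_above
    intro a ha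
    have := hM' a ha
    omega

theorem cross_add (z p a b : LPt) : cross (z + p) (z + a) (z + b) = cross p a b := by
  simp only [cross, Prod.fst_add, Prod.snd_add, add_assoc, add_right_inj, add_lt_add_iff_left]

theorem jump_add (z p q c : LPt) : jump (z + p) (z + q) (z + c) = jump p q c := by
  simp only [jump, Prod.fst_add, Prod.snd_add, add_assoc, add_right_inj, add_lt_add_iff_left]

/-- The winding number of a closed walk through `0` that enters from `y` and leaves to `x`, at the
neighbour `p` of `0`, up to a summand that does not depend on `p`. -/
def localWind (x y p : LPt) : ℤ := jump p 0 y - jump p 0 x + cross p 0 x + cross p y 0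

/-- The six unit vectors of the lattice, as a list, so that statements about them are decidable. -/
def dirs : List LPt := [(1, 0), (0, 1), (-1, 1), (-1, 0), (0, -1), (1, -1)]

theorem mem_dirs (v : LPt) : v ∈ dirs ↔ nsq v = 1 := by
  rw [nsq_eq_one_iff]; simp [dirs]

/-- A passage through `0` between two neighbours of `0` that lie on different sides of it gives
these neighbours different winding numbers. -/
theorem localWind_ne : ∀ e ∈ dirs, ∀ k < 6, ∀ j < k, ∀ i < j, 0 < i →
    localWind e (rotCW^[j] e) (rotCW^[i] e) ≠ localWind e (rotCW^[j] e) (rotCW^[k] e) := by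
  decide

theorem nsq_iterate_rotCW (e : LPt) (i : ℕ) : nsq (rotCW^[i] e) = nsq e := by
  induction i with
  | zero => rfl
  | succ i ih => rw [Function.iterate_succ_apply', nsq_rotCW, ih]

/-- A closed walk through `z` that passes between the neighbours `p` and `q` of `z`, and does not
return to `z`, separates `p` or `q` from infinity. -/
theorem exists_pocket {z e : LPt} (he : nsq e = 1) {i j k : ℕ} (hi : 0 < i) (hij : i < j)
    (hjk : j < k) (hk : k < 6) (w : hexGraph.Walk (z + e) (z + rotCW^[j] e)) (K : Set LPt)
    (hw : ∀ a ∈ w.support, a ∈ K) (hzK : z ∈ K) (hzw : z ∉ w.support)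
    (hp : z + rotCW^[i] e ∉ K) (hq : z + rotCW^[k] e ∉ K) :
    ∃ U : Set LPt, U.Finite ∧ U.Nonempty ∧ Disjoint U K ∧
      ∀ u ∈ U, ∀ v, hexGraph.Adj u v → v ∈ U ∪ K := by
  have hx : hexGraph.Adj z (z + e) := (adj_add_iff z e).2 he
  have hy : hexGraph.Adj (z + rotCW^[j] e) z :=
    ((adj_add_iff z _).2 (by rw [nsq_iterate_rotCW, he])).symm
  set C : hexGraph.Walk z z := .cons hx (w.append (.cons hy .nil)) with hC
  have hCK : ∀ a ∈ C.support, a ∈ K := by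
    intro a ha
    rw [hC, SimpleGraph.Walk.support_cons, List.mem_cons,
      SimpleGraph.Walk.mem_support_append_iff] at ha
    rcases ha with rfl | ha | ha
    · exact hzK
    · exact hw a ha
    · simp only [SimpleGraph.Walk.support_cons, SimpleGraph.Walk.support_nil, List.mem_cons,
        List.not_mem_nil, or_false] at ha
      rcases ha with rfl | rfl
      · exact hw _ w.end_mem_support
      · exact hzK
  have key : ∀ l : ℕ, z + rotCW^[l] e ∉ K →
      wind (z + rotCW^[l] e) C = wind z w + localWind e (rotCW^[j] e) (rotCW^[l] e) := by
    intro l hl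
    have hadj : hexGraph.Adj (z + rotCW^[l] e) z :=
      ((adj_add_iff z _).2 (by rw [nsq_iterate_rotCW, he])).symm
    have h1 := wind_sub_wind hadj w (fun h => hl (hw _ h)) hzw
    have h2 : ∀ c, jump (z + rotCW^[l] e) z (z + c) = jump (rotCW^[l] e) 0 c := fun c => by
      simpa using jump_add z (rotCW^[l] e) 0 c
    have h3 : cross (z + rotCW^[l] e) z (z + e) = cross (rotCW^[l] e) 0 e := by
      simpa using cross_add z (rotCW^[l] e) 0 e
    have h4 : cross (z + rotCW^[l] e) (z + rotCW^[j] e) z =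
        cross (rotCW^[l] e) (rotCW^[j] e) 0 := by
      simpa using cross_add z (rotCW^[l] e) (rotCW^[j] e) 0
    rw [h2, h2] at h1
    simp only [hC, wind, wind_append, localWind, h3, h4]
    omega
  refine ⟨{u | u ∉ K ∧ wind u C ≠ 0}, (finite_wind_ne_zero C).subset fun u hu => hu.2, ?_,
    Set.disjoint_left.2 fun u hu => hu.1, ?_⟩
  · have hne := localWind_ne e ((mem_dirs e).2 he) k hk j hjk i hij hi
    by_contra hcon
    rw [Set.not_nonempty_iff_eq_empty, Set.eq_empty_iff_forall_notMem] at hcon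
    have h1 := hcon (z + rotCW^[i] e)
    have h2 := hcon (z + rotCW^[k] e)
    simp only [Set.mem_ofPred_eq, not_and, not_not] at h1 h2
    have h1 := h1 hp
    have h2 := h2 hq
    rw [key i hp] at h1
    rw [key k hq] at h2
    omega
  · rintro u ⟨hu, hu'⟩ v huv
    by_cases hv : v ∈ K
    · exact Or.inr hv
    · refine Or.inl ⟨hv, ?_⟩
      have := wind_sub_wind huv C (fun h => hu (hCK _ h)) (fun h => hv (hCK _ h))
      omega

/-! ### Hop counts -/

section Hop

variable {P : Set LPt} {x y z : LPt} {g : ℤ}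

theorem hexagon_iff (x : LPt) : x ∈ hexagon ↔ x = (0, 0) ∨ hexGraph.Adj x (0, 0) := by
  rw [adj_coord]
  simp only [hexagon, Set.mem_insert_iff, Set.mem_singleton_iff, Prod.ext_iff]
  omega

theorem hop_nonneg_iff : 0 ≤ hop P x ↔ (hopGraph P).Reachable x (0, 0) := by
  unfold hop
  split_ifs with h <;> simp [h]

theorem hop_eq_dist (h : 0 ≤ hop P x) : hop P x = ((hopGraph P).dist x (0, 0) : ℤ) := by
  unfold hop
  rw [if_pos (hop_nonneg_iff.1 h)]

theorem hop_origin : hop P (0, 0) = 0 := by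
  have h : 0 ≤ hop P (0, 0) := hop_nonneg_iff.2 (SimpleGraph.Reachable.refl _)
  rw [hop_eq_dist h]; simp

theorem hop_eq_zero_iff : hop P x = 0 ↔ x = (0, 0) := by
  constructor
  · intro h
    have h0 : 0 ≤ hop P x := h.ge
    rw [hop_eq_dist h0, Nat.cast_eq_zero,
      SimpleGraph.Reachable.dist_eq_zero_iff (hop_nonneg_iff.1 h0)] at h
    exact h
  · rintro rfl; exact hop_origin

/-- Every point with a positive hop count has a neighbour whose hop count is smaller by one. -/
theorem exists_lower (h : 0 < hop P x) : x ∈ P ∪ hexagon ∧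
    ∃ y, hexGraph.Adj x y ∧ hop P y = hop P x - 1 := by
  have hr := hop_nonneg_iff.1 h.le
  obtain ⟨w, hw⟩ := hr.exists_walk_length_eq_dist
  have he := hop_eq_dist h.le
  cases w with
  | nil => rw [hop_origin] at h; exact absurd h (lt_irrefl _)
  | @cons _ y _ hxy w =>
    refine ⟨hxy.2.1, y, hxy.1, ?_⟩
    have hy : 0 ≤ hop P y := hop_nonneg_iff.2 w.reachable
    have hy' := hop_eq_dist hy
    have h1 := SimpleGraph.dist_le w
    obtain ⟨w', hw'⟩ := w.reachable.exists_walk_length_eq_dist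
    have h2 := SimpleGraph.dist_le (SimpleGraph.Walk.cons hxy w')
    simp only [SimpleGraph.Walk.length_cons] at hw h2
    omega

theorem mem_of_hop_nonneg (h : 0 ≤ hop P x) : x ∈ P ∪ hexagon := by
  rcases h.eq_or_lt with h | h
  · rw [eq_comm, hop_eq_zero_iff] at h
    exact Or.inr ((hexagon_iff x).2 (Or.inl h))
  · exact (exists_lower h).1

theorem hop_le_succ (hxy : hexGraph.Adj x y) (hx : x ∈ P ∪ hexagon) (hy : 0 ≤ hop P y) :
    0 ≤ hop P x ∧ hop P x ≤ hop P y + 1 := by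
  have hadj : (hopGraph P).Adj x y := ⟨hxy, hx, mem_of_hop_nonneg hy⟩
  have hr := hop_nonneg_iff.1 hy
  have hx' : 0 ≤ hop P x := hop_nonneg_iff.2 (hadj.reachable.trans hr)
  refine ⟨hx', ?_⟩
  obtain ⟨w', hw'⟩ := hr.exists_walk_length_eq_dist
  have h2 := SimpleGraph.dist_le (SimpleGraph.Walk.cons hadj w')
  rw [SimpleGraph.Walk.length_cons] at h2
  rw [hop_eq_dist hx', hop_eq_dist hy]
  omega

theorem hop_eq_one_iff : hop P x = 1 ↔ hexGraph.Adj x (0, 0) := by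
  constructor
  · intro h
    obtain ⟨-, y, hxy, hy⟩ := exists_lower (P := P) (x := x) (by omega)
    rw [h, sub_self, hop_eq_zero_iff] at hy
    exact hy ▸ hxy
  · intro h
    have h1 := hop_le_succ (P := P) h (Or.inr ((hexagon_iff x).2 (Or.inr h))) hop_origin.ge
    have h2 : hop P x ≠ 0 := fun e => hexGraph.loopless.irrefl (0, 0) (hop_eq_zero_iff.1 e ▸ h)
    rw [hop_origin] at h1
    omega

theorem hop_le_one_of_mem_hexagon (h : x ∈ hexagon) : 0 ≤ hop P x ∧ hop P x ≤ 1 := by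
  rcases (hexagon_iff x).1 h with h | h
  · have := (hop_eq_zero_iff (P := P)).2 h; omega
  · have := (hop_eq_one_iff (P := P)).2 h; omega

theorem mem_of_two_le_hop (h : 2 ≤ hop P x) : x ∈ P := by
  rcases mem_of_hop_nonneg (P := P) (x := x) (by omega) with h' | h'
  · exact h'
  · have := hop_le_one_of_mem_hexagon (P := P) h'; omega

/-- `y` is a neighbour of `x` whose hop count is smaller by one. -/
def Lower (P : Set LPt) (x y : LPt) : Prop := hexGraph.Adj x y ∧ hop P y = hop P x - 1

/-- The points of hop count at most `g`. -/
def hopBall (P : Set LPt) (g : ℤ) : Set LPt := {x | 0 ≤ hop P x ∧ hop P x ≤ g}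

theorem exists_walk_to_origin (n : ℕ) : ∀ x, hop P x = n →
    ∃ w : hexGraph.Walk x (0, 0), ∀ a ∈ w.support, a ∈ hopBall P n := by
  induction n with
  | zero =>
    intro x hx
    obtain rfl := hop_eq_zero_iff.1 hx
    exact ⟨.nil, fun a ha => by
      rw [SimpleGraph.Walk.support_nil, List.mem_singleton] at ha
      subst ha; exact ⟨hx.ge, hx.le⟩⟩
  | succ n ih =>
    intro x hx
    obtain ⟨-, y, hxy, hy⟩ := exists_lower (P := P) (x := x) (by omega)
    obtain ⟨w, hw⟩ := ih y (by push_cast at hx; omega)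
    refine ⟨.cons hxy w, fun a ha => ?_⟩
    rw [SimpleGraph.Walk.support_cons, List.mem_cons] at ha
    rcases ha with rfl | ha
    · exact ⟨by omega, hx.le⟩
    · exact ⟨(hw a ha).1, (hw a ha).2.trans (by push_cast; omega)⟩

/-- Balls are connected. -/
theorem exists_walk_in_hopBall (hx : x ∈ hopBall P g) (hy : y ∈ hopBall P g) :
    ∃ w : hexGraph.Walk x y, ∀ a ∈ w.support, a ∈ hopBall P g := by
  have key : ∀ x ∈ hopBall P g, ∃ w : hexGraph.Walk x (0, 0), ∀ a ∈ w.support, a ∈ hopBall P g := by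
    intro x hx
    obtain ⟨w, hw⟩ := exists_walk_to_origin (P := P) (hop P x).toNat x
      (Int.toNat_of_nonneg hx.1).symm
    refine ⟨w, fun a ha => ⟨(hw a ha).1, (hw a ha).2.trans ?_⟩⟩
    rw [Int.toNat_of_nonneg hx.1]; exact hx.2
  obtain ⟨w, hw⟩ := key x hx
  obtain ⟨w', hw'⟩ := key y hy
  refine ⟨w.append w'.reverse, fun a ha => ?_⟩
  rw [SimpleGraph.Walk.mem_support_append_iff, SimpleGraph.Walk.support_reverse,
    List.mem_reverse] at ha
  exact ha.elim (hw a) (hw' a)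

end Hop

/-! ### Uniqueness of lower neighbours -/

/-- The bilinear form of `nsq`. -/
def bil (v w : LPt) : ℤ := 2 * v.1 * w.1 + v.1 * w.2 + v.2 * w.1 + 2 * v.2 * w.2

theorem nsq_add (v w : LPt) : nsq (v + w) = nsq v + nsq w + bil v w := by
  simp only [nsq, bil, Prod.fst_add, Prod.snd_add]; ring

/-- Three consecutive unit vectors make an angle of at most `π / 2` with a given vector. -/
theorem exists_three_bil_nonneg (v : LPt) : ∃ e, nsq e = 1 ∧ ∀ k ≤ 2, 0 ≤ bil v (rotCW^[k] e) := by
  have key : ∀ e, nsq e = 1 → 0 ≤ bil v e → 0 ≤ bil v (rotCW e) → 0 ≤ bil v (rotCW (rotCW e)) →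
      ∃ e, nsq e = 1 ∧ ∀ k ≤ 2, 0 ≤ bil v (rotCW^[k] e) := by
    intro e he h0 h1 h2
    refine ⟨e, he, fun k hk => ?_⟩
    interval_cases k
    exacts [h0, h1, h2]
  have h : ∃ e ∈ dirs, 0 ≤ bil v e ∧ 0 ≤ bil v (rotCW e) ∧ 0 ≤ bil v (rotCW (rotCW e)) := by
    simp only [dirs, bil, rotCW, List.mem_cons, List.not_mem_nil, or_false, exists_eq_or_imp,
      exists_eq_left]
    omega
  obtain ⟨e, he, h0, h1, h2⟩ := h
  exact key e ((mem_dirs e).1 he) h0 h1 h2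

/-- A finite set has a point three consecutive neighbours of which are farther from a given
centre, in half-lattice coordinates `c`, than all points of the set. -/
theorem exists_extremal {U : Set LPt} (hU : U.Finite) (hne : U.Nonempty) (c : LPt) :
    ∃ u ∈ U, ∃ e, nsq e = 1 ∧ ∀ k ≤ 2, u + rotCW^[k] e ∉ U ∧
      4 ≤ nsq (2 • (u + rotCW^[k] e) - c) := by
  obtain ⟨u, hu, hmax⟩ := hU.exists_maximalFor (fun u => nsq (2 • u - c)) U hne
  obtain ⟨e, he, hb⟩ := exists_three_bil_nonneg (2 • u - c)
  have key : ∀ k ≤ 2, nsq (2 • u - c) + 4 ≤ nsq (2 • (u + rotCW^[k] e) - c) := by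
    intro k hk
    have h1 : 2 • (u + rotCW^[k] e) - c = (2 • u - c) + 2 • rotCW^[k] e := by rw [smul_add]; abel
    have h2 : nsq (2 • rotCW^[k] e) = 4 * nsq (rotCW^[k] e) := by
      rw [two_smul]; simp only [nsq, Prod.fst_add, Prod.snd_add]; ring
    have h3 : bil (2 • u - c) (2 • rotCW^[k] e) = 2 * bil (2 • u - c) (rotCW^[k] e) := by
      rw [two_smul ℕ (rotCW^[k] e)]; simp only [bil, Prod.fst_add, Prod.snd_add]; ring
    have h4 := hb k hk
    rw [h1, nsq_add, h2, h3, nsq_iterate_rotCW, he]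
    omega
  have h0 : 0 ≤ nsq (2 • u - c) := by
    have h1 := nsq_nonneg_form (2 • u - c)
    have h2 := sq_nonneg (2 * (2 • u - c).1 + (2 • u - c).2)
    have h3 := sq_nonneg (2 • u - c).2
    omega
  refine ⟨u, hu, e, he, fun k hk => ⟨fun hin => ?_, by have := key k hk; omega⟩⟩
  have h1 := key k hk
  have h2 := hmax hin (by simp only; omega)
  simp only at h2
  omega

/-- The hypotheses on a set `P` of lattice points under which its hop counts behave like those of
a disk: `P` lies on one side of the central hexagon, is joined to it, and every finite region whose
outer boundary lies in `P` and the hexagon is contained in `P`. -/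
structure HoleFree (P : Set LPt) : Prop where
  half_plane : P ⊆ H₁ ∨ P ⊆ H₂
  hop_pos : ∀ x ∈ P, 0 < hop P x
  subset_of_enclosed : ∀ U : Set LPt, U.Finite → Disjoint U hexagon →
    (∀ u ∈ U, ∀ v, hexGraph.Adj u v → v ∈ U ∪ (P ∪ hexagon)) → U ⊆ P

/-- Lower neighbours of points of hop count `g` are equal or adjacent. -/
def LowerClique (P : Set LPt) (g : ℤ) : Prop :=
  ∀ x, hop P x = g → ∀ y y', Lower P x y → Lower P x y' → y = y' ∨ hexGraph.Adj y y'

/-- Adjacent points of hop count `g` have a common lower neighbour. -/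
def EdgeLower (P : Set LPt) (g : ℤ) : Prop :=
  ∀ x x', hop P x = g → hop P x' = g → hexGraph.Adj x x' → ∃ y, Lower P x y ∧ Lower P x' y

/-- Two adjacent points have exactly two common neighbours, opposite to each other. -/
theorem common_neighbours {a b p q : LPt} (hab : hexGraph.Adj a b) (hap : hexGraph.Adj a p)
    (hbp : hexGraph.Adj b p) (haq : hexGraph.Adj a q) (hbq : hexGraph.Adj b q) (hpq : p ≠ q) :
    q = a + b - p := by
  rw [adj_coord] at *
  rw [ne_eq, Prod.ext_iff] at hpq
  rw [Prod.ext_iff]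
  simp only [Prod.fst_add, Prod.snd_add, Prod.fst_sub, Prod.snd_sub]
  omega

/-- Consecutive neighbours of a point are adjacent. -/
theorem adj_rot (u e : LPt) (he : nsq e = 1) (k : ℕ) :
    hexGraph.Adj (u + rotCW^[k] e) (u + rotCW^[k + 1] e) := by
  have h := nsq_iterate_rotCW e k
  rw [adj_iff, Function.iterate_succ_apply']
  rw [he] at h
  rw [← h]
  simp only [nsq, rotCW, Prod.fst_add, Prod.snd_add, Prod.fst_sub, Prod.snd_sub]
  ring

theorem adj_dir (u e : LPt) (he : nsq e = 1) (k : ℕ) : hexGraph.Adj u (u + rotCW^[k] e) :=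
  (adj_add_iff _ _).2 (by rw [nsq_iterate_rotCW, he])

/-- A sphere does not bend by three consecutive neighbours around a point beyond it: the two
lower neighbours that this forces on the middle one are not adjacent. -/
theorem not_three_consecutive {P : Set LPt} {g : ℤ} (h1 : LowerClique P g) (h2 : EdgeLower P g)
    {u e : LPt} (hu : hop P u = g + 1) (he : nsq e = 1) (k : ℕ)
    (hv : ∀ l ≤ 2, hop P (u + rotCW^[k + l] e) = g) : False := by
  have ha := hv 0 (by omega)
  have hb := hv 1 (by omega)
  have hc := hv 2 le_rfl
  obtain ⟨p, hpa, hpb⟩ := h2 _ _ ha hb (adj_rot u e he k)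
  obtain ⟨q, hqb, hqc⟩ := h2 _ _ hb hc (adj_rot u e he (k + 1))
  have hup : u ≠ p := by rintro rfl; have := hpa.2; omega
  have huq : u ≠ q := by rintro rfl; have := hqb.2; omega
  have ep := common_neighbours (adj_rot u e he k) (adj_dir u e he _).symm (adj_dir u e he _).symm
    hpa.1 hpb.1 hup
  have eq := common_neighbours (adj_rot u e he (k + 1)) (adj_dir u e he _).symm
    (adj_dir u e he _).symm hqb.1 hqc.1 huq
  have h3 : nsq (p - q) = 3 := by
    have hn := nsq_iterate_rotCW e k
    have e1 : rotCW^[k + 1] e = rotCW (rotCW^[k] e) := Function.iterate_succ_apply' _ _ _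
    have e2 : rotCW^[k + 1 + 1] e = rotCW (rotCW (rotCW^[k] e)) := by
      rw [Function.iterate_succ_apply', e1]
    rw [he] at hn
    rw [ep, eq, e1, e2]
    simp only [nsq, rotCW, Prod.fst_add, Prod.snd_add, Prod.fst_sub, Prod.snd_sub] at hn ⊢
    linear_combination 3 * hn
  rcases h1 _ hb p q hpb hqb with rfl | h
  · simp [nsq] at h3
  · rw [adj_iff] at h; omega

/-- No region outside a ball is enclosed by the ball together with points `Z` of the next sphere
that lie close to a common centre. -/
theorem not_enclosed {P : Set LPt} (hP : HoleFree P) {g : ℤ} (hg : 1 ≤ g) (h1 : LowerClique P g)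
    (h2 : EdgeLower P g) {Z : Set LPt} (hZ : ∀ z ∈ Z, hop P z = g + 1) (c : LPt)
    (hc : ∀ z ∈ Z, nsq (2 • z - c) ≤ 1) {U : Set LPt} (hU : U.Finite) (hne : U.Nonempty)
    (hdis : Disjoint U (hopBall P g ∪ Z))
    (hcl : ∀ u ∈ U, ∀ v, hexGraph.Adj u v → v ∈ U ∪ (hopBall P g ∪ Z)) : False := by
  rw [Set.disjoint_left] at hdis
  have hUP : U ⊆ P := by
    refine hP.subset_of_enclosed U hU (Set.disjoint_left.2 fun u hu hu' => hdis hu (Or.inl ?_)) ?_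
    · have := hop_le_one_of_mem_hexagon (P := P) hu'
      exact ⟨this.1, by omega⟩
    · intro u hu v huv
      rcases hcl u hu v huv with h | h | h
      · exact Or.inl h
      · exact Or.inr (mem_of_hop_nonneg h.1)
      · exact Or.inr (Or.inl (mem_of_two_le_hop (by rw [hZ v h]; omega)))
  obtain ⟨u, hu, e, he, hk⟩ := exists_extremal hU hne c
  have hu0 := hP.hop_pos u (hUP hu)
  have hug : g < hop P u := by
    by_contra hcon
    exact hdis hu (Or.inl ⟨hu0.le, not_lt.1 hcon⟩)
  have hb : ∀ k ≤ 2, u + rotCW^[k] e ∈ hopBall P g := by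
    intro k hk2
    rcases hcl u hu _ (adj_dir u e he k) with h | h | h
    · exact absurd h (hk k hk2).1
    · exact h
    · have := (hk k hk2).2
      have := hc _ h
      omega
  have hle : ∀ k ≤ 2, hop P u ≤ hop P (u + rotCW^[k] e) + 1 := fun k hk2 =>
    (hop_le_succ (adj_dir u e he k) (Or.inl (hUP hu)) (hb k hk2).1).2
  refine not_three_consecutive h1 h2 (u := u) (e := e) ?_ he 0 fun l hl => ?_
  · have := hle 0 (by omega)
    have := (hb 0 (by omega)).2
    omega
  · rw [zero_add]
    have := hle l hl
    have := (hb l hl).2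
    omega

theorem exists_rot_eq : ∀ e ∈ dirs, ∀ e' ∈ dirs, ∃ j < 6, e' = rotCW^[j] e := by decide

theorem rotCW_six (e : LPt) : rotCW^[6] e = e := by
  simp only [Function.iterate_succ_apply', Function.iterate_zero, id, rotCW]
  ext <;> simp

theorem exists_rot {z y y' : LPt} (hy : hexGraph.Adj z y) (hy' : hexGraph.Adj z y') :
    ∃ e, nsq e = 1 ∧ ∃ j < 6, y = z + e ∧ y' = z + rotCW^[j] e := by
  have he : nsq (y - z) = 1 := by rw [nsq_sub_comm]; exact hy
  have he' : nsq (y' - z) = 1 := by rw [nsq_sub_comm]; exact hy'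
  obtain ⟨j, hj, e⟩ := exists_rot_eq _ ((mem_dirs _).2 he) _ ((mem_dirs _).2 he')
  exact ⟨y - z, he, j, hj, by abel, by rw [← e]; abel⟩

/-- If a point `z` beyond the ball had two lower neighbours that are not adjacent, then a closed
walk through `z` and the ball would separate two neighbours of `z` outside of the ball, and the ball
together with `z` would enclose a region. -/
theorem lowerClique_succ {P : Set LPt} (hP : HoleFree P) {g : ℤ} (hg : 1 ≤ g)
    (h1 : LowerClique P g) (h2 : EdgeLower P g) : LowerClique P (g + 1) := by
  intro z hz y y' hy hy'
  obtain ⟨e, he, j, hj, ey, ey'⟩ := exists_rot hy.1 hy'.1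
  by_contra hcon
  rw [not_or] at hcon
  have hzP : z ∈ P := mem_of_two_le_hop (by omega)
  have hyg : hop P (z + rotCW^[0] e) = g := by
    rw [Function.iterate_zero, id, ← ey, hy.2]; omega
  have hyg6 : hop P (z + rotCW^[6] e) = g := by
    rw [rotCW_six, ← ey, hy.2]; omega
  have hyg' : hop P (z + rotCW^[j] e) = g := by rw [← ey', hy'.2]; omega
  have lev : ∀ k, z + rotCW^[k] e ∈ hopBall P g → hop P (z + rotCW^[k] e) = g := by
    intro k hk
    have := hop_le_succ (adj_dir z e he k) (Or.inl hzP) hk.1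
    have := hk.2
    omega
  have three : ∀ k, ¬ ∀ l ≤ 2, hop P (z + rotCW^[k + l] e) = g := fun k hk =>
    not_three_consecutive h1 h2 hz he k hk
  have hj0 : j ≠ 0 := by
    rintro rfl
    exact hcon.1 (by rw [ey, ey']; rfl)
  have hj1 : j ≠ 1 := by
    rintro rfl
    exact hcon.2 (by rw [ey, ey']; exact adj_rot z e he 0)
  have hj5 : j ≠ 5 := by
    rintro rfl
    refine hcon.2 (SimpleGraph.Adj.symm ?_)
    have := adj_rot z e he 5
    rwa [rotCW_six, ← ey, ← ey'] at this
  -- on either side of the two lower neighbours there is a neighbour outside of the ball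
  obtain ⟨i, hi, hij, hi'⟩ : ∃ i, 0 < i ∧ i < j ∧ z + rotCW^[i] e ∉ hopBall P g := by
    by_contra! h
    refine three 0 fun l hl => ?_
    rw [zero_add]
    rcases Nat.eq_zero_or_pos l with rfl | hl0
    · exact hyg
    · rcases (show l ≤ j by omega).eq_or_lt with rfl | hlt
      · exact hyg'
      · exact lev l (h l hl0 hlt)
  obtain ⟨k, hjk, hk, hk'⟩ : ∃ k, j < k ∧ k < 6 ∧ z + rotCW^[k] e ∉ hopBall P g := by
    by_contra! h
    refine three 4 fun l hl => ?_
    rcases hl.eq_or_lt with rfl | hlt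
    · exact hyg6
    · rcases (show j ≤ 4 + l by omega).eq_or_lt with hjl | hjl
      · rw [← hjl]; exact hyg'
      · exact lev _ (h _ hjl (by omega))
  have memy : z + e ∈ hopBall P g := by
    have : hop P (z + e) = g := hyg
    exact ⟨by omega, this.le⟩
  have memy' : z + rotCW^[j] e ∈ hopBall P g := ⟨by omega, hyg'.le⟩
  obtain ⟨w, hw⟩ := exists_walk_in_hopBall memy memy'
  have hzb : z ∉ hopBall P g := fun h => by have := h.2; omega
  have hne : ∀ l, z + rotCW^[l] e ≠ z := fun l h => (adj_dir z e he l).ne h.symm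
  obtain ⟨U, hU, hUne, hdis, hcl⟩ := exists_pocket he hi hij hjk hk w (hopBall P g ∪ {z})
    (fun a ha => Or.inl (hw a ha)) (Or.inr rfl) (fun h => hzb (hw z h))
    (by rintro (h | h); exacts [hi' h, hne _ h]) (by rintro (h | h); exacts [hk' h, hne _ h])
  refine not_enclosed hP hg h1 h2 (Z := {z}) (by rintro a h; rw [h]; exact hz) (2 • z) ?_ hU hUne
    hdis hcl
  rintro a h
  rw [h]
  simp [nsq]

/-- If adjacent points `z`, `z'` beyond the ball had no common lower neighbour, then the two common
neighbours of `z` and `z'` would lie outside of the ball, and a closed walk through `z`, `z'` and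
the ball would separate them. -/
theorem edgeLower_succ {P : Set LPt} (hP : HoleFree P) {g : ℤ} (hg : 1 ≤ g)
    (h1 : LowerClique P g) (h2 : EdgeLower P g) : EdgeLower P (g + 1) := by
  intro z z' hz hz' hzz'
  have hzP : z ∈ P := mem_of_two_le_hop (by omega)
  obtain ⟨-, x, hx⟩ := exists_lower (P := P) (x := z) (by omega)
  obtain ⟨-, y, hy⟩ := exists_lower (P := P) (x := z') (by omega)
  by_contra! hcon
  obtain ⟨e, he, j, hj, ex, ez'⟩ := exists_rot hx.1 hzz'
  have hxg : hop P (z + e) = g := by rw [← ex, hx.2]; omega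
  have hyg : hop P y = g := by rw [hy.2]; omega
  have hj0 : j ≠ 0 := by
    rintro rfl
    rw [Function.iterate_zero, id, ← ex] at ez'
    have := hx.2
    rw [← ez'] at this
    omega
  have lowz' : ∀ v, Lower P z v → ¬ hexGraph.Adj z' v := fun v hv hadj =>
    hcon v hv ⟨hadj, by rw [hv.2]; omega⟩
  have hj1 : j ≠ 1 := by
    rintro rfl
    refine lowz' x hx (SimpleGraph.Adj.symm ?_)
    rw [ex, ez']; exact adj_rot z e he 0
  have hj5 : j ≠ 5 := by
    rintro rfl
    refine lowz' x hx ?_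
    have := adj_rot z e he 5
    rwa [rotCW_six, ← ex, ← ez'] at this
  obtain ⟨i, rfl⟩ : ∃ i, j = i + 1 := ⟨j - 1, by omega⟩
  have hlow : ∀ k, z + rotCW^[k] e ∈ hopBall P g → Lower P z (z + rotCW^[k] e) := by
    intro k hk
    have h3 := hop_le_succ (adj_dir z e he k) (Or.inl hzP) hk.1
    have h4 := hk.2
    exact ⟨adj_dir z e he k, by omega⟩
  have memx : z + e ∈ hopBall P g := ⟨by omega, hxg.le⟩
  obtain ⟨w, hw⟩ := exists_walk_in_hopBall (P := P) (g := g) memx ⟨by omega, hyg.le⟩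
  have hzb : z ∉ hopBall P g := fun h => by have := h.2; omega
  have hne : ∀ l, z + rotCW^[l] e ≠ z := fun l h => (adj_dir z e he l).ne h.symm
  have hw' : ∀ a ∈ (w.concat (ez' ▸ hy.1.symm)).support, a ∈ hopBall P g ∨ a = z' := by
    intro a ha
    rw [SimpleGraph.Walk.support_concat, List.mem_append, List.mem_singleton] at ha
    exact ha.imp (hw a) (fun h => h.trans ez'.symm)
  obtain ⟨U, hU, hUne, hdis, hcl⟩ := exists_pocket he (i := i) (j := i + 1) (k := i + 2)
    (by omega) (by omega) (by omega) (by omega) (w.concat (ez' ▸ hy.1.symm))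
    (hopBall P g ∪ {z, z'})
    (fun a ha => (hw' a ha).imp id Or.inr) (Or.inr (Or.inl rfl))
    (fun h => (hw' z h).elim hzb hzz'.ne)
    (by
      rintro (h | h | h)
      · exact lowz' _ (hlow _ h) (by rw [ez']; exact (adj_rot z e he i).symm)
      · exact hne _ h
      · exact (adj_rot z e he i).ne (by rw [← ez']; exact h))
    (by
      rintro (h | h | h)
      · exact lowz' _ (hlow _ h) (by rw [ez']; exact (adj_rot z e he (i + 1)))
      · exact hne _ h
      · exact (adj_rot z e he (i + 1)).ne (by rw [← ez']; exact h.symm))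
  -- `z` and `z'` are both at distance `1 / 2` from the midpoint of the edge between them
  refine not_enclosed hP hg h1 h2 (Z := {z, z'}) ?_ (z + z') ?_ hU hUne hdis hcl
  · rintro a (h | h) <;> rw [h]
    exacts [hz, hz']
  · rintro a (h | h) <;> rw [h]
    · rw [show (2 : ℕ) • z - (z + z') = z - z' by rw [two_smul]; abel]; exact hzz'.le
    · rw [show (2 : ℕ) • z' - (z + z') = z' - z by rw [two_smul]; abel]; exact hzz'.symm.le

theorem lowerClique_and_edgeLower {P : Set LPt} (hP : HoleFree P) (n : ℕ) :
    LowerClique P (n + 1) ∧ EdgeLower P (n + 1) := by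
  induction n with
  | zero =>
    constructor
    · intro x hx y y' hy hy'
      have h1 := hy.2
      have h2 := hy'.2
      rw [hx, Nat.cast_zero, zero_add, sub_self, hop_eq_zero_iff] at h1 h2
      exact Or.inl (h1.trans h2.symm)
    · intro x x' hx hx' _
      rw [Nat.cast_zero, zero_add] at hx hx'
      exact ⟨(0, 0), ⟨hop_eq_one_iff.1 hx, by rw [hop_origin, hx, sub_self]⟩,
        hop_eq_one_iff.1 hx', by rw [hop_origin, hx', sub_self]⟩
  | succ n ih =>
    push_cast
    exact ⟨lowerClique_succ hP (by omega) ih.1 ih.2, edgeLower_succ hP (by omega) ih.1 ih.2⟩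

theorem HoleFree.lower_adj {P : Set LPt} (hP : HoleFree P) {x y y' : LPt} (hx : 0 < hop P x)
    (hy : Lower P x y) (hy' : Lower P x y') : y = y' ∨ hexGraph.Adj y y' := by
  have h := (lowerClique_and_edgeLower hP (hop P x - 1).toNat).1
  rw [Int.toNat_of_nonneg (by omega), sub_add_cancel] at h
  exact h x rfl y y' hy hy'

theorem HoleFree.edge_lower {P : Set LPt} (hP : HoleFree P) {x x' : LPt} (hx : 0 < hop P x)
    (hx' : hop P x' = hop P x) (h : hexGraph.Adj x x') : ∃ y, Lower P x y ∧ Lower P x' y := by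
  have h' := (lowerClique_and_edgeLower hP (hop P x - 1).toNat).2
  rw [Int.toNat_of_nonneg (by omega), sub_add_cancel] at h'
  exact h' x x' rfl hx' h

/-! ### Ribbons as directed paths -/

theorem HoleFree.notMem_hexagon {P : Set LPt} (hP : HoleFree P) {x : LPt} (hx : x ∈ P) :
    x ∉ hexagon := by
  intro h
  simp only [hexagon, Set.mem_insert_iff, Set.mem_singleton_iff, Prod.ext_iff] at h
  rcases hP.half_plane with h' | h' <;> have := h' hx <;>
    simp only [H₁, H₂, Set.mem_ofPred_eq] at this <;> omega

theorem HoleFree.two_le_hop {P : Set LPt} (hP : HoleFree P) {x : LPt} (hx : x ∈ P) :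
    2 ≤ hop P x := by
  have h := hP.hop_pos x hx
  by_contra hcon
  exact hP.notMem_hexagon hx ((hexagon_iff x).2 (Or.inr ((hop_eq_one_iff (P := P)).1 (by omega))))

/-- The clockwise step of a point of a triangle around one of the other two points leads to the
third one. -/
theorem rot_triangle {x y y' : LPt} (h : hexGraph.Adj x y) (h' : hexGraph.Adj x y')
    (hyy : hexGraph.Adj y y') : y + rotCW (x - y) = y' ∨ y' + rotCW (x - y') = y := by
  rw [adj_coord] at *
  simp only [rotCW, Prod.ext_iff, Prod.fst_add, Prod.snd_add, Prod.fst_sub, Prod.snd_sub]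
  omega

theorem eq_of_rot_eq {a b y : LPt} (h : y + rotCW (a - y) = y + rotCW (b - y)) : a = b := by
  simp only [rotCW, Prod.ext_iff, Prod.fst_add, Prod.snd_add, Prod.fst_sub, Prod.snd_sub] at *
  omega

/-- If clockwise steps around the two ends of an edge lead to the same common neighbour of them, then
one of the steps starts at an end of the edge. -/
theorem rot_triangle' {a b y y' : LPt} (h : hexGraph.Adj (y + rotCW (a - y)) y')
    (ha : hexGraph.Adj a y)
    (hyy : hexGraph.Adj y y') (hab : y + rotCW (a - y) = y' + rotCW (b - y')) :
    a = y' ∨ b = y := by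
  rw [adj_coord] at *
  simp only [rotCW, Prod.ext_iff, Prod.fst_add, Prod.snd_add, Prod.fst_sub, Prod.snd_sub] at *
  omega

theorem adj_rotCW {x y : LPt} (h : hexGraph.Adj x y) :
    hexGraph.Adj x (y + rotCW (x - y)) ∧ hexGraph.Adj (y + rotCW (x - y)) y := by
  rw [adj_coord] at *
  rw [adj_coord]
  simp only [rotCW, Prod.fst_add, Prod.snd_add, Prod.fst_sub, Prod.snd_sub]
  omega

/-- The arc that starts at `x` leads clockwise around `c`. -/
def ArcAround (P : Set LPt) (x c x' : LPt) : Prop :=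
  x ∈ P ∧ x' ∈ P ∧ Lower P x c ∧ Lower P x' c ∧ x' = c + rotCW (x - c)

section Ribbon

variable {P : Set LPt} (hP : HoleFree P) {x y z a b c c' : LPt}

theorem arc_iff : Arc P x y ↔ ∃ c, ArcAround P x c y := by
  constructor
  · rintro ⟨hx, hy, e, c, hxc, hc, rfl⟩
    exact ⟨c, hx, hy, ⟨hxc, hc⟩, ⟨(adj_rotCW hxc).2, hc.trans (by rw [e])⟩, rfl⟩
  · rintro ⟨c, hx, hy, h1, h2, e⟩
    have := h1.2
    have := h2.2
    exact ⟨hx, hy, by omega, c, h1.1, h1.2, e⟩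

theorem Arc.levelAdj (h : Arc P x y) : (levelGraph P).Adj x y := by
  obtain ⟨hx, hy, e, c, hxc, hc, rfl⟩ := h
  exact ⟨(adj_rotCW hxc).1, hx, hy, e⟩

theorem hop_eq_of_transGen_arc (h : Relation.TransGen (Arc P) x y) : hop P y = hop P x := by
  induction h with
  | single h => exact h.2.2.1.symm
  | tail _ h ih => rw [← ih]; exact h.2.2.1.symm

include hP

/-- Each point of `P` has at most one outgoing arc. -/
theorem HoleFree.arc_out (h : ArcAround P x c a) (h' : ArcAround P x c' b) : c = c' ∧ a = b := by
  obtain ⟨hx, ha, h1, h2, ea⟩ := h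
  obtain ⟨-, hb, h3, h4, eb⟩ := h'
  have e1 := h1.2
  have e2 := h2.2
  have e3 := h3.2
  have e4 := h4.2
  rcases hP.lower_adj (hP.hop_pos x hx) h1 h3 with rfl | hcc
  · exact ⟨rfl, ea.trans eb.symm⟩
  · rcases rot_triangle h1.1 h3.1 hcc with e | e
    · rw [← ea] at e; subst e; omega
    · rw [← eb] at e; subst e; omega

/-- Each point of `P` has at most one incoming arc. -/
theorem HoleFree.arc_in (h : Arc P a x) (h' : Arc P b x) : a = b := by
  obtain ⟨c, ha, hx, h1, h2, ea⟩ := arc_iff.1 h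
  obtain ⟨c', hb, -, h3, h4, eb⟩ := arc_iff.1 h'
  have e1 := h1.2
  have e2 := h2.2
  have e3 := h3.2
  have e4 := h4.2
  rcases hP.lower_adj (hP.hop_pos x hx) h2 h4 with rfl | hcc
  · exact eq_of_rot_eq (ea.symm.trans eb)
  · rcases rot_triangle' (ea ▸ h4.1) h1.1 hcc (ea.symm.trans eb) with e | e
    · subst e; omega
    · subst e; omega

theorem HoleFree.arc_or_arc (h : (levelGraph P).Adj x y) : Arc P x y ∨ Arc P y x := by
  obtain ⟨hxy, hx, hy, e⟩ := h
  obtain ⟨c, h1, h2⟩ := hP.edge_lower (hP.hop_pos x hx) e.symm hxy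
  rcases rot_triangle h1.1.symm h2.1.symm hxy with e' | e'
  all_goals
    have h3 := h1.1
    have h4 := h2.1
    have : y = c + rotCW (x - c) ∨ x = c + rotCW (y - c) := by
      rw [adj_coord] at *
      simp only [rotCW, Prod.ext_iff, Prod.fst_add, Prod.snd_add, Prod.fst_sub, Prod.snd_sub] at *
      omega
    exact this.imp (fun e => arc_iff.2 ⟨c, hx, hy, h1, h2, e⟩)
      (fun e => arc_iff.2 ⟨c, hy, hx, h2, h1, e⟩)

/-- Of two lower neighbours of a point the one around which the point moves on is the next one on
its own ribbon. -/
theorem HoleFree.arc_lower (hc : Lower P x c) (h : ArcAround P x c' y) (hcc : c ≠ c')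
    (hcP : c ∈ P) (hcP' : c' ∈ P) : Arc P c c' := by
  obtain ⟨hx, hy, h1, h2, ey⟩ := h
  have hadj := (hP.lower_adj (hP.hop_pos x hx) hc h1).resolve_left hcc
  have e1 := hc.2
  have e2 := h1.2
  have e3 := h2.2
  obtain ⟨u, hu1, hu2⟩ := hP.edge_lower (hP.hop_pos c hcP) (by omega) hadj
  have hux : u ≠ x := by rintro rfl; have := hu1.2; omega
  have hyc : y ≠ c := by rintro rfl; omega
  refine arc_iff.2 ⟨u, hcP, hcP', hu1, hu2, ?_⟩
  obtain rfl := common_neighbours hadj hc.1.symm h1.1.symm hu1.1 hu2.1 hux.symm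
  have hrot := (rot_triangle hc.1 h1.1 hadj).resolve_right (fun e => hyc (ey.trans e))
  simp only [rotCW, Prod.ext_iff, Prod.fst_add, Prod.snd_add, Prod.fst_sub, Prod.snd_sub] at hrot ⊢
  omega

/-- While a point moves along a ribbon, the point around which it moves advances along the parent
ribbon. -/
theorem HoleFree.centre_mono (hx3 : 3 ≤ hop P x) (h : Relation.TransGen (Arc P) x y) :
    ∀ c, (∃ a, ArcAround P x c a) → ∀ c', (∃ b, ArcAround P y c' b) →
      Relation.ReflTransGen (Arc P) c c' := by
  have single : ∀ x y, 3 ≤ hop P x → Arc P x y → ∀ c, (∃ a, ArcAround P x c a) → ∀ c',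
      (∃ b, ArcAround P y c' b) → Relation.ReflTransGen (Arc P) c c' := by
    rintro x y hx3 hxy c ⟨a, ha⟩ c' ⟨b, hb⟩
    obtain ⟨c₁, h1⟩ := arc_iff.1 hxy
    obtain ⟨rfl, rfl⟩ := hP.arc_out ha h1
    by_cases hcc : c = c'
    · rw [hcc]
    · have e1 := ha.2.2.1.2
      have e2 := ha.2.2.2.1.2
      have e3 := hb.2.2.1.2
      exact .single (hP.arc_lower ha.2.2.2.1 hb hcc (mem_of_two_le_hop (by omega))
        (mem_of_two_le_hop (by omega)))
  induction h with
  | single h => exact single _ _ hx3 h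
  | @tail y z hxy hyz ih =>
    intro c hc c' hc'
    obtain ⟨c₁, h1⟩ := arc_iff.1 hyz
    have hy3 : 3 ≤ hop P y := by rw [hop_eq_of_transGen_arc hxy]; exact hx3
    exact (ih c hc c₁ ⟨z, h1⟩).trans (single y z hy3 hyz c₁ ⟨z, h1⟩ c' hc')

/-- Along the ribbon of gradient two the first coordinate is monotone. -/
theorem HoleFree.acyclic_two (hx : hop P x = 2) : ¬ Relation.TransGen (Arc P) x x := by
  have key : ∀ a b, Arc P a b → hop P a = 2 →
      (P ⊆ H₁ → a.1 < b.1) ∧ (P ⊆ H₂ → b.1 < a.1) := by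
    intro a b hab ha
    obtain ⟨c, haP, hbP, h1, h2, e⟩ := arc_iff.1 hab
    have hc : hop P c = 1 := by rw [h1.2]; omega
    rw [hop_eq_one_iff] at hc
    have h3 := h1.1
    have h4 := h2.1
    rw [adj_coord] at hc h3 h4
    simp only [rotCW, Prod.ext_iff, Prod.fst_add, Prod.snd_add, Prod.fst_sub, Prod.snd_sub] at e
    constructor
    · intro hH
      have h5 : 2 ≤ a.2 := hH haP
      have h6 : 2 ≤ b.2 := hH hbP
      omega
    · intro hH
      have h5 : a.2 ≤ -2 := hH haP
      have h6 : b.2 ≤ -2 := hH hbP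
      omega
  have key2 : ∀ y, Relation.TransGen (Arc P) x y →
      hop P y = 2 ∧ (P ⊆ H₁ → x.1 < y.1) ∧ (P ⊆ H₂ → y.1 < x.1) := by
    intro y h
    induction h with
    | single h => exact ⟨by rw [← hx]; exact h.2.2.1.symm, key _ _ h hx⟩
    | tail _ h ih =>
      exact ⟨by rw [← ih.1]; exact h.2.2.1.symm,
        fun hH => (ih.2.1 hH).trans ((key _ _ h ih.1).1 hH),
        fun hH => ((key _ _ h ih.1).2 hH).trans (ih.2.2 hH)⟩
  intro h
  rcases hP.half_plane with hH | hH
  · exact lt_irrefl _ ((key2 x h).2.1 hH)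
  · exact lt_irrefl _ ((key2 x h).2.2 hH)

/-- A directed cycle on a ribbon would, by `HoleFree.centre_mono`, run around a directed cycle on
the parent ribbon or around a single point. -/
theorem HoleFree.acyclic_succ {g : ℤ} (hg : 2 ≤ g)
    (ih : ∀ x, hop P x = g → ¬ Relation.TransGen (Arc P) x x) (hx : hop P x = g + 1) :
    ¬ Relation.TransGen (Arc P) x x := by
  intro h
  obtain ⟨a, ha, -⟩ := Relation.TransGen.head'_iff.1 h
  obtain ⟨c, hc⟩ := arc_iff.1 ha
  have hcx := hc.2.2.1
  have hcg : hop P c = g := by rw [hcx.2]; omega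
  have step : ∀ b, Relation.TransGen (Arc P) x b → Relation.TransGen (Arc P) b x →
      ∃ b', ArcAround P b c b' ∧ Relation.TransGen (Arc P) x b' ∧
        Relation.TransGen (Arc P) b' x := by
    intro b h1 h2
    obtain ⟨b', hb, hb'⟩ := Relation.TransGen.head'_iff.1 h2
    obtain ⟨c', hc'⟩ := arc_iff.1 hb
    have hbg : hop P b = g + 1 := by rw [hop_eq_of_transGen_arc h1]; exact hx
    have m1 := hP.centre_mono (by omega) h1 c ⟨a, hc⟩ c' ⟨b', hc'⟩
    have m2 := hP.centre_mono (by omega) h2 c' ⟨b', hc'⟩ c ⟨a, hc⟩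
    obtain rfl : c = c' := by
      rcases Relation.reflTransGen_iff_eq_or_transGen.1 m1 with e | m1
      · exact e.symm
      · exact absurd (m1.trans_left m2) (ih c hcg)
    refine ⟨b', hc', h1.tail hb, ?_⟩
    rcases Relation.reflTransGen_iff_eq_or_transGen.1 hb' with e | h3
    · rw [← e]; exact h
    · exact h3
  -- the cycle runs once around `c`, which leaves no room for a lower neighbour of `c`
  have turn : ∀ k, hop P (c + rotCW^[k] (x - c)) = g + 1 ∧
      Relation.TransGen (Arc P) x (c + rotCW^[k] (x - c)) ∧
        Relation.TransGen (Arc P) (c + rotCW^[k] (x - c)) x := by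
    intro k
    induction k with
    | zero =>
      rw [Function.iterate_zero, id, add_sub_cancel]
      exact ⟨hx, h, h⟩
    | succ k ihk =>
      obtain ⟨b', hb', h1, h2⟩ := step _ ihk.2.1 ihk.2.2
      have e := hb'.2.2.2.2
      rw [add_sub_cancel_left, ← Function.iterate_succ_apply' rotCW k] at e
      rw [← e]
      refine ⟨?_, h1, h2⟩
      rw [← ihk.1]
      exact (arc_iff.2 ⟨c, hb'⟩).2.2.1.symm
  obtain ⟨-, d, hd, hd'⟩ := exists_lower (P := P) (x := c) (by omega)
  obtain ⟨e, -, j, -, ex, ed⟩ := exists_rot hcx.1.symm hd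
  have := (turn j).1
  rw [ex, add_sub_cancel_left, ← ed] at this
  omega

theorem HoleFree.acyclic (hx : x ∈ P) : ¬ Relation.TransGen (Arc P) x x := by
  have : ∀ n : ℕ, ∀ x, hop P x = n + 2 → ¬ Relation.TransGen (Arc P) x x := by
    intro n
    induction n with
    | zero => intro x hx; exact hP.acyclic_two (by simpa using hx)
    | succ n ih =>
      intro x hx
      exact hP.acyclic_succ (g := n + 2) (by omega) ih (by push_cast at hx; omega)
  have h2 := hP.two_le_hop hx
  exact this (hop P x - 2).toNat x (by omega)

omit hP

theorem levelReachable_hop (h : (levelGraph P).Reachable x y) : hop P y = hop P x := by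
  obtain ⟨w⟩ := h
  induction w with
  | nil => rfl
  | cons h _ ih => exact ih.trans h.2.2.2.symm

theorem levelReachable_mem (h : (levelGraph P).Reachable x y) : x ∈ P → y ∈ P := by
  obtain ⟨w⟩ := h
  induction w with
  | nil => exact id
  | cons h _ ih => exact fun _ => ih h.2.2.1

theorem ribbonOf_eq_iff (hy : y ∈ P) :
    ribbonOf P x = ribbonOf P y ↔ (levelGraph P).Reachable x y := by
  constructor
  · intro h
    have : y ∈ ribbonOf P y := ⟨hy, SimpleGraph.Reachable.refl _⟩
    rw [← h] at this
    exact this.2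
  · intro h
    ext z
    exact ⟨fun hz => ⟨hz.1, h.symm.trans hz.2⟩, fun hz => ⟨hz.1, h.trans hz.2⟩⟩

theorem ribbonOf_mem (hx : x ∈ P) : ribbonOf P x ∈ ribbonization P := ⟨x, hx, rfl⟩

theorem hasGradient_ribbonOf : HasGradient P (ribbonOf P x) (hop P x) :=
  fun _ hy => levelReachable_hop hy.2

include hP

/-- A ribbon is a directed path. -/
theorem HoleFree.ribbon_total (h : (levelGraph P).Reachable x y) :
    Relation.ReflTransGen (Arc P) x y ∨ Relation.ReflTransGen (Arc P) y x := by
  obtain ⟨w⟩ := h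
  induction w with
  | nil => exact Or.inl .refl
  | @cons x a y h _ ih =>
    rcases hP.arc_or_arc h with h1 | h1
    · rcases ih with h2 | h2
      · exact Or.inl (.head h1 h2)
      · rcases Relation.ReflTransGen.cases_tail h2 with e | ⟨b, h3, h4⟩
        · rw [← e]; exact Or.inl (.single h1)
        · obtain rfl := hP.arc_in h1 h4
          exact Or.inr h3
    · rcases ih with h2 | h2
      · rcases Relation.ReflTransGen.cases_head h2 with e | ⟨b, h3, h4⟩
        · rw [← e]; exact Or.inr (.single h1)
        · obtain ⟨c, h1⟩ := arc_iff.1 h1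
          obtain ⟨c', h3⟩ := arc_iff.1 h3
          obtain ⟨-, rfl⟩ := hP.arc_out h1 h3
          exact Or.inl h4
      · exact Or.inr (.tail h2 h1)

/-- All lower neighbours of the points of a ribbon lie on one ribbon, its parent. -/
theorem HoleFree.isParent (hx : x ∈ P) (hy : y ∈ P) (hxy : Lower P x y) :
    IsParent P (ribbonOf P y) (ribbonOf P x) := by
  have key : ∀ {a b}, (levelGraph P).Reachable a b → a ∈ P → 2 < hop P a →
      ∀ v v', Lower P a v → Lower P b v' → (levelGraph P).Reachable v v' := by
    rintro a b ⟨w⟩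
    have clique : ∀ a v v', a ∈ P → 2 < hop P a → Lower P a v → Lower P a v' →
        (levelGraph P).Reachable v v' := by
      intro a v v' ha h2 hv hv'
      rcases hP.lower_adj (by omega) hv hv' with rfl | h
      · exact .refl _
      · have e1 := hv.2
        have e2 := hv'.2
        exact SimpleGraph.Adj.reachable ⟨h, mem_of_two_le_hop (by omega),
          mem_of_two_le_hop (by omega), by omega⟩
    induction w with
    | nil => intro ha h2 v v'; exact clique _ v v' ha h2
    | @cons a c b h _ ih =>
      intro ha h2 v v' hv hv'
      obtain ⟨u, hu1, hu2⟩ := hP.edge_lower (by omega) h.2.2.2.symm h.1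
      have e := h.2.2.2
      exact (clique a v u ha h2 hv hu1).trans (ih h.2.2.1 (by omega) u v' hu2 hv')
  have hy2 := hP.two_le_hop hy
  have e := hxy.2
  refine ⟨ribbonOf_mem hy, ribbonOf_mem hx, ⟨hop P y, hasGradient_ribbonOf, ?_⟩, ?_⟩
  · rw [hxy.2, sub_add_cancel]; exact hasGradient_ribbonOf
  · intro x' hx'
    have e' := levelReachable_hop hx'.2
    obtain ⟨-, y', hy'⟩ := exists_lower (P := P) (x := x') (by omega)
    have := key hx'.2 hx (by omega) y y' hxy hy'
    exact ⟨y', ⟨levelReachable_mem this hy, this⟩, hy'.1⟩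

/-! ### The order of the points -/

variable {lt : Set LPt → Set LPt → Prop}

theorem HoleFree.pointLT_of_lower (hlt : IsCompleteTreeOrder P lt) (hx : x ∈ P) (hy : y ∈ P)
    (hxy : Lower P x y) : PointLT P lt y x :=
  Or.inl (hlt.extend _ _ (.single (hP.isParent hx hy hxy)))

theorem HoleFree.pointLT_irrefl (hlt : IsCompleteTreeOrder P lt) (hx : x ∈ P) :
    ¬ PointLT P lt x x := by
  rintro (h | h)
  · exact hlt.irrefl _ (ribbonOf_mem hx) h
  · exact hP.acyclic hx h.2

omit hP in
theorem pointLT_trans (hlt : IsCompleteTreeOrder P lt) (hx : x ∈ P) (hy : y ∈ P) (hz : z ∈ P)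
    (h : PointLT P lt x y) (h' : PointLT P lt y z) : PointLT P lt x z := by
  rcases h with h | h <;> rcases h' with h' | h'
  · exact Or.inl (hlt.trans _ (ribbonOf_mem hx) _ (ribbonOf_mem hy) _ (ribbonOf_mem hz) h h')
  · exact Or.inl (h'.1 ▸ h)
  · exact Or.inl (h.1.symm ▸ h')
  · exact Or.inr ⟨h.1.trans h'.1, h'.2.trans h.2⟩

theorem HoleFree.pointLT_total (hlt : IsCompleteTreeOrder P lt) (hx : x ∈ P) (hy : y ∈ P)
    (hne : x ≠ y) : PointLT P lt x y ∨ PointLT P lt y x := by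
  rcases hlt.total _ (ribbonOf_mem hx) _ (ribbonOf_mem hy) with h | h | h
  · exact Or.inl (Or.inl h)
  · rcases hP.ribbon_total ((ribbonOf_eq_iff hy).1 h) with h' | h' <;>
      rcases Relation.reflTransGen_iff_eq_or_transGen.1 h' with e | h''
    · exact absurd e.symm hne
    · exact Or.inr (Or.inr ⟨h.symm, h''⟩)
    · exact absurd e hne
    · exact Or.inl (Or.inr ⟨h, h''⟩)
  · exact Or.inr (Or.inl h)

/-- `A` is an initial segment of `P` for the order of the points. -/
def IsInitial (P : Set LPt) (lt : Set LPt → Set LPt → Prop) (A : Set LPt) : Prop :=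
  A ⊆ P ∧ ∀ x ∈ A, ∀ y ∈ P, PointLT P lt y x → y ∈ A

theorem IsInitial.lower_mem {A : Set LPt} (hA : IsInitial P lt A)
    (hlt : IsCompleteTreeOrder P lt) (hx : x ∈ A) (hy : y ∈ P) (hxy : Lower P x y) : y ∈ A :=
  hA.2 x hx y hy (hP.pointLT_of_lower hlt (hA.1 hx) hy hxy)

/-- If `z` lies in `P` between two points of an initial segment that are not adjacent, then `z`, or
another common neighbour, is in the initial segment. -/
theorem IsInitial.common_neighbour {A : Set LPt} (hA : IsInitial P lt A)
    (hlt : IsCompleteTreeOrder P lt) (hx : x ∈ A) (hy : y ∈ A) (hz : z ∈ P)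
    (hxz : hexGraph.Adj x z) (hyz : hexGraph.Adj y z) (hne : x ≠ y) (hxy : ¬ hexGraph.Adj x y) :
    ∃ v ∈ A, hexGraph.Adj x v ∧ hexGraph.Adj y v := by
  have mixed : ∀ x y, x ∈ A → y ∈ A → hexGraph.Adj x z → hexGraph.Adj y z → ¬ hexGraph.Adj x y →
      hop P x = hop P z → Lower P z y → ∃ v ∈ A, hexGraph.Adj x v ∧ hexGraph.Adj y v := by
    intro x y hx hy hxz hyz hxy e hzy
    obtain ⟨v, h1, h2⟩ := hP.edge_lower (hP.hop_pos z hz) e hxz.symm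
    have e1 := h1.2
    have e2 := hzy.2
    have e3 := hP.two_le_hop (hA.1 hy)
    have hvA : v ∈ A := hA.lower_mem hP hlt hx (mem_of_two_le_hop (by omega)) h2
    rcases hP.lower_adj (hP.hop_pos z hz) h1 hzy with rfl | h
    · exact absurd h2.1 hxy
    · exact ⟨v, hvA, h2.1, h.symm⟩
  have hx0 := (hP.hop_pos x (hA.1 hx))
  have hy0 := (hP.hop_pos y (hA.1 hy))
  have hz0 := (hP.hop_pos z hz)
  have h1 := (hop_le_succ hxz (Or.inl (hA.1 hx)) hz0.le).2
  have h2 := (hop_le_succ hyz (Or.inl (hA.1 hy)) hz0.le).2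
  have h3 := (hop_le_succ hxz.symm (Or.inl hz) hx0.le).2
  have h4 := (hop_le_succ hyz.symm (Or.inl hz) hy0.le).2
  by_cases c1 : hop P x = hop P z + 1
  · exact ⟨z, hA.lower_mem hP hlt hx hz ⟨hxz, by omega⟩, hxz, hyz⟩
  by_cases c2 : hop P y = hop P z + 1
  · exact ⟨z, hA.lower_mem hP hlt hy hz ⟨hyz, by omega⟩, hxz, hyz⟩
  by_cases c3 : hop P x = hop P z <;> by_cases c4 : hop P y = hop P z
  · have hR : ∀ w ∈ A, Arc P w z → z ∈ A := fun w hw h =>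
      hA.2 w hw z hz (Or.inr ⟨((ribbonOf_eq_iff hz).2 h.levelAdj.reachable).symm,
        .single h⟩)
    rcases hP.arc_or_arc ⟨hxz, hA.1 hx, hz, c3⟩ with h | h
    · exact ⟨z, hR x hx h, hxz, hyz⟩
    · rcases hP.arc_or_arc ⟨hyz, hA.1 hy, hz, c4⟩ with h' | h'
      · exact ⟨z, hR y hy h', hxz, hyz⟩
      · obtain ⟨_, h⟩ := arc_iff.1 h
        obtain ⟨_, h'⟩ := arc_iff.1 h'
        exact absurd (hP.arc_out h h').2 hne
  · exact mixed x y hx hy hxz hyz hxy c3 ⟨hyz.symm, by omega⟩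
  · obtain ⟨v, hv, h5, h6⟩ := mixed y x hy hx hyz hxz (fun h => hxy h.symm) c4
      ⟨hxz.symm, by omega⟩
    exact ⟨v, hv, h6, h5⟩
  · rcases hP.lower_adj hz0 ⟨hxz.symm, by omega⟩ ⟨hyz.symm, by omega⟩ with h | h
    · exact absurd h hne
    · exact absurd h hxy

end Ribbon

/-! ### The shape and the idle half-plane are hole-free -/

theorem hexagon_coord (x : LPt) : x ∈ hexagon ↔
    (x.1 = 0 ∧ x.2 = 0) ∨ (x.1 = -1 ∧ x.2 = 1) ∨ (x.1 = 0 ∧ x.2 = 1) ∨ (x.1 = 1 ∧ x.2 = 0) ∨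
    (x.1 = 1 ∧ x.2 = -1) ∨ (x.1 = 0 ∧ x.2 = -1) ∨ (x.1 = -1 ∧ x.2 = 0) := by
  simp only [hexagon, Set.mem_insert_iff, Set.mem_singleton_iff, Prod.ext_iff]

theorem adj_mk (x : LPt) (a b : ℤ) : hexGraph.Adj x (a, b) ↔
    (a = x.1 + 1 ∧ b = x.2) ∨ (a = x.1 ∧ b = x.2 + 1) ∨ (a = x.1 - 1 ∧ b = x.2 + 1) ∨
    (a = x.1 - 1 ∧ b = x.2) ∨ (a = x.1 ∧ b = x.2 - 1) ∨ (a = x.1 + 1 ∧ b = x.2 - 1) :=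
  adj_coord x (a, b)

theorem hexagon_mk (a b : ℤ) : (a, b) ∈ hexagon ↔
    (a = 0 ∧ b = 0) ∨ (a = -1 ∧ b = 1) ∨ (a = 0 ∧ b = 1) ∨ (a = 1 ∧ b = 0) ∨
    (a = 1 ∧ b = -1) ∨ (a = 0 ∧ b = -1) ∨ (a = -1 ∧ b = 0) :=
  hexagon_coord (a, b)

theorem adj_mk_left (x : LPt) (a b : ℤ) : hexGraph.Adj (a, b) x ↔
    (a = x.1 + 1 ∧ b = x.2) ∨ (a = x.1 ∧ b = x.2 + 1) ∨ (a = x.1 - 1 ∧ b = x.2 + 1) ∨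
    (a = x.1 - 1 ∧ b = x.2) ∨ (a = x.1 ∧ b = x.2 - 1) ∨ (a = x.1 + 1 ∧ b = x.2 - 1) :=
  (hexGraph.adj_comm _ _).trans (adj_mk x a b)

/-- From a point outside the hexagon in a row that does not meet `P`, the row leads to infinity. -/
theorem not_enclosed_of_free_row {P U : Set LPt} (hU : U.Finite) (hdis : Disjoint U hexagon)
    (hcl : ∀ u ∈ U, ∀ v, hexGraph.Adj u v → v ∈ U ∪ (P ∪ hexagon)) {u : LPt} (hu : u ∈ U)
    (hrow : ∀ v : LPt, v.2 = u.2 → v ∉ P) : False := by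
  rw [Set.disjoint_left] at hdis
  have hu' := hdis hu
  obtain ⟨σ, hσ, hray⟩ : ∃ σ : ℤ, (σ = 1 ∨ σ = -1) ∧
      ∀ k : ℕ, (u.1 + σ * k, u.2) ∉ hexagon := by
    rw [hexagon_coord] at hu'
    by_cases h : 1 ≤ u.1
    · exact ⟨1, Or.inl rfl, fun k => by rw [hexagon_mk]; omega⟩
    · exact ⟨-1, Or.inr rfl, fun k => by rw [hexagon_mk]; omega⟩
  have hmem : ∀ k : ℕ, (u.1 + σ * k, u.2) ∈ U := by
    intro k
    induction k with
    | zero => simpa using hu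
    | succ k ih =>
      have hadj : hexGraph.Adj (u.1 + σ * k, u.2) (u.1 + σ * (k + 1 : ℕ), u.2) := by
        rw [adj_mk]
        push_cast
        rcases hσ with rfl | rfl <;> omega
      rcases hcl _ ih _ hadj with h | h | h
      · exact h
      · exact absurd h (hrow _ rfl)
      · exact absurd h (hray _)
  refine Set.infinite_of_injective_forall_mem (f := fun k : ℕ => (u.1 + σ * k, u.2)) ?_ hmem hU
  intro k l hkl
  simp only [Prod.mk.injEq, and_true, add_right_inj] at hkl
  rcases hσ with rfl | rfl <;> omega

/-- The points of the root ribbon of a shape with a proper ribbonization: the three points beyond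
the line `p₁ p₂` that are adjacent to `p₁` or `p₂`. -/
def rootRibbon : List LPt := [(-2, 2), (-1, 2), (0, 2)]

theorem mem_rootRibbon (x : LPt) : x ∈ rootRibbon ↔ x.2 = 2 ∧ (x.1 = -2 ∨ x.1 = -1 ∨ x.1 = 0) := by
  simp only [rootRibbon, List.mem_cons, List.not_mem_nil, or_false, Prod.ext_iff]
  omega

theorem exists_adj_of_hop_two {P : Set LPt} {x : LPt} (h : hop P x = 2) :
    ∃ y, hexGraph.Adj x y ∧ hexGraph.Adj y (0, 0) := by
  obtain ⟨-, y, hxy, hy⟩ := exists_lower (P := P) (x := x) (by omega)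
  exact ⟨y, hxy, (hop_eq_one_iff (P := P)).1 (by omega)⟩

/-- Only three points beyond the seeds can have hop count two, so the root ribbon consists of them.
-/
theorem IsProperRibbonization.mem_of_rootRibbon {S : Set LPt} (hS : IsProperRibbonization S)
    {x : LPt} (hx : x ∈ rootRibbon) : x ∈ S ∧ hop S x = 2 := by
  obtain ⟨R, ⟨x₀, hx₀, rfl⟩, hg, hcard, -⟩ := hS.root
  have hsub : ribbonOf S x₀ ⊆ {((-2 : ℤ), (2 : ℤ)), (-1, 2), (0, 2)} := by
    intro y hy
    have h2 : 2 ≤ y.2 := hS.subset_H₁ hy.1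
    obtain ⟨z, h3, h4⟩ := exists_adj_of_hop_two (hg y hy)
    rw [adj_coord] at h3 h4
    simp only [Set.mem_insert_iff, Set.mem_singleton_iff, Prod.ext_iff]
    omega
  have hle : ({((-2 : ℤ), (2 : ℤ)), (-1, 2), (0, 2)} : Set LPt).ncard ≤ 3 :=
    (Set.ncard_insert_le _ _).trans (Nat.succ_le_succ
      ((Set.ncard_insert_le _ _).trans (Nat.succ_le_succ (Set.ncard_singleton _).le)))
  have heq := Set.eq_of_subset_of_ncard_le hsub (hle.trans hcard.ge)
  have hxR : x ∈ ribbonOf S x₀ := by rw [heq]; simpa [rootRibbon] using hx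
  exact ⟨hxR.1, hg x hxR⟩

/-- A region enclosed by the shape and the hexagon lies in the shape: a point of it outside of the
shape is joined to infinity through the complement of the shape. Such a path can leave the region
only through the hexagon, from a row that does not meet the shape, and this row leads to infinity
within the region. -/
theorem holeFree_shape {S : Set LPt} (hS : IsProperRibbonization S) (hfin : S.Finite)
    (hS' : NoLatticeHoles S) : HoleFree S where
  half_plane := Or.inl hS.subset_H₁
  hop_pos := hS.hop_pos
  subset_of_enclosed U hU hdis hcl := by
    intro u hu
    by_contra huS
    have hdis' := Set.disjoint_left.1 hdis
    -- the part of `U` outside of `S` is closed under adjacency in the complement of `S`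
    have step : ∀ x y, x ∈ U → x ∉ S → y ∉ S → hexGraph.Adj x y → y ∈ U := by
      intro x y hx hxS hyS hxy
      rcases hcl x hx y hxy with h | h | h
      · exact h
      · exact absurd h hyS
      · exfalso
        refine not_enclosed_of_free_row hU hdis hcl hx fun v hv hvS => ?_
        have h1 : 2 ≤ v.2 := hS.subset_H₁ hvS
        have h2 : x ∉ rootRibbon := fun h => hxS (hS.mem_of_rootRibbon h).1
        have h3 := hdis' hx
        rw [hexagon_coord] at h
        rw [mem_rootRibbon] at h2
        rw [adj_coord] at hxy
        omega
    have hall : ∀ y, y ∉ S → y ∈ U := by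
      intro y hy
      obtain ⟨w⟩ := hS' ⟨u, huS⟩ ⟨y, hy⟩
      have : ∀ {a b : ↥(Sᶜ)}, (hexGraph.induce Sᶜ).Walk a b → a.1 ∈ U → b.1 ∈ U := by
        intro a b w
        induction w with
        | nil => exact id
        | @cons a c b h _ ih => exact fun ha => ih (step _ _ ha a.2 c.2 h)
      exact this w hu
    refine Set.infinite_univ (α := LPt) ((hU.union hfin).subset fun y _ => ?_)
    by_cases hy : y ∈ S
    · exact Or.inr hy
    · exact Or.inl (hall y hy)

/-- In `H₂` the point `x` is at hexagonal distance `g` from the origin. -/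
def IsNorm (x : LPt) (g : ℤ) : Prop :=
  (x.1 ≤ g ∧ -x.2 ≤ g ∧ -(x.1 + x.2) ≤ g) ∧ (x.1 = g ∨ -x.2 = g ∨ -(x.1 + x.2) = g)

/-- The hop count is at least the hexagonal distance from the origin. -/
theorem norm_le_hop {P : Set LPt} (n : ℕ) : ∀ x, hop P x = n →
    x.1 ≤ n ∧ -x.2 ≤ n ∧ -(x.1 + x.2) ≤ n := by
  induction n with
  | zero =>
    intro x hx
    obtain rfl := hop_eq_zero_iff.1 hx
    simp
  | succ n ih =>
    intro x hx
    obtain ⟨-, y, hxy, hy⟩ := exists_lower (P := P) (x := x) (by omega)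
    have := ih y (by omega)
    rw [adj_coord] at hxy
    push_cast
    omega

/-- In `H₂` some neighbour in `H₂` is closer to the origin, so that the hop count is at most the
hexagonal distance. -/
theorem hop_le_norm (n : ℕ) : ∀ x : LPt, x.2 ≤ -2 → IsNorm x (n + 2) →
    0 ≤ hop H₂ x ∧ hop H₂ x ≤ n + 2 := by
  induction n with
  | zero =>
    intro x hx hn
    unfold IsNorm at hn
    have key : ∀ y ∈ hexagon, hexGraph.Adj x y → 0 ≤ hop H₂ x ∧ hop H₂ x ≤ (0 : ℕ) + 2 := by
      intro y hy hxy
      have h1 := hop_le_one_of_mem_hexagon (P := H₂) hy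
      have h2 := hop_le_succ (P := H₂) hxy (Or.inl hx) h1.1
      omega
    by_cases h : x.1 ≤ 1
    · refine key (0, -1) ?_ ?_
      · simp [hexagon]
      · rw [adj_mk]; omega
    · refine key (1, -1) ?_ ?_
      · simp [hexagon]
      · rw [adj_mk]; omega
  | succ n ih =>
    intro x hx hn
    unfold IsNorm at hn
    have key : ∀ y : LPt, y.2 ≤ -2 → IsNorm y (n + 2) → hexGraph.Adj x y →
        0 ≤ hop H₂ x ∧ hop H₂ x ≤ (n + 1 : ℕ) + 2 := by
      intro y hy hny hxy
      have h1 := ih y hy hny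
      have h2 := hop_le_succ (P := H₂) hxy (Or.inl hx) h1.1
      push_cast
      omega
    push_cast at hn
    by_cases hrow : x.2 = -2
    · by_cases h : 1 ≤ x.1
      · refine key (x.1 - 1, x.2) hx ?_ ?_
        · unfold IsNorm; simp only; omega
        · rw [adj_mk]; omega
      · refine key (x.1 + 1, x.2) hx ?_ ?_
        · unfold IsNorm; simp only; omega
        · rw [adj_mk]; omega
    · by_cases h : 1 ≤ x.1
      · refine key (x.1 - 1, x.2 + 1) (by simp only; omega) ?_ ?_
        · unfold IsNorm; simp only; omega
        · rw [adj_mk]; omega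
      · refine key (x.1, x.2 + 1) (by simp only; omega) ?_ ?_
        · unfold IsNorm; simp only; omega
        · rw [adj_mk]; omega

theorem exists_isNorm (x : LPt) (hx : x.2 ≤ -2) : ∃ n : ℕ, IsNorm x (n + 2) := by
  obtain ⟨g, hg⟩ : ∃ g : ℤ, IsNorm x g := by
    unfold IsNorm
    by_cases h1 : -x.2 ≤ x.1
    · exact ⟨x.1, by omega⟩
    · by_cases h2 : 0 ≤ x.1
      · exact ⟨-x.2, by omega⟩
      · exact ⟨-(x.1 + x.2), by omega⟩
  refine ⟨(g - 2).toNat, ?_⟩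
  have : 2 ≤ g := by unfold IsNorm at hg; omega
  rw [Int.toNat_of_nonneg (by omega), sub_add_cancel]
  exact hg

theorem isNorm_hop {x : LPt} (hx : x ∈ H₂) : IsNorm x (hop H₂ x) ∧ 2 ≤ hop H₂ x := by
  have hx' : x.2 ≤ -2 := hx
  obtain ⟨n, hn⟩ := exists_isNorm x hx'
  have h1 := hop_le_norm n x hx' hn
  have h2 := norm_le_hop (P := H₂) (hop H₂ x).toNat x (Int.toNat_of_nonneg h1.1).symm
  rw [Int.toNat_of_nonneg h1.1] at h2
  have h3 : hop H₂ x = n + 2 := by unfold IsNorm at hn; omega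
  rw [h3]
  exact ⟨hn, by omega⟩

theorem hop_eq_of_isNorm {x : LPt} {g : ℤ} (hx : x ∈ H₂) (h : IsNorm x g) : hop H₂ x = g := by
  have := (isNorm_hop hx).1
  unfold IsNorm at *
  omega

theorem holeFree_idle : HoleFree H₂ where
  half_plane := Or.inr subset_rfl
  hop_pos x hx := by have := (isNorm_hop hx).2; omega
  subset_of_enclosed U hU hdis hcl := by
    intro u hu
    by_contra hcon
    refine not_enclosed_of_free_row hU hdis hcl hu fun v hv hv' => hcon ?_
    have h : v.2 ≤ -2 := hv'
    change u.2 ≤ -2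
    omega

/-! ### The tree order of the idle half-plane -/

/-- The points of `H₂` at hexagonal distance `g` form a path; `n` is the number of steps from its
end point in row `-2` on the right. -/
theorem idle_level_connected (g : ℤ) (hg : 2 ≤ g) (n : ℕ) : ∀ x : LPt, x ∈ H₂ → IsNorm x g →
    ((x.1 = g ∧ -x.2 - 2 = n) ∨ (x.1 ≠ g ∧ 2 * g - 2 - x.1 = n)) →
      (levelGraph H₂).Reachable (g, -2) x := by
  induction n with
  | zero =>
    intro x hx hn h
    unfold IsNorm at hn
    obtain rfl : x = (g, -2) := by
      have hx' : x.2 ≤ -2 := hx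
      rw [Prod.ext_iff]
      simp only
      omega
    exact .refl _
  | succ n ih =>
    intro x hx hn h
    have hx' : x.2 ≤ -2 := hx
    have key : ∀ a b : ℤ, b ≤ -2 →
        ((a ≤ g ∧ -b ≤ g ∧ -(a + b) ≤ g) ∧ (a = g ∨ -b = g ∨ -(a + b) = g)) →
        ((a = g ∧ -b - 2 = n) ∨ (a ≠ g ∧ 2 * g - 2 - a = n)) → hexGraph.Adj (a, b) x →
        (levelGraph H₂).Reachable (g, -2) x := by
      intro a b hb hny hy' hadj
      have hy : (a, b) ∈ H₂ := hb
      refine (ih (a, b) hy hny hy').trans (SimpleGraph.Adj.reachable ⟨hadj, hy, hx, ?_⟩)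
      rw [hop_eq_of_isNorm hy hny, hop_eq_of_isNorm hx hn]
    unfold IsNorm at hn
    simp only [adj_mk_left] at key
    push_cast at h
    by_cases h1 : x.1 = g
    · refine key x.1 (x.2 + 1) ?_ ?_ ?_ ?_ <;> omega
    · by_cases h2 : 0 ≤ x.1
      · refine key (x.1 + 1) x.2 ?_ ?_ ?_ ?_ <;> omega
      · refine key (x.1 + 1) (x.2 - 1) ?_ ?_ ?_ ?_ <;> omega

theorem idle_reachable {x y : LPt} (hx : x ∈ H₂) (hy : y ∈ H₂) (h : hop H₂ x = hop H₂ y) :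
    (levelGraph H₂).Reachable x y := by
  have key : ∀ x ∈ H₂, (levelGraph H₂).Reachable (hop H₂ x, -2) x := by
    intro x hx
    obtain ⟨h1, h2⟩ := isNorm_hop hx
    have hx' : x.2 ≤ -2 := hx
    refine idle_level_connected _ h2
      (if x.1 = hop H₂ x then (-x.2 - 2).toNat else (2 * hop H₂ x - 2 - x.1).toNat) x hx h1 ?_
    unfold IsNorm at h1
    split_ifs with h <;> omega
  have h1 := key x hx
  rw [h] at h1
  exact h1.symm.trans (key y hy)

theorem TreeLT.gradient_lt {P : Set LPt} {R R' : Set LPt} (h : TreeLT P R R') :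
    ∃ g g', HasGradient P R g ∧ HasGradient P R' g' ∧ g < g' := by
  have nonempty : ∀ R ∈ ribbonization P, R.Nonempty := by
    rintro _ ⟨x, hx, rfl⟩
    exact ⟨x, hx, .refl _⟩
  induction h with
  | single h =>
    obtain ⟨-, -, ⟨g, h1, h2⟩, -⟩ := h
    exact ⟨g, g + 1, h1, h2, by omega⟩
  | tail _ h ih =>
    obtain ⟨g, g', h1, h2, h3⟩ := ih
    obtain ⟨hR, -, ⟨g₁, h4, h5⟩, -⟩ := h
    obtain ⟨x, hx⟩ := nonempty _ hR
    have e1 := h2 x hx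
    have e2 := h4 x hx
    exact ⟨g, g₁ + 1, h1, h5, by omega⟩

theorem treeLT_hop_lt {P : Set LPt} {x y : LPt} (hx : x ∈ P) (hy : y ∈ P)
    (h : TreeLT P (ribbonOf P x) (ribbonOf P y)) : hop P x < hop P y := by
  obtain ⟨g, g', h1, h2, h3⟩ := h.gradient_lt
  rw [h1 x ⟨hx, .refl _⟩, h2 y ⟨hy, .refl _⟩]
  exact h3

theorem idle_treeLT (n : ℕ) : ∀ x y, x ∈ H₂ → y ∈ H₂ → hop H₂ y = hop H₂ x + (n + 1) →
    TreeLT H₂ (ribbonOf H₂ x) (ribbonOf H₂ y) := by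
  induction n with
  | zero =>
    intro x y hx hy h
    have h2 := (isNorm_hop hx).2
    obtain ⟨-, z, hyz, hz⟩ := exists_lower (P := H₂) (x := y) (by omega)
    have hzP : z ∈ H₂ := mem_of_two_le_hop (by omega)
    rw [(ribbonOf_eq_iff hzP).2 (idle_reachable hx hzP (by omega))]
    exact .single (holeFree_idle.isParent hy hzP ⟨hyz, hz⟩)
  | succ n ih =>
    intro x y hx hy h
    have h2 := (isNorm_hop hx).2
    obtain ⟨-, z, hyz, hz⟩ := exists_lower (P := H₂) (x := y) (by omega)
    have hzP : z ∈ H₂ := mem_of_two_le_hop (by omega)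
    exact (ih x z hx hzP (by omega)).tail (holeFree_idle.isParent hy hzP ⟨hyz, hz⟩)

/-- The ribbons of `H₂` form a single chain. -/
theorem isCompleteTreeOrder_idle : IsCompleteTreeOrder H₂ (TreeLT H₂) where
  irrefl := by
    rintro _ ⟨x, hx, rfl⟩ h
    exact lt_irrefl _ (treeLT_hop_lt hx hx h)
  trans _ _ _ _ _ _ h h' := Relation.TransGen.trans h h'
  total := by
    rintro _ ⟨x, hx, rfl⟩ _ ⟨y, hy, rfl⟩
    rcases lt_trichotomy (hop H₂ x) (hop H₂ y) with h | h | h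
    · exact Or.inl (idle_treeLT (hop H₂ y - hop H₂ x - 1).toNat x y hx hy (by omega))
    · exact Or.inr (Or.inl ((ribbonOf_eq_iff hy).2 (idle_reachable hx hy h)))
    · exact Or.inr (Or.inr (idle_treeLT (hop H₂ x - hop H₂ y - 1).toNat y x hy hx (by omega)))
  extend _ _ h := h

/-- An idle placement filled layer by layer is an initial segment of `H₂`. -/
theorem IsIdlePlacement.isInitial {I : Set LPt} (hI : IsIdlePlacement I) :
    IsInitial H₂ (TreeLT H₂) I := by
  refine ⟨hI.subset_H₂, fun x hx y hy hyx => ?_⟩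
  have hxP := hI.subset_H₂ hx
  have hfill : ribbonOf H₂ x ⊆ I := by
    rcases hI.empty_or_filled _ (ribbonOf_mem hxP) with h | h
    · exact absurd hx (Set.disjoint_left.1 h ⟨hxP, .refl _⟩)
    · exact h
  rcases hyx with h | ⟨h, -⟩
  · exact hI.layer_by_layer _ (ribbonOf_mem hxP) _ (ribbonOf_mem hy) hfill _ _
      hasGradient_ribbonOf hasGradient_ribbonOf (treeLT_hop_lt hy hxP h) ⟨hy, .refl _⟩
  · exact hfill (h ▸ ⟨hy, .refl _⟩)

/-! ### Activation and assembly sequences -/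

theorem exists_isLargest {R : LPt → LPt → Prop} {A : Set LPt} (hA : A.Finite) (hne : A.Nonempty)
    (htrans : ∀ x ∈ A, ∀ y ∈ A, ∀ z ∈ A, R x y → R y z → R x z)
    (htotal : ∀ x ∈ A, ∀ y ∈ A, x ≠ y → R x y ∨ R y x) : ∃ x, IsLargest R A x := by
  induction A, hA using Set.Finite.induction_on with
  | empty => exact absurd hne Set.not_nonempty_empty
  | @insert a A _ _ ih =>
    rcases A.eq_empty_or_nonempty with rfl | hne'
    · refine ⟨a, Set.mem_insert _ _, fun y hy hya => ?_⟩
      rw [insert_empty_eq] at hy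
      exact absurd hy hya
    · obtain ⟨x, hx, hmax⟩ := ih hne'
        (fun x hx y hy z hz => htrans x (Or.inr hx) y (Or.inr hy) z (Or.inr hz))
        (fun x hx y hy => htotal x (Or.inr hx) y (Or.inr hy))
      by_cases hxa : x = a
      · refine ⟨a, Or.inl rfl, fun y hy hya => ?_⟩
        rcases hy with rfl | hy
        · exact absurd rfl hya
        · rw [← hxa]
          exact hmax y hy (hxa ▸ hya)
      · rcases htotal x (Or.inr hx) a (Or.inl rfl) hxa with h | h
        · refine ⟨a, Or.inl rfl, fun y hy hya => ?_⟩
          rcases hy with rfl | hy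
          · exact absurd rfl hya
          · by_cases hyx : y = x
            · rw [hyx]; exact h
            · exact htrans y (Or.inr hy) x (Or.inr hx) a (Or.inl rfl) (hmax y hy hyx) h
        · refine ⟨x, Or.inr hx, fun y hy hyx => ?_⟩
          rcases hy with rfl | hy
          · exact h
          · exact hmax y hy hyx

/-- The elements of a finite, strictly totally ordered set can be listed from the largest one on. -/
theorem exists_sequence {R : LPt → LPt → Prop} {A : Set LPt} (hA : A.Finite)
    (htrans : ∀ x ∈ A, ∀ y ∈ A, ∀ z ∈ A, R x y → R y z → R x z)
    (htotal : ∀ x ∈ A, ∀ y ∈ A, x ≠ y → R x y ∨ R y x) (N : ℕ) (hN : N ≤ A.ncard) :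
    ∃ s : ℕ → LPt, ∀ n, 1 ≤ n → n ≤ N → IsLargest R (A \ s '' Ico 1 n) (s n) := by
  induction N with
  | zero => exact ⟨fun _ => 0, fun n h h' => by omega⟩
  | succ N ih =>
    obtain ⟨s, hs⟩ := ih (by omega)
    have hne : (A \ s '' Ico 1 (N + 1)).Nonempty := by
      refine Set.sdiff_nonempty_of_ncard_lt_ncard ?_ ((Set.finite_Ico _ _).image _)
      calc (s '' Ico 1 (N + 1)).ncard ≤ (Ico 1 (N + 1)).ncard :=
            Set.ncard_image_le (Set.finite_Ico _ _)
        _ = N := by rw [Set.ncard_eq_toFinset_card']; simp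
        _ < A.ncard := by omega
    obtain ⟨x, hx⟩ := exists_isLargest (R := R) (hA.subset Set.sdiff_subset) hne
      (fun x hx y hy z hz => htrans x hx.1 y hy.1 z hz.1)
      (fun x hx y hy => htotal x hx.1 y hy.1)
    refine ⟨Function.update s (N + 1) x, fun n h1 h2 => ?_⟩
    have himg : Function.update s (N + 1) x '' Ico 1 n = s '' Ico 1 n := by
      refine Set.image_congr fun k hk => Function.update_of_ne ?_ _ _
      have := hk.2
      omega
    rw [himg]
    rcases h2.eq_or_lt with rfl | h3
    · rw [Function.update_self]; exact hx
    · rw [Function.update_of_ne (by omega)]; exact hs n h1 (by omega)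

section Sequences

variable {P : Set LPt} {lt : Set LPt → Set LPt → Prop} {A : Set LPt} {N n : ℕ}
  {s : ℕ → LPt}

theorem exists_descending (hP : HoleFree P) (hlt : IsCompleteTreeOrder P lt) (hAP : A ⊆ P)
    (hA : A.Finite) (hN : N ≤ A.ncard) :
    ∃ s : ℕ → LPt, ∀ n, 1 ≤ n → n ≤ N → IsLargest (PointLT P lt) (A \ s '' Ico 1 n) (s n) :=
  exists_sequence (R := PointLT P lt) hA
    (fun _ hx _ hy _ hz => pointLT_trans hlt (hAP hx) (hAP hy) (hAP hz))
    (fun _ hx _ hy h => hP.pointLT_total hlt (hAP hx) (hAP hy) h) N hN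

theorem exists_ascending (hP : HoleFree P) (hlt : IsCompleteTreeOrder P lt) (hAP : A ⊆ P)
    (hA : A.Finite) (hN : N ≤ A.ncard) :
    ∃ s : ℕ → LPt, ∀ n, 1 ≤ n → n ≤ N → IsSmallest (PointLT P lt) (A \ s '' Ico 1 n) (s n) :=
  exists_sequence (R := fun x y => PointLT P lt y x) hA
    (fun _ hx _ hy _ hz h h' => pointLT_trans hlt (hAP hz) (hAP hy) (hAP hx) h' h)
    (fun _ hx _ hy h => (hP.pointLT_total hlt (hAP hx) (hAP hy) h).symm) N hN

theorem isInitial_descending (hP : HoleFree P) (hlt : IsCompleteTreeOrder P lt)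
    (hA : IsInitial P lt A)
    (hs : ∀ n, 1 ≤ n → n ≤ N → IsLargest (PointLT P lt) (A \ s '' Ico 1 n) (s n)) (hn : n ≤ N) :
    IsInitial P lt (A \ s '' Icc 1 n) := by
  refine ⟨fun x hx => hA.1 hx.1, fun x hx y hy hyx => ⟨hA.2 x hx.1 y hy hyx, ?_⟩⟩
  rintro ⟨k, hk, rfl⟩
  have hxk : x ≠ s k := fun e => hx.2 ⟨k, hk, e.symm⟩
  have h := (hs k hk.1 (hk.2.trans hn)).2 x
    ⟨hx.1, fun h => hx.2 (Set.image_mono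
      (Set.Ico_subset_Icc_self.trans (Set.Icc_subset_Icc_right hk.2)) h)⟩ hxk
  exact hP.pointLT_irrefl hlt hy (pointLT_trans hlt hy (hA.1 hx.1) hy hyx h)

theorem isInitial_ascending (hP : HoleFree P) (hlt : IsCompleteTreeOrder P lt)
    (hs : ∀ n, 1 ≤ n → n ≤ N → IsSmallest (PointLT P lt) (P \ s '' Ico 1 n) (s n)) (hn : n ≤ N) :
    IsInitial P lt (s '' Icc 1 n) := by
  constructor
  · rintro _ ⟨k, hk, rfl⟩
    exact (hs k hk.1 (hk.2.trans hn)).1.1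
  · rintro _ ⟨k, hk, rfl⟩ y hy hyx
    by_contra hcon
    have hk' := hs k hk.1 (hk.2.trans hn)
    have h := hk'.2 y
      ⟨hy, fun h => hcon (Set.image_mono
        (Set.Ico_subset_Icc_self.trans (Set.Icc_subset_Icc_right hk.2)) h)⟩
      (fun e => hcon ⟨k, hk, e.symm⟩)
    exact hP.pointLT_irrefl hlt hy (pointLT_trans hlt hy hk'.1.1 hy hyx h)

end Sequences

/-! ### Tight sets of occupied points -/

/-- Two points at distance `√3 d` or `2 d` do not leave a gap in `occ` between them: in the first
case one of their common neighbours is occupied, in the second case the midpoint is. -/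
def TightPair (occ : Set LPt) (x y : LPt) : Prop :=
  (nsq (x - y) = 3 → ∃ v ∈ occ, hexGraph.Adj x v ∧ hexGraph.Adj y v) ∧
  (nsq (x - y) = 4 → ∀ z, hexGraph.Adj x z → hexGraph.Adj y z → z ∈ occ)

/-- No two points of `occ` leave a gap between them. -/
def IsTight (occ : Set LPt) : Prop := ∀ x ∈ occ, ∀ y ∈ occ, TightPair occ x y

theorem TightPair.symm {occ : Set LPt} {x y : LPt} (h : TightPair occ x y) : TightPair occ y x := by
  constructor
  · intro h3
    obtain ⟨v, hv, h1, h2⟩ := h.1 (by rw [nsq_sub_comm]; exact h3)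
    exact ⟨v, hv, h2, h1⟩
  · exact fun h4 z h1 h2 => h.2 (by rw [nsq_sub_comm]; exact h4) z h2 h1

theorem TightPair.mono {occ occ' : Set LPt} (h : occ ⊆ occ') {x y : LPt} (hxy : TightPair occ x y) :
    TightPair occ' x y :=
  ⟨fun h3 => let ⟨v, hv, h1⟩ := hxy.1 h3; ⟨v, h hv, h1⟩, fun h4 z h1 h2 => h (hxy.2 h4 z h1 h2)⟩

/-- A set of lattice points with a smooth boundary. -/
structure IsSmooth (P : Set LPt) : Prop where
  two : ∀ x ∈ P, ∀ y ∈ P, nsq (x - y) = 4 → ∀ z, hexGraph.Adj x z → hexGraph.Adj y z → z ∈ P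
  sqrt_three : ∀ x ∈ P, ∀ y ∈ P, nsq (x - y) = 3 →
    ∃ z ∈ P, hexGraph.Adj x z ∧ hexGraph.Adj y z

theorem IsProperRibbonization.isSmooth {S : Set LPt} (hS : IsProperRibbonization S) :
    IsSmooth S where
  two := hS.smooth_two
  sqrt_three := by
    intro x hx y hy h
    have := hS.smooth_sqrt_three x hx y hy h
    push Not at this
    obtain ⟨z, h1, h2, h3⟩ := this
    exact ⟨z, h3, h1, h2⟩

theorem isSmooth_idle : IsSmooth H₂ where
  two := by
    intro x hx y hy h z hxz hyz
    have h1 : x.2 ≤ -2 := hx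
    have h2 : y.2 ≤ -2 := hy
    change z.2 ≤ -2
    rw [two_coord] at h
    rw [adj_coord] at *
    omega
  sqrt_three := by
    intro x hx y hy h
    have h1 : x.2 ≤ -2 := hx
    have h2 : y.2 ≤ -2 := hy
    have key : ∀ a b : ℤ, b ≤ -2 → hexGraph.Adj x (a, b) → hexGraph.Adj y (a, b) →
        ∃ z ∈ H₂, hexGraph.Adj x z ∧ hexGraph.Adj y z := fun a b hb h h' => ⟨(a, b), hb, h, h'⟩
    simp only [adj_mk] at key
    rw [sqrt_three_coord] at h
    rcases h with h | h | h | h | h | h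
    · exact key (x.1 + 1) x.2 (by omega) (by omega) (by omega)
    · exact key x.1 (x.2 + 1) (by omega) (by omega) (by omega)
    · exact key (x.1 - 1) x.2 (by omega) (by omega) (by omega)
    · exact key (x.1 - 1) x.2 (by omega) (by omega) (by omega)
    · exact key x.1 (x.2 - 1) (by omega) (by omega) (by omega)
    · exact key (x.1 + 1) x.2 (by omega) (by omega) (by omega)

theorem nsq_sub_self (x : LPt) : nsq (x - x) = 0 := by simp [nsq]

/-- An initial segment of a smooth hole-free set has no gaps. -/
theorem IsInitial.isTight {P A : Set LPt} {lt : Set LPt → Set LPt → Prop} (hP : HoleFree P)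
    (hsm : IsSmooth P) (hlt : IsCompleteTreeOrder P lt) (hA : IsInitial P lt A) : IsTight A := by
  intro x hx y hy
  constructor
  · intro h
    obtain ⟨z, hz, h1, h2⟩ := hsm.sqrt_three x (hA.1 hx) y (hA.1 hy) h
    refine hA.common_neighbour hP hlt hx hy hz h1 h2 ?_ ?_
    · rintro rfl; rw [nsq_sub_self] at h; omega
    · rw [adj_iff]; omega
  · intro h z h1 h2
    have hz := hsm.two x (hA.1 hx) y (hA.1 hy) h z h1 h2
    obtain ⟨v, hv, h3, h4⟩ := hA.common_neighbour hP hlt hx hy hz h1 h2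
      (by rintro rfl; rw [nsq_sub_self] at h; omega) (by rw [adj_iff]; omega)
    obtain rfl : v = z := by
      rw [two_coord] at h
      rw [adj_coord] at *
      rw [Prod.ext_iff]
      omega
    exact hv

/-- The points of `seeds`, as a list. -/
def seedList : List LPt := [(0, 0), (-1, 1), (0, 1), (1, -1), (0, -1)]

/-- The ribbon of gradient two of `H₂`. -/
def idleRootRibbon : List LPt := [(2, -2), (1, -2), (0, -2)]

/-- The lattice vectors of length `√3 d`. -/
def sqrtThreeDirs : List LPt := [(1, 1), (-1, 2), (-2, 1), (-1, -1), (1, -2), (2, -1)]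

/-- The lattice vectors of length `2 d`. -/
def twoDirs : List LPt := [(2, 0), (0, 2), (-2, 2), (-2, 0), (0, -2), (2, -2)]

theorem mem_seedList (x : LPt) : x ∈ seedList ↔ x ∈ seeds := by
  simp [seedList, seeds]

theorem row_of_mem_seeds {x : LPt} (hx : x ∈ seeds) : -1 ≤ x.2 ∧ x.2 ≤ 1 := by
  simp only [seeds, Set.mem_insert_iff, Set.mem_singleton_iff, Prod.ext_iff] at hx
  omega

theorem sqrt_three_dir {x y : LPt} (h : nsq (x - y) = 3) : ∃ v ∈ sqrtThreeDirs, x = y + v :=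
  ⟨x - y, by rw [nsq_eq_three_iff] at h; simpa [sqrtThreeDirs] using h, by abel⟩

theorem two_dir {x y : LPt} (h : nsq (x - y) = 4) : ∃ v ∈ twoDirs, x = y + v :=
  ⟨x - y, by rw [nsq_eq_four_iff] at h; simpa [twoDirs] using h, by abel⟩

theorem adj_dir_mem {x y : LPt} (h : hexGraph.Adj x y) : ∃ d ∈ dirs, y = x + d :=
  ⟨y - x, (mem_dirs _).2 (by rw [nsq_sub_comm]; exact h), by abel⟩

/-- Two points at distance `√3 d` have only two common neighbours. -/
theorem common_eq {x y u v w : LPt} (hxy : nsq (x - y) = 3) (h1 : hexGraph.Adj x u)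
    (h2 : hexGraph.Adj y u) (h3 : hexGraph.Adj x v) (h4 : hexGraph.Adj y v)
    (h5 : hexGraph.Adj x w) (h6 : hexGraph.Adj y w) (hu : u ≠ w) (hv : v ≠ w) : u = v := by
  have key : ∀ s ∈ sqrtThreeDirs, ∀ a ∈ dirs, nsq (s - a) = 1 → ∀ b ∈ dirs, nsq (s - b) = 1 →
      ∀ c ∈ dirs, nsq (s - c) = 1 → a ≠ c → b ≠ c → a = b := by decide
  rw [nsq_sub_comm] at hxy
  obtain ⟨s, hs, rfl⟩ := sqrt_three_dir hxy
  obtain ⟨a, ha, rfl⟩ := adj_dir_mem h1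
  obtain ⟨b, hb, rfl⟩ := adj_dir_mem h3
  obtain ⟨c, hc, rfl⟩ := adj_dir_mem h5
  rw [adj_iff, add_sub_add_left_eq_sub] at h2 h4 h6
  rw [key s hs a ha h2 b hb h4 c hc h6 (fun e => hu (by rw [e])) (fun e => hv (by rw [e]))]

theorem IsTight.isProperBoundary {occ : Set LPt} (h : IsTight occ) : IsProperBoundary occ where
  sqrt_three := by
    intro x hx y hy hxy
    obtain ⟨v, hv, h1, h2⟩ := (h x hx.1 y hy.1).1 hxy
    rintro z ⟨hz, hz1, hz2⟩ z' ⟨hz', hz1', hz2'⟩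
    exact common_eq hxy hz1 hz2 hz1' hz2' h1 h2 (fun e => hz (e ▸ hv)) (fun e => hz' (e ▸ hv))
  two := fun x hx y hy hxy => (h x hx.1 y hy.1).2 hxy

/-- Tightness of a list of points is decidable. -/
theorem isTight_list {L : List LPt}
    (h3 : ∀ x ∈ L, ∀ y ∈ L, nsq (x - y) = 3 → ∃ w ∈ L, nsq (x - w) = 1 ∧ nsq (y - w) = 1)
    (h4 : ∀ x ∈ L, ∀ y ∈ L, nsq (x - y) = 4 → ∀ d ∈ dirs, nsq (y - (x + d)) = 1 → x + d ∈ L) :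
    IsTight {x | x ∈ L} := by
  intro x hx y hy
  constructor
  · intro h
    obtain ⟨w, hw, h1, h2⟩ := h3 x hx y hy h
    exact ⟨w, hw, h1, h2⟩
  · intro h z h1 h2
    obtain ⟨d, hd, rfl⟩ := adj_dir_mem h1
    exact h4 x hx y hy h d hd h2

theorem isTight_seeds : IsTight seeds := by
  have e : {x | x ∈ seedList} = seeds := Set.ext mem_seedList
  exact e ▸ isTight_list (by decide) (by decide)

/-- The root ribbon `ρ` of `P` fills every gap between a seed and a point of `P` that is not filled
by the seeds. -/
def Shields (ρ : List LPt) (P : Set LPt) : Prop :=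
  (∀ r ∈ ρ, r ∈ P ∧ hop P r = 2) ∧
  (∀ y ∈ seedList, ∀ v ∈ sqrtThreeDirs, y + v ∈ P → ∃ w ∈ seedList ++ ρ,
    nsq (y + v - w) = 1 ∧ nsq (y - w) = 1 ∧ (w ∈ seedList ∨ w ∈ ρ ∧ y + v ∉ ρ)) ∧
  ∀ y ∈ seedList, ∀ v ∈ twoDirs, y + v ∈ P → ∀ d ∈ dirs, nsq (y + v - (y + d)) = 1 →
    (y + d ∈ seedList ∨ y + d ∈ ρ ∧ y + v ∉ ρ)

theorem root_shields_three : ∀ y ∈ seedList, ∀ v ∈ sqrtThreeDirs, 2 ≤ (y + v).2 →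
    ∃ w ∈ seedList ++ rootRibbon, nsq (y + v - w) = 1 ∧ nsq (y - w) = 1 ∧
      (w ∈ seedList ∨ w ∈ rootRibbon ∧ y + v ∉ rootRibbon) := by decide

theorem root_shields_four : ∀ y ∈ seedList, ∀ v ∈ twoDirs, 2 ≤ (y + v).2 → ∀ d ∈ dirs,
    nsq (y + v - (y + d)) = 1 →
      (y + d ∈ seedList ∨ y + d ∈ rootRibbon ∧ y + v ∉ rootRibbon) := by decide

theorem idle_shields_three : ∀ y ∈ seedList, ∀ v ∈ sqrtThreeDirs, (y + v).2 ≤ -2 →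
    ∃ w ∈ seedList ++ idleRootRibbon, nsq (y + v - w) = 1 ∧ nsq (y - w) = 1 ∧
      (w ∈ seedList ∨ w ∈ idleRootRibbon ∧ y + v ∉ idleRootRibbon) := by decide

theorem idle_shields_four : ∀ y ∈ seedList, ∀ v ∈ twoDirs, (y + v).2 ≤ -2 → ∀ d ∈ dirs,
    nsq (y + v - (y + d)) = 1 →
      (y + d ∈ seedList ∨ y + d ∈ idleRootRibbon ∧ y + v ∉ idleRootRibbon) := by decide

theorem IsProperRibbonization.shields {S : Set LPt} (hS : IsProperRibbonization S) :
    Shields rootRibbon S :=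
  ⟨fun _ => hS.mem_of_rootRibbon, fun y hy v hv h => root_shields_three y hy v hv (hS.subset_H₁ h),
    fun y hy v hv h => root_shields_four y hy v hv (hS.subset_H₁ h)⟩

theorem shields_idle : Shields idleRootRibbon H₂ := by
  refine ⟨fun r hr => ?_, fun y hy v hv h => idle_shields_three y hy v hv h,
    fun y hy v hv h => idle_shields_four y hy v hv h⟩
  have h : r ∈ H₂ ∧ IsNorm r 2 := by
    change r.2 ≤ -2 ∧ IsNorm r 2
    simp only [idleRootRibbon, List.mem_cons, List.not_mem_nil, or_false] at hr
    rcases hr with rfl | rfl | rfl <;> simp [IsNorm]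
  exact ⟨h.1, hop_eq_of_isNorm h.1 h.2⟩

section Initial

variable {P A : Set LPt} {lt : Set LPt → Set LPt → Prop}

/-- An initial segment contains every point of the root ribbon `ρ` that is adjacent to one of its
points outside of `ρ`. -/
theorem IsInitial.root_mem {ρ : List LPt} (hρ : Shields ρ P) (hP : HoleFree P)
    (hlt : IsCompleteTreeOrder P lt) (hA : IsInitial P lt A) {x r : LPt}
    (hroot : ∀ x ∈ P, hop P x = 2 → x ∈ ρ) (hx : x ∈ A) (hr : r ∈ ρ) (hxρ : x ∉ ρ)
    (hxr : hexGraph.Adj x r) : r ∈ A := by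
  obtain ⟨hrP, hr2⟩ := hρ.1 r hr
  have h1 := (hop_le_succ hxr (Or.inl (hA.1 hx)) (by omega)).2
  have h2 := hP.two_le_hop (hA.1 hx)
  have h3 : hop P x ≠ 2 := fun h => hxρ (hroot x (hA.1 hx) h)
  exact hA.lower_mem hP hlt hx hrP ⟨hxr, by omega⟩

theorem IsInitial.tightPair_seed {ρ : List LPt} (hρ : Shields ρ P) (hP : HoleFree P)
    (hlt : IsCompleteTreeOrder P lt) (hA : IsInitial P lt A)
    (hroot : ∀ x ∈ P, hop P x = 2 → x ∈ ρ) {x y : LPt} (hx : x ∈ A) (hy : y ∈ seeds) :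
    TightPair (seeds ∪ A) x y := by
  rw [← mem_seedList] at hy
  constructor
  · intro h
    obtain ⟨v, hv, rfl⟩ := sqrt_three_dir h
    obtain ⟨w, -, h1, h2, h3⟩ := hρ.2.1 y hy v hv (hA.1 hx)
    refine ⟨w, ?_, h1, h2⟩
    rcases h3 with h3 | ⟨h3, h4⟩
    · exact Or.inl ((mem_seedList w).1 h3)
    · exact Or.inr (hA.root_mem hρ hP hlt hroot hx h3 h4 h1)
  · intro h z h1 h2
    obtain ⟨v, hv, rfl⟩ := two_dir h
    obtain ⟨d, hd, rfl⟩ := adj_dir_mem h2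
    rcases hρ.2.2 y hy v hv (hA.1 hx) d hd h1 with h3 | ⟨h3, h4⟩
    · exact Or.inl ((mem_seedList _).1 h3)
    · exact Or.inr (hA.root_mem hρ hP hlt hroot hx h3 h4 h1)

/-- Every point of an initial segment is adjacent to a lower point, which is a seed or lies in the
segment. -/
theorem IsInitial.adj_mem (hP : HoleFree P) (hlt : IsCompleteTreeOrder P lt)
    (hA : IsInitial P lt A) {x : LPt} (hx : x ∈ A) :
    ∃ y, hexGraph.Adj x y ∧ (y ∈ seeds ∨ y ∈ A) := by
  have h2 := hP.two_le_hop (hA.1 hx)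
  obtain ⟨-, y, hxy, hy⟩ := exists_lower (P := P) (x := x) (by omega)
  refine ⟨y, hxy, ?_⟩
  by_cases h : hop P y = 1
  · rw [hop_eq_one_iff] at h
    left
    have hrow : 2 ≤ x.2 ∨ x.2 ≤ -2 := hP.half_plane.imp (fun h => h (hA.1 hx)) fun h => h (hA.1 hx)
    rw [← mem_seedList]
    rw [adj_coord] at h hxy
    simp only [seedList, List.mem_cons, List.not_mem_nil, or_false, Prod.ext_iff]
    omega
  · exact Or.inr (hA.lower_mem hP hlt hx (mem_of_two_le_hop (by omega)) ⟨hxy, hy⟩)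

end Initial

theorem mem_rootRibbon_of_hop {S : Set LPt} (hS : S ⊆ H₁) :
    ∀ x ∈ S, hop S x = 2 → x ∈ rootRibbon := by
  intro x hx h
  have h2 : 2 ≤ x.2 := hS hx
  obtain ⟨z, h3, h4⟩ := exists_adj_of_hop_two h
  rw [adj_coord] at h3 h4
  rw [mem_rootRibbon]
  omega

theorem mem_idleRootRibbon_of_hop : ∀ x ∈ H₂, hop H₂ x = 2 → x ∈ idleRootRibbon := by
  intro x hx h
  have h2 : x.2 ≤ -2 := hx
  obtain ⟨z, h3, h4⟩ := exists_adj_of_hop_two h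
  rw [adj_coord] at h3 h4
  simp only [idleRootRibbon, List.mem_cons, List.not_mem_nil, or_false, Prod.ext_iff]
  omega

/-- The seeds together with an initial segment of the idle half-plane and one of the shape leave no
gaps. -/
theorem isTight_occ {S A T : Set LPt} {lt : Set LPt → Set LPt → Prop}
    (hS : IsProperRibbonization S) (hS' : HoleFree S) (hlt : IsCompleteTreeOrder S lt)
    (hA : IsInitial H₂ (TreeLT H₂) A) (hT : IsInitial S lt T) : IsTight (seeds ∪ A ∪ T) := by
  have hAA := hA.isTight holeFree_idle isSmooth_idle isCompleteTreeOrder_idle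
  have hTT := hT.isTight hS' hS.isSmooth hlt
  have hAs : ∀ x ∈ A, ∀ y ∈ seeds, TightPair (seeds ∪ A ∪ T) x y := fun x hx y hy =>
    (hA.tightPair_seed shields_idle holeFree_idle isCompleteTreeOrder_idle
      mem_idleRootRibbon_of_hop hx hy).mono subset_union_left
  have hTs : ∀ x ∈ T, ∀ y ∈ seeds, TightPair (seeds ∪ A ∪ T) x y := fun x hx y hy =>
    (hT.tightPair_seed hS.shields hS' hlt (mem_rootRibbon_of_hop hS.subset_H₁) hx hy).mono
      (Set.union_subset_union_left _ subset_union_left)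
  have hAT : ∀ x ∈ A, ∀ y ∈ T, TightPair (seeds ∪ A ∪ T) x y := by
    intro x hx y hy
    have h1 : x.2 ≤ -2 := hA.1 hx
    have h2 : 2 ≤ y.2 := hS.subset_H₁ (hT.1 hy)
    constructor
    · intro h; rw [sqrt_three_coord] at h; omega
    · intro h; rw [two_coord] at h; omega
  rintro x ((hx | hx) | hx) y ((hy | hy) | hy)
  · exact (isTight_seeds x hx y hy).mono (subset_union_left.trans subset_union_left)
  · exact (hAs y hy x hx).symm
  · exact (hTs y hy x hx).symm
  · exact hAs x hx y hy
  · exact (hAA x hx y hy).mono (subset_union_right.trans subset_union_left)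
  · exact hAT x hx y hy
  · exact hTs x hx y hy
  · exact (hAT y hy x hx).symm
  · exact (hTT x hx y hy).mono subset_union_right

/-! ### The discrete boundary cycle -/

/-- The step of an edge-following robot from one lattice point to the next one, clockwise around
the occupied point `c`. -/
def StepAround (occ : Set LPt) (x c x' : LPt) : Prop :=
  x ∉ occ ∧ x' ∉ occ ∧ c ∈ occ ∧ hexGraph.Adj x c ∧ x' = c + rotCW (x - c)

/-- A step of an edge-following robot, around some occupied point. -/
def Step (occ : Set LPt) (x x' : LPt) : Prop := ∃ c, StepAround occ x c x'

/-- Every point of the edge-following set is reached from every other one. -/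
def IsCycle (occ : Set LPt) : Prop :=
  ∀ x ∈ edgeFollowingSet occ, ∀ y ∈ edgeFollowingSet occ, Relation.ReflTransGen (Step occ) x y

section Cycle

variable {occ : Set LPt} {x y z t c c' a b : LPt}

theorem StepAround.mem_left (h : StepAround occ x c y) : x ∈ edgeFollowingSet occ :=
  ⟨h.1, c, h.2.2.1, h.2.2.2.1⟩

theorem StepAround.mem_right (h : StepAround occ x c y) : y ∈ edgeFollowingSet occ :=
  ⟨h.2.1, c, h.2.2.1, by rw [h.2.2.2.2]; exact (adj_rotCW h.2.2.2.1).2⟩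

/-- If `c`, `c'` are at distance `√3 d`, then the clockwise step from one common neighbour `x`
around one of them leads to the other common neighbour `m`. -/
theorem rot_between {m : LPt} (h3 : nsq (c - c') = 3) (hc : hexGraph.Adj c x)
    (hc' : hexGraph.Adj c' x) (h1 : hexGraph.Adj c m) (h2 : hexGraph.Adj c' m) (hm : m ≠ x) :
    c + rotCW (x - c) = m ∨ c' + rotCW (x - c') = m := by
  have h : ∀ d ∈ dirs, ∀ d' ∈ dirs, nsq (d - d') = 3 → ∀ e ∈ dirs, nsq (d' - (d + e)) = 1 →
      d + e ≠ 0 → d + rotCW (-d) = d + e ∨ d' + rotCW (-d') = d + e := by decide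
  obtain ⟨d, hd, rfl⟩ := adj_dir_mem hc.symm
  obtain ⟨d', hd', rfl⟩ := adj_dir_mem hc'.symm
  obtain ⟨e, he, rfl⟩ := adj_dir_mem h1
  rw [add_sub_add_left_eq_sub] at h3
  rw [adj_iff, add_assoc, add_sub_add_left_eq_sub] at h2
  have := h d hd d' hd' h3 e he h2 (fun e => hm (by rw [add_assoc, e, add_zero]))
  rw [sub_add_cancel_left, sub_add_cancel_left]
  simpa only [add_assoc, add_right_inj] using this

theorem nsq_sub_of_common (hc : hexGraph.Adj x c) (hc' : hexGraph.Adj x c') (hne : c ≠ c') :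
    nsq (c - c') = 1 ∨ nsq (c - c') = 3 ∨ nsq (c - c') = 4 := by
  have h : ∀ d ∈ dirs, ∀ d' ∈ dirs, d ≠ d' →
    nsq (d - d') = 1 ∨ nsq (d - d') = 3 ∨ nsq (d - d') = 4 := by decide
  obtain ⟨d, hd, rfl⟩ := adj_dir_mem hc
  obtain ⟨d', hd', rfl⟩ := adj_dir_mem hc'
  rw [add_sub_add_left_eq_sub]
  exact h d hd d' hd' (fun e => hne (by rw [e]))

/-- In a tight configuration the occupied neighbours of a free point form one block, so that there
is one way to edge-follow from it. -/
theorem IsTight.step_unique (hocc : IsTight occ) (h : StepAround occ x c y)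
    (h' : StepAround occ x c' z) : c = c' ∧ y = z := by
  obtain ⟨hx, hy, hc, hxc, ey⟩ := h
  obtain ⟨-, hz, hc', hxc', ez⟩ := h'
  by_cases hcc : c = c'
  · subst hcc; exact ⟨rfl, ey.trans ez.symm⟩
  exfalso
  rcases nsq_sub_of_common hxc hxc' hcc with h1 | h3 | h4
  · rcases rot_triangle hxc hxc' h1 with e | e
    · exact hy (by rw [ey, e]; exact hc')
    · exact hz (by rw [ez, e]; exact hc)
  · obtain ⟨m, hm, h5, h6⟩ := (hocc c hc c' hc').1 h3
    rcases rot_between h3 hxc.symm hxc'.symm h5 h6 (fun e => hx (e ▸ hm)) with e | e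
    · exact hy (by rw [ey, e]; exact hm)
    · exact hz (by rw [ez, e]; exact hm)
  · exact hx ((hocc c hc c' hc').2 h4 x hxc.symm hxc'.symm)

/-- If every clockwise rotation around an occupied neighbour of a free point `x` were blocked, half
a turn would give occupied points on opposite sides of `x`. -/
theorem IsTight.exists_step (hocc : IsTight occ) (hx : x ∈ edgeFollowingSet occ) :
    ∃ y, Step occ x y := by
  by_contra! hcon
  obtain ⟨hx, c, hc, hxc⟩ := hx
  have next : ∀ c ∈ occ, hexGraph.Adj x c → c + rotCW (x - c) ∈ occ := by
    intro c hc hxc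
    by_contra h
    exact hcon _ ⟨c, hx, h, hc, hxc, rfl⟩
  have h1 := next c hc hxc
  have a1 := (adj_rotCW hxc).1
  have h2 := next _ h1 a1
  have a2 := (adj_rotCW a1).1
  have h3 := next _ h2 a2
  have a3 := (adj_rotCW a2).1
  refine hx ((hocc c hc _ h3).2 ?_ x hxc.symm a3.symm)
  have hn : nsq (x - c) = 1 := hxc
  simp only [nsq, rotCW, Prod.fst_add, Prod.snd_add, Prod.fst_sub, Prod.snd_sub] at hn ⊢
  linear_combination 4 * hn

/-- Edge-following around a single occupied point `t`. -/
theorem rot_path (ht : t ∈ occ) {f : LPt} (hf : nsq f = 1) (i k : ℕ)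
    (h : ∀ j ≤ k, t + rotCW^[i + j] f ∉ occ) :
    Relation.ReflTransGen (Step occ) (t + rotCW^[i] f) (t + rotCW^[i + k] f) := by
  induction k with
  | zero => exact .refl
  | succ k ih =>
    refine (ih fun j hj => h j (by omega)).tail
      ⟨t, h k (by omega), h (k + 1) le_rfl, ht, (adj_dir t f hf _).symm, ?_⟩
    rw [add_sub_cancel_left, ← add_assoc, Function.iterate_succ_apply']

/-- Rotating backwards around the free point `t` is rotating clockwise around its neighbours. -/
theorem rot_step (t f : LPt) (i : ℕ) :
    t + rotCW^[i] f = (t + rotCW^[i + 1] f) + rotCW (t - (t + rotCW^[i + 1] f)) := by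
  rw [Function.iterate_succ_apply']
  simp only [rotCW, Prod.ext_iff, Prod.fst_add, Prod.snd_add, Prod.fst_sub, Prod.snd_sub]
  omega

/-- Filling a point of the edge-following set of a tight configuration keeps its boundary a
cycle: the step into and the step out of this point are replaced by a path around it. -/
theorem IsCycle.insert (hocc : IsTight occ) (hcyc : IsCycle occ) (ht : t ∈ edgeFollowingSet occ) :
    IsCycle (occ ∪ {t}) := by
  obtain ⟨hto, c₀, hc₀, htc₀⟩ := ht
  have ht' : t ∈ occ ∪ {t} := Or.inr rfl
  have hsub : occ ⊆ occ ∪ {t} := subset_union_left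
  have nbr : ∀ {f : LPt}, nsq f = 1 → ∀ i, t + rotCW^[i] f ∉ occ →
      t + rotCW^[i] f ∉ occ ∪ {t} := by
    rintro f hf i h (h' | h')
    · exact h h'
    · exact (adj_dir t f hf i).ne h'.symm
  -- the detour around `t`
  have detour : ∀ y z, Step occ y t → Step occ t z →
      Relation.ReflTransGen (Step (occ ∪ {t})) y z := by
    rintro y z ⟨c, hy, -, hc, hyc, et⟩ ⟨c', hz⟩
    have hty : hexGraph.Adj t y := by rw [et]; exact (adj_rotCW hyc).1.symm
    have htc : hexGraph.Adj t c := by rw [et]; exact (adj_rotCW hyc).2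
    obtain ⟨f, hf, j, hj, ey, ec⟩ := exists_rot hty htc
    have hex : ∃ i, t + rotCW^[i + 1] f ∈ occ := by
      refine ⟨j - 1, ?_⟩
      have : j ≠ 0 := by
        rintro rfl
        exact hy (by rw [ey, ← Function.iterate_zero_apply rotCW f, ← ec]; exact hc)
      rw [Nat.sub_add_cancel (by omega), ← ec]
      exact hc
    classical
    have hfree : ∀ i ≤ Nat.find hex, t + rotCW^[i] f ∉ occ := by
      intro i hi
      cases i with
      | zero => rw [Function.iterate_zero, id, ← ey]; exact hy
      | succ i => exact Nat.find_min hex hi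
    have hstep : StepAround occ t (t + rotCW^[Nat.find hex + 1] f) (t + rotCW^[Nat.find hex] f) :=
      ⟨hto, hfree _ le_rfl, Nat.find_spec hex, adj_dir t f hf _, rot_step t f _⟩
    rw [← (hocc.step_unique hstep hz).2, ey]
    have := rot_path (occ := occ ∪ {t}) ht' hf 0 (Nat.find hex)
      (fun i hi => nbr hf _ (hfree _ (by omega)))
    simpa using this
  have old : ∀ x, x ≠ t → ∀ y, Relation.ReflTransGen (Step occ) x y →
      (y ≠ t → Relation.ReflTransGen (Step (occ ∪ {t})) x y) ∧
      (y = t → ∀ z, Step occ t z → Relation.ReflTransGen (Step (occ ∪ {t})) x z) := by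
    intro x hx y h
    induction h with
    | refl => exact ⟨fun _ => .refl, fun e => absurd e hx⟩
    | @tail y y' _ hyy ih =>
      by_cases hy : y = t
      · subst hy
        refine ⟨fun _ => ih.2 rfl y' hyy, ?_⟩
        rintro rfl
        obtain ⟨c, h⟩ := hyy
        have hself := (adj_rotCW h.2.2.2.1).1
        rw [← h.2.2.2.2] at hself
        exact absurd hself (hexGraph.loopless.irrefl _)
      · constructor
        · intro hy'
          obtain ⟨c, h1, h2, h3, h4, h5⟩ := hyy
          exact (ih.1 hy).tail ⟨c, by rintro (h | h); exacts [h1 h, hy h],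
            by rintro (h | h); exacts [h2 h, hy' h], hsub h3, h4, h5⟩
        · rintro rfl z hz
          exact (ih.1 hy).trans (detour y z hyy hz)
  -- a free neighbour of `t` lies on an arc around `t` between points of the old cycle
  have ends : ∀ x ∈ edgeFollowingSet (occ ∪ {t}),
      (∃ a ∈ edgeFollowingSet occ, a ≠ t ∧ Relation.ReflTransGen (Step (occ ∪ {t})) a x) ∧
      (∃ b ∈ edgeFollowingSet occ, b ≠ t ∧ Relation.ReflTransGen (Step (occ ∪ {t})) x b) := by
    rintro x ⟨hx, v, hv, hxv⟩
    have hxo : x ∉ occ := fun h => hx (hsub h)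
    have hxt : x ≠ t := fun h => hx (Or.inr h)
    rcases hv with hv | hv
    · have : x ∈ edgeFollowingSet occ := ⟨hxo, v, hv, hxv⟩
      exact ⟨⟨x, this, hxt, .refl⟩, x, this, hxt, .refl⟩
    · rw [Set.mem_singleton_iff] at hv
      subst hv
      obtain ⟨f, hf, j, hj, ec, ex⟩ := exists_rot htc₀ hxv.symm
      have c0 : v + rotCW^[0] f ∈ occ := by rw [Function.iterate_zero, id, ← ec]; exact hc₀
      have c6 : v + rotCW^[6] f ∈ occ := by rw [rotCW_six, ← ec]; exact hc₀
      have hj0 : j ≠ 0 := by rintro rfl; exact hxo (ex ▸ c0)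
      have hxj : v + rotCW^[j] f ∉ occ := ex ▸ hxo
      obtain ⟨l, hl⟩ : ∃ l, j + l = 6 := ⟨6 - j, by omega⟩
      constructor
      · have key : ∀ n ≤ j, v + rotCW^[j - n] f ∉ occ → (∀ i ≤ n, v + rotCW^[j - n + i] f ∉ occ) →
            ∃ a, a ≤ j ∧ v + rotCW^[j - a] f ∈ edgeFollowingSet occ ∧
              ∀ i ≤ a, v + rotCW^[j - a + i] f ∉ occ := by
          intro n hn
          induction hm : j - n generalizing n with
          | zero => intro h; exact absurd c0 (by simpa using h)
          | succ m ih =>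
            intro h hall
            by_cases hmem : v + rotCW^[m] f ∈ occ
            · refine ⟨n, hn, ?_, by rw [hm]; exact hall⟩
              rw [hm]
              exact ⟨h, _, hmem, (adj_rot v f hf m).symm⟩
            · refine ih (n + 1) (by omega) (by omega) hmem fun i hi => ?_
              cases i with
              | zero => exact hmem
              | succ i =>
                have := hall i (by omega)
                rwa [show m + (i + 1) = m + 1 + i by omega]
        obtain ⟨a, ha, hE, hall⟩ := key 0 (by omega) hxj (fun i hi => by
          obtain rfl : i = 0 := by omega
          exact hxj)
        refine ⟨_, hE, (adj_dir v f hf _).ne.symm, ?_⟩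
        have := rot_path (occ := occ ∪ {v}) ht' hf (j - a) a (fun i hi => nbr hf _ (hall i hi))
        rw [Nat.sub_add_cancel ha, ← ex] at this
        exact this
      · classical
        have hex : ∃ i, v + rotCW^[j + i + 1] f ∈ occ :=
          ⟨l - 1, by rw [show j + (l - 1) + 1 = 6 by omega]; exact c6⟩
        have hfree : ∀ i ≤ Nat.find hex, v + rotCW^[j + i] f ∉ occ := by
          intro i hi
          cases i with
          | zero => exact hxj
          | succ i => exact Nat.find_min hex hi
        refine ⟨v + rotCW^[j + Nat.find hex] f, ⟨hfree _ le_rfl, _, Nat.find_spec hex,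
          adj_rot v f hf _⟩, (adj_dir v f hf _).ne.symm, ?_⟩
        have := rot_path (occ := occ ∪ {v}) ht' hf j (Nat.find hex)
          (fun i hi => nbr hf _ (hfree i hi))
        rw [← ex] at this
        exact this
  intro x hx y hy
  obtain ⟨-, b, hb, hbt, hxb⟩ := ends x hx
  obtain ⟨⟨a, ha, hat, hay⟩, -⟩ := ends y hy
  exact (hxb.trans ((old b hbt a (hcyc b hb a ha)).1 hat)).trans hay

theorem isCycle_singleton (t : LPt) : IsCycle {t} := by
  rintro x ⟨-, v, hv, hxv⟩ y ⟨-, v', hv', hyv⟩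
  rw [Set.mem_singleton_iff] at hv hv'
  rw [hv] at hxv
  rw [hv'] at hyv
  obtain ⟨f, hf, j, -, rfl, rfl⟩ := exists_rot hxv.symm hyv.symm
  have := rot_path (occ := {t}) rfl hf 0 j (fun i _ h => (adj_dir t f hf _).ne h.symm)
  simpa using this

theorem isCycle_cons {L : List LPt} {t : LPt} (hL : IsTight {x | x ∈ L}) (hc : IsCycle {x | x ∈ L})
    (ht : t ∉ L) (hadj : ∃ y ∈ L, nsq (t - y) = 1) : IsCycle {x | x ∈ t :: L} := by
  have e : {x | x ∈ t :: L} = {x | x ∈ L} ∪ {t} := by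
    ext x
    simp only [Set.mem_ofPred_eq, List.mem_cons, Set.mem_union, Set.mem_singleton_iff]
    tauto
  rw [e]
  exact hc.insert hL ⟨ht, hadj⟩

theorem isCycle_seeds : IsCycle seeds := by
  have h1 : IsCycle {x : LPt | x ∈ [((0 : ℤ), (0 : ℤ))]} := by
    have e : {x : LPt | x ∈ [((0 : ℤ), (0 : ℤ))]} = {(0, 0)} := by ext; simp
    rw [e]; exact isCycle_singleton _
  have h2 := isCycle_cons (t := (-1, 1)) (isTight_list (by decide) (by decide)) h1
    (by decide) (by decide)
  have h3 := isCycle_cons (t := (0, 1)) (isTight_list (by decide) (by decide)) h2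
    (by decide) (by decide)
  have h4 := isCycle_cons (t := (1, -1)) (isTight_list (by decide) (by decide)) h3
    (by decide) (by decide)
  have h5 := isCycle_cons (t := (0, -1)) (isTight_list (by decide) (by decide)) h4
    (by decide) (by decide)
  have e : {x : LPt | x ∈ [((0 : ℤ), (-1 : ℤ)), (1, -1), (0, 1), (-1, 1), (0, 0)]} = seeds := by
    ext x
    simp only [seeds, Set.mem_ofPred_eq, List.mem_cons, List.not_mem_nil, or_false,
      Set.mem_insert_iff, Set.mem_singleton_iff]
    tauto
  rw [e] at h5
  exact h5

/-- Growing a configuration along an initial segment keeps its boundary a cycle. -/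
theorem isCycle_union {P : Set LPt} {lt : Set LPt → Set LPt → Prop} (hP : HoleFree P)
    (hlt : IsCompleteTreeOrder P lt) {B : Set LPt} (hB : IsCycle B) (hsB : seeds ⊆ B)
    (hBP : ∀ x ∈ P, x ∉ B) (htight : ∀ A, IsInitial P lt A → IsTight (B ∪ A)) (n : ℕ) :
    ∀ A, IsInitial P lt A → A.Finite → A.ncard = n → IsCycle (B ∪ A) := by
  induction n with
  | zero =>
    intro A _ hfin hA
    rw [(Set.ncard_eq_zero hfin).1 hA, Set.union_empty]
    exact hB
  | succ n ih =>
    intro A hA hfin hcard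
    have hne : A.Nonempty := Set.nonempty_of_ncard_ne_zero (by omega)
    obtain ⟨t, htA, hmax⟩ := exists_isLargest (R := PointLT P lt) hfin hne
      (fun x hx y hy z hz => pointLT_trans hlt (hA.1 hx) (hA.1 hy) (hA.1 hz))
      (fun x hx y hy h => hP.pointLT_total hlt (hA.1 hx) (hA.1 hy) h)
    have hA' : IsInitial P lt (A \ {t}) := by
      refine ⟨fun x hx => hA.1 hx.1, fun x hx y hy hyx => ⟨hA.2 x hx.1 y hy hyx, ?_⟩⟩
      rintro rfl
      exact hP.pointLT_irrefl hlt hy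
        (pointLT_trans hlt hy (hA.1 hx.1) hy hyx (hmax x hx.1 hx.2))
    have hc := ih (A \ {t}) hA' (hfin.subset Set.sdiff_subset)
      (by rw [Set.ncard_sdiff_singleton_of_mem htA, hcard]; rfl)
    have e : B ∪ A = (B ∪ A \ {t}) ∪ {t} := by
      rw [Set.union_assoc, Set.sdiff_union_of_subset (Set.singleton_subset_iff.2 htA)]
    rw [e]
    refine hc.insert (htight _ hA') ⟨?_, ?_⟩
    · rintro (h | h)
      · exact hBP t (hA.1 htA) h
      · exact h.2 rfl
    · obtain ⟨y, hty, hy⟩ := hA.adj_mem hP hlt htA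
      exact ⟨y, hy.elim (fun h => Or.inl (hsB h)) (fun h => Or.inr ⟨h, hty.ne.symm⟩), hty⟩

end Cycle

/-- The boundary of the seeds together with finite initial segments of the idle half-plane and of
the shape is a cycle. -/
theorem isCycle_occ {S A T : Set LPt} {lt : Set LPt → Set LPt → Prop}
    (hS : IsProperRibbonization S) (hS' : HoleFree S) (hlt : IsCompleteTreeOrder S lt)
    (hA : IsInitial H₂ (TreeLT H₂) A) (hT : IsInitial S lt T) (hAfin : A.Finite)
    (hTfin : T.Finite) : IsCycle (seeds ∪ A ∪ T) := by
  refine isCycle_union hS' hlt (isCycle_union holeFree_idle isCompleteTreeOrder_idle isCycle_seeds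
    subset_rfl ?_ ?_ _ A hA hAfin rfl) subset_union_left ?_
    (fun T hT => isTight_occ hS hS' hlt hA hT) _ T hT hTfin rfl
  · intro x hx h
    have h1 : x.2 ≤ -2 := hx
    have := row_of_mem_seeds h
    omega
  · intro A hA
    have := isTight_occ hS hS' hlt hA (T := ∅) ⟨Set.empty_subset _, fun x hx => hx.elim⟩
    rwa [Set.union_empty] at this
  · rintro x hx (h | h)
    · have h1 : 2 ≤ x.2 := hS.subset_H₁ hx
      have := row_of_mem_seeds h
      omega
    · have h1 : 2 ≤ x.2 := hS.subset_H₁ hx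
      have h2 : x.2 ≤ -2 := hA.1 h
      omega

/-! ### Arcs of the edge-following path -/

theorem pos_add (d : ℝ) (x y : LPt) : pos d (x + y) = pos d x + pos d y := by
  apply Complex.ext <;> simp only [pos, Prod.fst_add, Prod.snd_add, Complex.add_re,
    Complex.add_im] <;> push_cast <;> ring

theorem pos_sub (d : ℝ) (x y : LPt) : pos d (x - y) = pos d x - pos d y := by
  rw [eq_sub_iff_add_eq, ← pos_add, sub_add_cancel]

theorem nsq_pos {v : LPt} (hv : v ≠ 0) : 1 ≤ nsq v := by
  have h1 := nsq_nonneg_form v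
  have h2 := nsq_form_fst v
  have h3 := sq_nonneg (2 * v.1 + v.2)
  have h4 := sq_nonneg (2 * v.2 + v.1)
  by_contra hcon
  apply hv
  have h5 : v.2 ^ 2 ≤ 0 := by omega
  have h6 : v.1 ^ 2 ≤ 0 := by omega
  have h7 : v.1 = 0 := by nlinarith
  have h8 : v.2 = 0 := by nlinarith
  exact Prod.ext h7 h8

theorem dist_pos_ge {d : ℝ} (hd : 0 < d) {x y : LPt} (h : x ≠ y) :
    d ≤ dist (pos d x) (pos d y) := by
  have h1 : (1 : ℝ) ≤ (nsq (x - y) : ℝ) := by exact_mod_cast nsq_pos (sub_ne_zero.2 h)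
  have h2 := dist_pos_sq d x y
  nlinarith [dist_nonneg (x := pos d x) (y := pos d y), sq_nonneg d]

theorem dist_pos_eq_iff {d : ℝ} (hd : 0 < d) {x y : LPt} :
    dist (pos d x) (pos d y) = d ↔ hexGraph.Adj x y := by
  have h2 := dist_pos_sq d x y
  rw [adj_iff]
  constructor
  · intro h
    rw [h] at h2
    have h3 : (nsq (x - y) : ℝ) = 1 := by
      have : d ^ 2 ≠ 0 := by positivity
      exact (mul_left_cancel₀ this (by rw [mul_one]; exact h2)).symm
    exact_mod_cast h3
  · intro h
    rw [h, Int.cast_one, mul_one] at h2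
    exact (sq_eq_sq₀ dist_nonneg hd.le).1 h2

theorem pos_injective {d : ℝ} (hd : 0 < d) : Function.Injective (pos d) := by
  intro x y h
  by_contra hne
  have := dist_pos_ge hd hne
  rw [h, dist_self] at this
  linarith

/-- The point reached from the lattice point `x` by a clockwise rotation around `c` by the
angle `u`. -/
noncomputable def arcPoint (d : ℝ) (c x : LPt) (u : ℝ) : ℂ :=
  pos d c + Complex.exp (-(u : ℂ) * Complex.I) * (pos d x - pos d c)

theorem continuous_arcPoint (d : ℝ) (c x : LPt) : Continuous (arcPoint d c x) := by
  unfold arcPoint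
  fun_prop

theorem arcPoint_zero (d : ℝ) (c x : LPt) : arcPoint d c x 0 = pos d x := by
  simp [arcPoint]

theorem arcPoint_end (d : ℝ) (c x : LPt) :
    arcPoint d c x (Real.pi / 3) = pos d (c + rotCW (x - c)) := by
  rw [arcPoint, pos_add, pos_rotCW, pos_sub]

theorem arcPoint_add (d : ℝ) (c x : LPt) (u t : ℝ) : arcPoint d c x (u + t) =
    pos d c + Complex.exp (-(t : ℂ) * Complex.I) * (arcPoint d c x u - pos d c) := by
  rw [arcPoint, arcPoint, add_sub_cancel_left, ← mul_assoc, ← Complex.exp_add]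
  congr 3
  push_cast
  ring

theorem dist_arcPoint_centre (d : ℝ) (c x : LPt) (u : ℝ) :
    dist (arcPoint d c x u) (pos d c) = dist (pos d x) (pos d c) := by
  rw [dist_eq_norm, arcPoint, add_sub_cancel_left, norm_mul, ← Complex.ofReal_neg,
    Complex.norm_exp_ofReal_mul_I, one_mul, dist_eq_norm]

/-- The coordinates of a rotated unit vector `e` with respect to `e` and `rotCW e`: after a rotation
by `u` they are `arcCoeff (π / 3 - u)` and `arcCoeff u`. -/
noncomputable def arcCoeff (u : ℝ) : ℝ := 2 / Real.sqrt 3 * Real.sin u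

theorem exp_eq_arcCoeff (u : ℝ) : Complex.exp (-(u : ℂ) * Complex.I) =
    arcCoeff (Real.pi / 3 - u) +
      arcCoeff u * Complex.exp (-((Real.pi / 3 : ℝ) : ℂ) * Complex.I) := by
  have h3 : Real.sqrt 3 ≠ 0 := by positivity
  have hsq : Real.sqrt 3 * Real.sqrt 3 = 3 := Real.mul_self_sqrt (by norm_num)
  have hc : ∀ t : ℝ, Complex.exp (-(t : ℂ) * Complex.I) = ⟨Real.cos t, -Real.sin t⟩ := by
    intro t
    apply Complex.ext
    · rw [← Complex.ofReal_neg, Complex.exp_ofReal_mul_I_re, Real.cos_neg]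
    · rw [← Complex.ofReal_neg, Complex.exp_ofReal_mul_I_im, Real.sin_neg]
  rw [hc, hc, Real.cos_pi_div_three, Real.sin_pi_div_three]
  have e1 : arcCoeff (Real.pi / 3 - u) = Real.cos u - Real.sin u / Real.sqrt 3 := by
    rw [arcCoeff, Real.sin_sub, Real.cos_pi_div_three, Real.sin_pi_div_three]
    field_simp
  have e2 : arcCoeff u * (Real.sqrt 3 / 2) = Real.sin u := by
    rw [arcCoeff]; field_simp
  apply Complex.ext
  · simp only [Complex.add_re, Complex.ofReal_re, Complex.mul_re, Complex.ofReal_im, zero_mul,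
      sub_zero]
    rw [e1, arcCoeff]
    field_simp
    ring
  · simp only [Complex.add_im, Complex.ofReal_re, Complex.mul_im, Complex.ofReal_im, zero_mul,
      add_zero, zero_add, mul_neg, e2]

/-- The norm in coordinates with respect to a unit vector and its rotation. -/
theorem norm_comb (d p q : ℝ) {e : LPt} (he : nsq e = 1) :
    ‖(p : ℂ) * pos d e + q * pos d (rotCW e)‖ ^ 2 = d ^ 2 * (p ^ 2 + p * q + q ^ 2) := by
  have h3 : Real.sqrt 3 ^ 2 = 3 := Real.sq_sqrt (by norm_num)
  have he' : (e.1 : ℝ) ^ 2 + e.1 * e.2 + e.2 ^ 2 = 1 := by exact_mod_cast he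
  rw [Complex.sq_norm, Complex.normSq_apply]
  simp only [Complex.add_re, Complex.add_im, Complex.mul_re, Complex.mul_im, Complex.ofReal_re,
    Complex.ofReal_im, zero_mul, sub_zero, add_zero, pos, rotCW]
  push_cast
  linear_combination (d ^ 2 * (p * e.2 - q * e.1) ^ 2 / 4) * h3 +
    (d ^ 2 * (p ^ 2 + p * q + q ^ 2)) * he'

/-- A unit vector and its rotation form a basis of the lattice. -/
theorem exists_coords {e : LPt} (he : nsq e = 1) (v : LPt) :
    ∃ a b : ℤ, v = a • e + b • rotCW e := by
  refine ⟨v.1 * e.1 + v.2 * (e.1 + e.2), v.1 * e.2 - v.2 * e.1, ?_⟩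
  simp only [nsq] at he
  ext
  · simp only [rotCW, Prod.fst_add, Prod.smul_fst, smul_eq_mul]
    linear_combination (-v.1) * he
  · simp only [rotCW, Prod.snd_add, Prod.smul_snd, smul_eq_mul]
    linear_combination (-v.2) * he

theorem pos_zsmul (d : ℝ) (a : ℤ) (x : LPt) : pos d (a • x) = (a : ℂ) * pos d x := by
  apply Complex.ext
  · simp only [pos, Complex.mul_re, Complex.intCast_re, Complex.intCast_im, zero_mul, sub_zero,
      Prod.smul_fst, Prod.smul_snd, smul_eq_mul]
    push_cast; ring
  · simp only [pos, Complex.mul_im, Complex.intCast_re, Complex.intCast_im, zero_mul, add_zero,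
      Prod.smul_snd, smul_eq_mul]
    push_cast; ring

theorem arcPoint_eq_comb (d : ℝ) (c x : LPt) (u : ℝ) : arcPoint d c x u = pos d c +
    ((arcCoeff (Real.pi / 3 - u) : ℂ) * pos d (x - c) + arcCoeff u * pos d (rotCW (x - c))) := by
  rw [arcPoint, exp_eq_arcCoeff, ← pos_sub, pos_rotCW]
  ring

theorem arcCoeff_sq (u : ℝ) : arcCoeff (Real.pi / 3 - u) ^ 2 +
    arcCoeff (Real.pi / 3 - u) * arcCoeff u + arcCoeff u ^ 2 = 1 := by
  have h := norm_comb 1 (arcCoeff (Real.pi / 3 - u)) (arcCoeff u) (e := (1, 0)) (by decide)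
  have h' := dist_arcPoint_centre 1 (0, 0) (1, 0) u
  have h0 : dist (pos 1 (1, 0)) (pos 1 (0, 0)) = 1 :=
    (dist_pos_eq_iff one_pos).2 (by rw [adj_iff]; decide)
  rw [dist_eq_norm, arcPoint_eq_comb, add_sub_cancel_left, h0] at h'
  rw [show ((1, 0) : LPt) - (0, 0) = (1, 0) from rfl] at h'
  rw [h'] at h
  linarith

theorem arcCoeff_nonneg {u : ℝ} (h0 : 0 ≤ u) (h1 : u ≤ Real.pi) : 0 ≤ arcCoeff u :=
  mul_nonneg (by positivity) (Real.sin_nonneg_of_nonneg_of_le_pi h0 h1)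

theorem arcCoeff_pos {u : ℝ} (h0 : 0 < u) (h1 : u < Real.pi) : 0 < arcCoeff u :=
  mul_pos (by positivity) (Real.sin_pos_of_pos_of_lt_pi h0 h1)

/-- The squared distance of a point of an arc from a lattice point in coordinates adapted to the
arc. -/
theorem dist_arcPoint_sq (d : ℝ) {c x : LPt} (hx : nsq (x - c) = 1) (u : ℝ) (a b : ℤ) :
    dist (arcPoint d c x u) (pos d (c + (a • (x - c) + b • rotCW (x - c)))) ^ 2 =
      d ^ 2 * (1 + ((a : ℝ) ^ 2 + a * b + b ^ 2 -
        a * (2 * arcCoeff (Real.pi / 3 - u) + arcCoeff u) -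
        b * (arcCoeff (Real.pi / 3 - u) + 2 * arcCoeff u))) := by
  have e : arcPoint d c x u - pos d (c + (a • (x - c) + b • rotCW (x - c))) =
      ((arcCoeff (Real.pi / 3 - u) - a : ℝ) : ℂ) * pos d (x - c) +
        ((arcCoeff u - b : ℝ) : ℂ) * pos d (rotCW (x - c)) := by
    rw [arcPoint_eq_comb, pos_add, pos_add, pos_zsmul, pos_zsmul]
    push_cast
    ring
  rw [dist_eq_norm, e, norm_comb d _ _ hx]
  linear_combination d ^ 2 * arcCoeff_sq u

/-- The values of the quadratic form bound the maxima over `1 ≤ s, t ≤ 2` of `a * s + b * t`, in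
each quadrant, except at three vectors. -/
theorem int_quad {a b : ℤ} (h10 : ¬(a = 1 ∧ b = 0)) (h01 : ¬(a = 0 ∧ b = 1))
    (h11 : ¬(a = 1 ∧ b = 1)) :
    (a ≤ 0 → b ≤ 0 → 0 ≤ a ^ 2 + a * b + b ^ 2) ∧
    (1 ≤ a → b ≤ -1 → 2 * a + b ≤ a ^ 2 + a * b + b ^ 2) ∧
    (a ≤ -1 → 1 ≤ b → a + 2 * b ≤ a ^ 2 + a * b + b ^ 2) ∧
    (0 ≤ a → 0 ≤ b → 2 * a + 2 * b ≤ a ^ 2 + a * b + b ^ 2) := by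
  have mixed : ∀ a b : ℤ, 1 ≤ a → b ≤ -1 → 2 * a + b ≤ a ^ 2 + a * b + b ^ 2 := by
    intro a b ha hb
    rcases hb.eq_or_lt with rfl | hb
    · nlinarith [show (0 : ℤ) ≤ (a - 1) * (a - 2) by
        rcases ha.eq_or_lt with rfl | h
        · simp
        · exact mul_nonneg (by omega) (by omega)]
    · nlinarith [sq_nonneg (2 * a + b - 2)]
  refine ⟨fun _ _ => by nlinarith [sq_nonneg (a + b), sq_nonneg a, sq_nonneg b], mixed a b, ?_, ?_⟩
  · intro ha hb
    have := mixed b a hb ha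
    linarith
  · intro ha hb
    have h : (a = 0 ∧ b = 0) ∨ (a = 0 ∧ 2 ≤ b) ∨ (2 ≤ a ∧ b = 0) ∨ (1 ≤ a ∧ 2 ≤ b) ∨
        (2 ≤ a ∧ 1 ≤ b) := by omega
    rcases h with ⟨rfl, rfl⟩ | ⟨rfl, h⟩ | ⟨h, rfl⟩ | ⟨h, h'⟩ | ⟨h, h'⟩ <;> nlinarith

/-- The difference of squared distances of a point of an arc from a lattice point and from the
centre of the arc, in adapted coordinates, where `s` and `t` are twice the inner products of the
point of the arc with the two basis vectors. -/
theorem quad_ge {s t : ℝ} (hs1 : 1 ≤ s) (hs2 : s ≤ 2) (ht1 : 1 ≤ t) (ht2 : t ≤ 2) {a b : ℤ}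
    (h10 : ¬(a = 1 ∧ b = 0)) (h01 : ¬(a = 0 ∧ b = 1)) (h11 : ¬(a = 1 ∧ b = 1)) :
    0 ≤ (a : ℝ) ^ 2 + a * b + b ^ 2 - a * s - b * t ∧
    (s < 2 → t < 2 → ¬(a = 0 ∧ b = 0) → 0 < (a : ℝ) ^ 2 + a * b + b ^ 2 - a * s - b * t) := by
  obtain ⟨k1, k2, k3, k4⟩ := int_quad h10 h01 h11
  rcases le_or_gt a 0 with ha | ha <;> rcases le_or_gt b 0 with hb | hb
  · have h := k1 ha hb
    have h' : (0 : ℝ) ≤ (a : ℝ) ^ 2 + a * b + b ^ 2 := by exact_mod_cast h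
    have ha' : (a : ℝ) ≤ 0 := by exact_mod_cast ha
    have hb' : (b : ℝ) ≤ 0 := by exact_mod_cast hb
    have m1 : (a : ℝ) * s ≤ a := by nlinarith
    have m2 : (b : ℝ) * t ≤ b := by nlinarith
    refine ⟨by linarith, fun _ _ hne => ?_⟩
    have : a + b < 0 := by omega
    have : (a : ℝ) + b < 0 := by exact_mod_cast this
    linarith
  · rcases ha.eq_or_lt with rfl | ha
    · have h := k4 le_rfl hb.le
      have h' : 2 * ((0 : ℤ) : ℝ) + 2 * b ≤ ((0 : ℤ) : ℝ) ^ 2 + ((0 : ℤ) : ℝ) * b + b ^ 2 := by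
        exact_mod_cast h
      have hb' : (0 : ℝ) < b := by exact_mod_cast hb
      have m : (b : ℝ) * t ≤ b * 2 := by nlinarith
      push_cast at h' ⊢
      refine ⟨by linarith, fun _ ht _ => ?_⟩
      have m : (b : ℝ) * t < b * 2 := by nlinarith
      linarith
    · have h := k3 (by omega) hb
      have h' : (a : ℝ) + 2 * b ≤ (a : ℝ) ^ 2 + a * b + b ^ 2 := by exact_mod_cast h
      have ha' : (a : ℝ) < 0 := by exact_mod_cast ha
      have hb' : (0 : ℝ) < b := by exact_mod_cast hb
      have m1 : (a : ℝ) * s ≤ a := by nlinarith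
      have m2 : (b : ℝ) * t ≤ b * 2 := by nlinarith
      refine ⟨by linarith, fun _ ht _ => ?_⟩
      have m : (b : ℝ) * t < b * 2 := by nlinarith
      linarith
  · rcases hb.eq_or_lt with rfl | hb
    · have h := k4 ha.le le_rfl
      have h' : 2 * (a : ℝ) + 2 * ((0 : ℤ) : ℝ) ≤ (a : ℝ) ^ 2 + a * ((0 : ℤ) : ℝ) +
          ((0 : ℤ) : ℝ) ^ 2 := by exact_mod_cast h
      have ha' : (0 : ℝ) < a := by exact_mod_cast ha
      have m : (a : ℝ) * s ≤ a * 2 := by nlinarith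
      push_cast at h' ⊢
      refine ⟨by linarith, fun hs _ _ => ?_⟩
      have m : (a : ℝ) * s < a * 2 := by nlinarith
      linarith
    · have h := k2 ha (by omega)
      have h' : 2 * (a : ℝ) + b ≤ (a : ℝ) ^ 2 + a * b + b ^ 2 := by exact_mod_cast h
      have ha' : (0 : ℝ) < a := by exact_mod_cast ha
      have hb' : (b : ℝ) < 0 := by exact_mod_cast hb
      have m1 : (a : ℝ) * s ≤ a * 2 := by nlinarith
      have m2 : (b : ℝ) * t ≤ b := by nlinarith
      refine ⟨by linarith, fun hs _ _ => ?_⟩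
      have m : (a : ℝ) * s < a * 2 := by nlinarith
      linarith
  · have h := k4 ha.le hb.le
    have h' : 2 * (a : ℝ) + 2 * b ≤ (a : ℝ) ^ 2 + a * b + b ^ 2 := by exact_mod_cast h
    have ha' : (0 : ℝ) < a := by exact_mod_cast ha
    have hb' : (0 : ℝ) < b := by exact_mod_cast hb
    have m1 : (a : ℝ) * s ≤ a * 2 := by nlinarith
    have m2 : (b : ℝ) * t ≤ b * 2 := by nlinarith
    refine ⟨by linarith, fun hs _ _ => ?_⟩
    have m : (a : ℝ) * s < a * 2 := by nlinarith
    linarith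

theorem coeff_bounds {α β : ℝ} (hα : 0 ≤ α) (hβ : 0 ≤ β) (h : α ^ 2 + α * β + β ^ 2 = 1) :
    1 ≤ 2 * α + β ∧ 2 * α + β ≤ 2 := by
  constructor
  · nlinarith [mul_nonneg hα hβ]
  · nlinarith [mul_nonneg hα hβ, sq_nonneg β]

theorem coeff_bounds_strict {α β : ℝ} (hα : 0 < α) (hβ : 0 < β)
    (h : α ^ 2 + α * β + β ^ 2 = 1) : 1 < 2 * α + β ∧ 2 * α + β < 2 := by
  have h1 := mul_pos hα hβ
  have h2 : 0 < β ^ 2 := by positivity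
  constructor <;> nlinarith

section ArcDistances

variable {d : ℝ} {c x y : LPt} {u : ℝ}

/-- On the arc from `x` to the next point around `c` all lattice points except for these two points
and the reflection of `c` in them are at distance at least `d`. -/
theorem arcPoint_dist_ge (hd : 0 < d) (hxc : hexGraph.Adj x c) (hu0 : 0 ≤ u) (hu1 : u ≤ Real.pi / 3)
    (h1 : y ≠ x) (h2 : y ≠ c + rotCW (x - c)) (h3 : y ≠ x + rotCW (x - c)) :
    d ≤ dist (arcPoint d c x u) (pos d y) ∧
      (0 < u → u < Real.pi / 3 → y ≠ c → d < dist (arcPoint d c x u) (pos d y)) := by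
  have hpi := Real.pi_pos
  obtain ⟨a, b, hab⟩ := exists_coords hxc (y - c)
  have ey : y = c + (a • (x - c) + b • rotCW (x - c)) := by rw [← hab]; abel
  have hdist := dist_arcPoint_sq d hxc u a b
  rw [← ey] at hdist
  have hα := arcCoeff_nonneg (u := Real.pi / 3 - u) (by linarith) (by linarith)
  have hβ := arcCoeff_nonneg hu0 (by linarith)
  have hsq := arcCoeff_sq u
  have hsq' : arcCoeff u ^ 2 + arcCoeff u * arcCoeff (Real.pi / 3 - u) +
      arcCoeff (Real.pi / 3 - u) ^ 2 = 1 := by linarith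
  have b1 := coeff_bounds hα hβ hsq
  have b2 := coeff_bounds hβ hα hsq'
  have hq := quad_ge b1.1 b1.2 (t := arcCoeff (Real.pi / 3 - u) + 2 * arcCoeff u)
    (by linarith) (by linarith) (a := a) (b := b)
    (by rintro ⟨rfl, rfl⟩; exact h1 (by rw [ey]; simp))
    (by rintro ⟨rfl, rfl⟩; exact h2 (by rw [ey]; simp))
    (by rintro ⟨rfl, rfl⟩; exact h3 (by rw [ey]; simp [← add_assoc]))
  constructor
  · have : d ^ 2 ≤ dist (arcPoint d c x u) (pos d y) ^ 2 := by
      rw [hdist]; nlinarith [sq_nonneg d, hq.1]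
    exact (sq_le_sq₀ hd.le dist_nonneg).1 this
  · intro hu0' hu1' hyc
    have s1 := coeff_bounds_strict (arcCoeff_pos (u := Real.pi / 3 - u) (by linarith) (by linarith))
      (arcCoeff_pos hu0' (by linarith)) hsq
    have s2 := coeff_bounds_strict (arcCoeff_pos hu0' (by linarith))
      (arcCoeff_pos (u := Real.pi / 3 - u) (by linarith) (by linarith)) hsq'
    have hq' := hq.2 s1.2 (by linarith) (by rintro ⟨rfl, rfl⟩; exact hyc (by rw [ey]; simp))
    have : d ^ 2 < dist (arcPoint d c x u) (pos d y) ^ 2 := by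
      rw [hdist]
      have hd2 : 0 < d ^ 2 := by positivity
      nlinarith [mul_pos hd2 hq']
    exact (sq_lt_sq₀ hd.le dist_nonneg).1 this

/-- The three exceptional points are closer than `d` to the interior of the arc. -/
theorem arcPoint_dist_lt (hd : 0 < d) (hxc : hexGraph.Adj x c) (hu0 : 0 < u)
    (hu1 : u < Real.pi / 3)
    (hy : y = x ∨ y = c + rotCW (x - c) ∨ y = x + rotCW (x - c)) :
    dist (arcPoint d c x u) (pos d y) < d := by
  have hpi := Real.pi_pos
  have hsq := arcCoeff_sq u
  have hα := arcCoeff_pos (u := Real.pi / 3 - u) (by linarith) (by linarith)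
  have hβ := arcCoeff_pos hu0 (by linarith)
  have s1 := coeff_bounds_strict hα hβ hsq
  have s2 := coeff_bounds_strict hβ hα (by linarith)
  have hsum : 1 < arcCoeff (Real.pi / 3 - u) + arcCoeff u := by nlinarith [mul_pos hα hβ]
  have hd2 : 0 < d ^ 2 := by positivity
  have key : ∀ a b : ℤ, y = c + (a • (x - c) + b • rotCW (x - c)) →
      (a : ℝ) ^ 2 + a * b + b ^ 2 - a * (2 * arcCoeff (Real.pi / 3 - u) + arcCoeff u) -
        b * (arcCoeff (Real.pi / 3 - u) + 2 * arcCoeff u) < 0 →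
      dist (arcPoint d c x u) (pos d y) < d := by
    intro a b ey hneg
    have hdist := dist_arcPoint_sq d hxc u a b
    rw [← ey] at hdist
    refine (sq_lt_sq₀ dist_nonneg hd.le).1 ?_
    rw [hdist]
    nlinarith [mul_pos_of_neg_of_neg hneg (neg_neg_of_pos hd2)]
  rcases hy with rfl | rfl | rfl
  · exact key 1 0 (by simp) (by push_cast; linarith)
  · exact key 0 1 (by simp) (by push_cast; linarith)
  · exact key 1 1 (by simp [← add_assoc]) (by push_cast; linarith)

/-- From an interior point of an arc only the centre of the arc is at distance `d`. -/
theorem eq_centre_of_dist_eq (hd : 0 < d) (hxc : hexGraph.Adj x c) (hu0 : 0 < u)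
    (hu1 : u < Real.pi / 3) (h : dist (arcPoint d c x u) (pos d y) = d) : y = c := by
  by_contra hyc
  by_cases hy : y = x ∨ y = c + rotCW (x - c) ∨ y = x + rotCW (x - c)
  · exact (arcPoint_dist_lt hd hxc hu0 hu1 hy).ne h
  · simp only [not_or] at hy
    exact ((arcPoint_dist_ge hd hxc hu0.le hu1.le hy.1 hy.2.1 hy.2.2).2 hu0 hu1 hyc).ne' h

end ArcDistances

/-- Every point at distance `d` from a lattice point `c` lies on one of the six arcs around `c`. -/
theorem exists_arcPoint {d : ℝ} {c : LPt} {w : ℂ} (hw : dist w (pos d c) = d) :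
    ∃ x, hexGraph.Adj x c ∧ ∃ u, 0 ≤ u ∧ u < Real.pi / 3 ∧ w = arcPoint d c x u := by
  have hpi : 0 < Real.pi / 3 := by positivity
  set e : LPt := (1, 0) with he
  have hpos : pos d e = d := by apply Complex.ext <;> simp [pos, he]
  have hnorm : ‖w - pos d c‖ = d := by rw [← dist_eq_norm]; exact hw
  set θ : ℝ := -Complex.arg (w - pos d c) + 2 * Real.pi with hθ
  have hθ0 : 0 ≤ θ := by have := Complex.arg_le_pi (w - pos d c); rw [hθ]; linarith [Real.pi_pos]
  have hexp : w - pos d c = Complex.exp (-(θ : ℂ) * Complex.I) * pos d e := by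
    have h1 := Complex.norm_mul_exp_arg_mul_I (w - pos d c)
    rw [hnorm] at h1
    rw [hpos, mul_comm, ← h1]
    congr 1
    · rw [hθ]
      push_cast
      rw [show -(-(Complex.arg (w - pos d c) : ℂ) + 2 * (Real.pi : ℂ)) * Complex.I =
        (Complex.arg (w - pos d c) : ℂ) * Complex.I - 2 * (Real.pi : ℂ) * Complex.I by ring,
        Complex.exp_sub, Complex.exp_two_pi_mul_I, div_one]
  have hiter : ∀ n : ℕ, pos d (rotCW^[n] e) =
      Complex.exp (-((n * (Real.pi / 3) : ℝ) : ℂ) * Complex.I) * pos d e := by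
    intro n
    induction n with
    | zero => simp
    | succ n ih =>
      rw [Function.iterate_succ_apply', pos_rotCW, ih, ← mul_assoc, ← Complex.exp_add]
      congr 2
      push_cast
      ring
  set n := ⌊θ / (Real.pi / 3)⌋₊ with hn
  have h1 : (n : ℝ) * (Real.pi / 3) ≤ θ := by
    rw [← le_div_iff₀ hpi]
    exact Nat.floor_le (by positivity)
  have h2 : θ < (n + 1 : ℝ) * (Real.pi / 3) := by
    rw [← div_lt_iff₀ hpi]
    exact Nat.lt_floor_add_one _
  refine ⟨c + rotCW^[n] e, (adj_dir c e (by decide) n).symm, θ - n * (Real.pi / 3), by linarith,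
    by linarith, ?_⟩
  rw [arcPoint, pos_add, add_sub_cancel_left, hiter, ← mul_assoc, ← Complex.exp_add,
    ← sub_eq_iff_eq_add', hexp]
  congr 2
  push_cast
  ring

section Arcs

variable {occ : Set LPt} {d : ℝ} {x y c c' x' y' : LPt} {u t : ℝ}

theorem StepAround.ne (h : StepAround occ x c x') : x ≠ x' := by
  have := (adj_rotCW h.2.2.2.1).1
  rw [← h.2.2.2.2] at this
  exact this.ne

/-- The arc of a step lies on the edge-following path: the only lattice points closer than `d` are
its end points and the reflection of its centre, which is free because the configuration is
tight. -/
theorem StepAround.arcPoint_mem (hocc : IsTight occ) (hd : 0 < d) (h : StepAround occ x c x')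
    (hu0 : 0 ≤ u) (hu1 : u ≤ Real.pi / 3) : arcPoint d c x u ∈ edgeFollowingPath d occ := by
  have hne := h.ne
  obtain ⟨hx, hx', hc, hxc, ex⟩ := h
  refine ⟨⟨c, hc, ?_⟩, fun z hz => ?_⟩
  · rw [dist_arcPoint_centre]; exact (dist_pos_eq_iff hd).2 hxc
  · refine (arcPoint_dist_ge hd hxc hu0 hu1 (fun e => hx (e ▸ hz)) (fun e => hx' ?_) ?_).1
    · rw [ex, ← e]; exact hz
    · intro e
      have hn : nsq (x - c) = 1 := hxc
      have h3 : nsq (c - z) = 3 := by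
        rw [e]
        simp only [nsq, rotCW, Prod.fst_add, Prod.snd_add, Prod.fst_sub, Prod.snd_sub] at hn ⊢
        linear_combination 3 * hn
      have ax : hexGraph.Adj z x := by
        rw [e, hexGraph.adj_comm, adj_add_iff, nsq_rotCW]; exact hxc
      have ax' : hexGraph.Adj z x' := by
        rw [adj_iff, show z - x' = x - c by rw [e, ex]; abel]; exact hxc
      have acx' : hexGraph.Adj c x' := by rw [ex]; exact (adj_rotCW hxc).2.symm
      obtain ⟨m, hm, h5, h6⟩ := (hocc c hc z hz).1 h3
      by_cases hmx : m = x'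
      · exact hx' (hmx ▸ hm)
      · exact hx (common_eq h3 h5 h6 hxc.symm ax acx' ax' hmx hne ▸ hm)

/-- A rotation by a small positive angle that does not meet an occupied point is the beginning of a
step. -/
theorem stepAround_of_arcPoint_mem (hd : 0 < d) (hc : c ∈ occ) (hxc : hexGraph.Adj x c)
    (hu0 : 0 < u) (hu1 : u < Real.pi / 3) (h : arcPoint d c x u ∈ edgeFollowingPath d occ) :
    StepAround occ x c (c + rotCW (x - c)) :=
  ⟨fun hx => (arcPoint_dist_lt hd hxc hu0 hu1 (.inl rfl)).not_ge (h.2 _ hx),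
    fun hx => (arcPoint_dist_lt hd hxc hu0 hu1 (.inr (.inl rfl))).not_ge (h.2 _ hx), hc, hxc, rfl⟩

theorem pos_mem_edgeFollowingPath_iff (hd : 0 < d) :
    pos d x ∈ edgeFollowingPath d occ ↔ x ∈ edgeFollowingSet occ := by
  constructor
  · rintro ⟨⟨c, hc, h⟩, h'⟩
    refine ⟨fun hx => ?_, c, hc, (dist_pos_eq_iff hd).1 h⟩
    have := h' x hx
    rw [dist_self] at this
    linarith
  · rintro ⟨hx, c, hc, h⟩
    exact ⟨⟨c, hc, (dist_pos_eq_iff hd).2 h⟩, fun c hc => dist_pos_ge hd fun e => hx (e ▸ hc)⟩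

/-- Every point of the edge-following path lies on the arc of a step. -/
theorem exists_step_of_mem_path (hocc : IsTight occ) (hd : 0 < d) {w : ℂ}
    (hw : w ∈ edgeFollowingPath d occ) : ∃ x c x' u, StepAround occ x c x' ∧ 0 ≤ u ∧
      u < Real.pi / 3 ∧ w = arcPoint d c x u := by
  obtain ⟨c, hc, hdist⟩ := hw.1
  obtain ⟨x, hxc, u, hu0, hu1, e⟩ := exists_arcPoint hdist
  rcases hu0.eq_or_lt with rfl | hu0'
  · rw [arcPoint_zero] at e
    obtain ⟨x', c', h⟩ := hocc.exists_step ((pos_mem_edgeFollowingPath_iff hd).1 (e ▸ hw))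
    exact ⟨x, c', x', 0, h, le_rfl, hu1, by rw [arcPoint_zero, e]⟩
  · exact ⟨x, c, _, u, stepAround_of_arcPoint_mem hd hc hxc hu0' hu1 (e ▸ hw), hu0, hu1, e⟩

/-- The half-open arcs of different steps are disjoint. -/
theorem arcPoint_inj (hd : 0 < d) (h : StepAround occ x c x') (h' : StepAround occ y c' y')
    (hu0 : 0 ≤ u) (hu1 : u < Real.pi / 3) (ht0 : 0 ≤ t) (ht1 : t < Real.pi / 3)
    (he : arcPoint d c x u = arcPoint d c' y t) : x = y ∧ u = t := by
  have hpi := Real.pi_pos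
  have one : ∀ {x y c c' x' y' : LPt} {t : ℝ}, StepAround occ x c x' → StepAround occ y c' y' →
      0 < t → t < Real.pi / 3 → arcPoint d c x 0 = arcPoint d c' y t → False := by
    intro x y c c' x' y' t _ h' ht0 ht1 he
    rw [arcPoint_zero] at he
    have close : ∀ z, dist (arcPoint d c' y t) (pos d z) < d → x = z := by
      intro z hz
      by_contra hne
      rw [← he] at hz
      exact hz.not_ge (dist_pos_ge hd hne)
    refine h'.ne ((close y ?_).symm.trans (close y' ?_))
    · exact arcPoint_dist_lt hd h'.2.2.2.1 ht0 ht1 (.inl rfl)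
    · exact arcPoint_dist_lt hd h'.2.2.2.1 ht0 ht1 (.inr (.inl h'.2.2.2.2))
  rcases hu0.eq_or_lt with rfl | hu0' <;> rcases ht0.eq_or_lt with rfl | ht0'
  · rw [arcPoint_zero, arcPoint_zero] at he
    exact ⟨pos_injective hd he, rfl⟩
  · exact (one h h' ht0' ht1 he).elim
  · exact (one h' h hu0' hu1 he.symm).elim
  · have hxc := h.2.2.2.1
    have hyc := h'.2.2.2.1
    have hcc : c' = c := by
      refine eq_centre_of_dist_eq hd hxc hu0' hu1 ?_
      rw [he, dist_arcPoint_centre]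
      exact (dist_pos_eq_iff hd).2 hyc
    subst hcc
    have near : ∀ {x y : LPt} {u t : ℝ}, hexGraph.Adj x c' → hexGraph.Adj y c' → 0 < u →
        u < Real.pi / 3 → 0 < t → t < Real.pi / 3 → arcPoint d c' x u = arcPoint d c' y t →
        y = x ∨ y = c' + rotCW (x - c') := by
      intro x y u t hxc hyc hu0 hu1 ht0 ht1 he
      by_contra! hcon
      refine (arcPoint_dist_ge hd hxc hu0.le hu1.le hcon.1 hcon.2 ?_).1.not_gt ?_
      · rintro rfl
        have hn : nsq (x - c') = 1 := hxc
        have hn' : nsq (x + rotCW (x - c') - c') = 1 := hyc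
        have : nsq (x + rotCW (x - c') - c') = 3 * nsq (x - c') := by
          simp only [nsq, rotCW, Prod.fst_add, Prod.snd_add, Prod.fst_sub, Prod.snd_sub]
          ring
        omega
      · rw [he]
        exact arcPoint_dist_lt hd hyc ht0 ht1 (.inl rfl)
    have hxy : x = y := by
      rcases near hxc hyc hu0' hu1 ht0' ht1 he with e | e
      · exact e.symm
      rcases near hyc hxc ht0' ht1 hu0' hu1 he.symm with e' | e'
      · exact e'
      · have hn : nsq (x - c') = 1 := hxc
        obtain ⟨x1, x2⟩ := x
        obtain ⟨y1, y2⟩ := y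
        obtain ⟨c1, c2⟩ := c'
        simp only [nsq, rotCW, Prod.ext_iff, Prod.fst_add, Prod.snd_add, Prod.fst_sub,
          Prod.snd_sub] at *
        obtain ⟨e1, e2⟩ := e
        obtain ⟨e3, e4⟩ := e'
        have k1 : x1 = c1 := by omega
        have k2 : x2 = c2 := by omega
        rw [k1, k2] at hn
        simp at hn
    subst hxy
    refine ⟨rfl, ?_⟩
    have hne : pos d x - pos d c' ≠ 0 := sub_ne_zero.2 fun e => hxc.ne (pos_injective hd e)
    have hexp := mul_right_cancel₀ hne (add_left_cancel he)
    have him : ∀ s : ℝ, (-(s : ℂ) * Complex.I).im = -s := by intro s; simp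
    have := Complex.exp_inj_of_neg_pi_lt_of_le_pi (by rw [him]; linarith) (by rw [him]; linarith)
      (by rw [him]; linarith) (by rw [him]; linarith) hexp
    have := congrArg Complex.im this
    rw [him, him] at this
    linarith

end Arcs

/-! ### The boundary cycle -/

/-- The bi-infinite periodic walk of an edge-following robot on the lattice: `v i` is the position
after `i` steps, `ctr i` the occupied point around which the next step rotates, and `m` is the
number of points of the edge-following set. -/
structure BoundaryOrbit (occ : Set LPt) (m : ℕ) (v ctr : ℤ → LPt) : Prop where
  pos_length : 0 < m
  step : ∀ i, StepAround occ (v i) (ctr i) (v (i + 1))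
  eq_iff : ∀ i j, v i = v j ↔ (m : ℤ) ∣ i - j
  exhaust : ∀ x ∈ edgeFollowingSet occ, ∃ i, v i = x

/-- In a tight configuration steps are unique, so the boundary cycle is the orbit of the step map.
-/
theorem exists_boundaryOrbit {occ : Set LPt} (hocc : IsTight occ) (hcyc : IsCycle occ) {a : LPt}
    (ha : a ∈ edgeFollowingSet occ) : ∃ m v ctr, BoundaryOrbit occ m v ctr ∧ v 0 = a := by
  classical
  have hex : ∀ x : LPt, ∃ y, x ∈ edgeFollowingSet occ → Step occ x y := by
    intro x
    by_cases hx : x ∈ edgeFollowingSet occ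
    · obtain ⟨y, hy⟩ := hocc.exists_step hx; exact ⟨y, fun _ => hy⟩
    · exact ⟨x, fun h => (hx h).elim⟩
  choose N hN using hex
  have uniq : ∀ {x y : LPt}, Step occ x y → y = N x := by
    rintro x y ⟨c, h⟩
    obtain ⟨c', h'⟩ := hN x h.mem_left
    exact (hocc.step_unique h h').2
  have hmem : ∀ n : ℕ, N^[n] a ∈ edgeFollowingSet occ := by
    intro n
    induction n with
    | zero => exact ha
    | succ n ih =>
      rw [Function.iterate_succ_apply']
      obtain ⟨c, h⟩ := hN _ ih
      exact h.mem_right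
  have hiter : ∀ {x y : LPt}, Relation.ReflTransGen (Step occ) x y → ∃ n : ℕ, N^[n] x = y := by
    intro x y h
    induction h with
    | refl => exact ⟨0, rfl⟩
    | tail _ h ih =>
      obtain ⟨n, rfl⟩ := ih
      exact ⟨n + 1, by rw [Function.iterate_succ_apply', uniq h]⟩
  have hper : a ∈ Function.periodicPts N := by
    obtain ⟨n, hn⟩ := hiter (hcyc _ (hmem 1) a ha)
    exact ⟨n + 1, n.succ_pos, hn⟩
  have hm := Function.minimalPeriod_pos_of_mem_periodicPts hper
  set m := Function.minimalPeriod N a with hm_def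
  have hm' : (0 : ℤ) < m := by exact_mod_cast hm
  have hlt : ∀ i : ℤ, (i % m).toNat < m := by
    intro i
    have := Int.emod_lt_of_pos i hm'
    have := Int.emod_nonneg i hm'.ne'
    omega
  have hsucc : ∀ i : ℤ, N^[((i + 1) % m).toNat] a = N (N^[(i % m).toNat] a) := by
    intro i
    have e : ((i + 1) % m).toNat = ((i % m).toNat + 1) % m := by
      zify
      rw [Int.toNat_of_nonneg (Int.emod_nonneg _ hm'.ne'),
        Int.toNat_of_nonneg (Int.emod_nonneg _ hm'.ne'), Int.emod_add_emod]
    rw [e, hm_def, Function.iterate_mod_minimalPeriod_eq, Function.iterate_succ_apply']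
  have hstep : ∀ i : ℤ, Step occ (N^[(i % m).toNat] a) (N^[((i + 1) % m).toNat] a) := by
    intro i
    rw [hsucc]
    exact hN _ (hmem _)
  choose ctr hctr using hstep
  refine ⟨m, fun i => N^[(i % m).toNat] a, ctr, ⟨hm, hctr, fun i j => ?_, fun x hx => ?_⟩, by simp⟩
  · rw [Function.iterate_eq_iterate_iff_of_lt_minimalPeriod (hlt i) (hlt j),
      Int.dvd_iff_emod_eq_zero, ← Int.emod_eq_emod_iff_emod_sub_eq_zero]
    have := Int.emod_nonneg i hm'.ne'
    have := Int.emod_nonneg j hm'.ne'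
    omega
  · obtain ⟨n, rfl⟩ := hiter (hcyc _ ha x hx)
    refine ⟨n, ?_⟩
    rw [← Function.iterate_mod_minimalPeriod_eq (n := n), ← hm_def]
    congr 2

/-! ### The boundary curve -/

/-- The motion with unit angular speed along the walk `v` with centres `ctr`: the `i`-th step takes
the time interval from `i * π / 3` to `(i + 1) * π / 3`. -/
noncomputable def boundaryCurve (d : ℝ) (v ctr : ℤ → LPt) (τ : ℝ) : ℂ :=
  arcPoint d (ctr ⌊τ / (Real.pi / 3)⌋) (v ⌊τ / (Real.pi / 3)⌋)
    (τ - ⌊τ / (Real.pi / 3)⌋ * (Real.pi / 3))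

theorem exists_time_step (τ : ℝ) :
    ∃ i : ℤ, i * (Real.pi / 3) ≤ τ ∧ τ < (i + 1) * (Real.pi / 3) ∧ ⌊τ / (Real.pi / 3)⌋ = i := by
  have hpi : 0 < Real.pi / 3 := by positivity
  exact ⟨_, (le_div_iff₀ hpi).1 (Int.floor_le _), (div_lt_iff₀ hpi).1 (Int.lt_floor_add_one _), rfl⟩

namespace BoundaryOrbit

variable {occ : Set LPt} {m : ℕ} {v ctr : ℤ → LPt} {d τ : ℝ}

theorem curve_eq (h : BoundaryOrbit occ m v ctr) (i : ℤ) (h0 : i * (Real.pi / 3) ≤ τ)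
    (h1 : τ ≤ (i + 1) * (Real.pi / 3)) :
    boundaryCurve d v ctr τ = arcPoint d (ctr i) (v i) (τ - i * (Real.pi / 3)) := by
  have hpi : 0 < Real.pi / 3 := by positivity
  rcases h1.eq_or_lt with rfl | h1
  · have e : ⌊((i : ℝ) + 1) * (Real.pi / 3) / (Real.pi / 3)⌋ = i + 1 := by
      rw [mul_div_cancel_right₀ _ hpi.ne']
      exact_mod_cast Int.floor_intCast (R := ℝ) (i + 1)
    have e1 : ((i : ℝ) + 1) * (Real.pi / 3) - ((i + 1 : ℤ) : ℝ) * (Real.pi / 3) = 0 := by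
      push_cast; ring
    have e2 : ((i : ℝ) + 1) * (Real.pi / 3) - i * (Real.pi / 3) = Real.pi / 3 := by ring
    rw [boundaryCurve, e, e1, e2, arcPoint_zero, arcPoint_end, ← (h.step i).2.2.2.2]
  · have e : ⌊τ / (Real.pi / 3)⌋ = i :=
      Int.floor_eq_iff.2 ⟨(le_div_iff₀ hpi).2 h0, (div_lt_iff₀ hpi).2 h1⟩
    rw [boundaryCurve, e]

theorem curve_int (h : BoundaryOrbit occ m v ctr) (i : ℤ) :
    boundaryCurve d v ctr (i * (Real.pi / 3)) = pos d (v i) := by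
  have hpi : 0 < Real.pi / 3 := by positivity
  rw [h.curve_eq i le_rfl (by nlinarith), sub_self, arcPoint_zero]

theorem continuous_curve (h : BoundaryOrbit occ m v ctr) : Continuous (boundaryCurve d v ctr) := by
  have hpi : 0 < Real.pi / 3 := by positivity
  have piece : ∀ i : ℤ, ContinuousOn (boundaryCurve d v ctr)
      (Icc (i * (Real.pi / 3)) ((i + 1) * (Real.pi / 3))) := by
    intro i
    refine ContinuousOn.congr (f := fun τ => arcPoint d (ctr i) (v i) (τ - i * (Real.pi / 3))) ?_
      fun τ hτ => h.curve_eq i hτ.1 hτ.2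
    exact ((continuous_arcPoint d _ _).comp (continuous_id.sub continuous_const)).continuousOn
  rw [continuous_iff_continuousAt]
  intro τ
  obtain ⟨i, h0, h1, -⟩ := exists_time_step τ
  have h2 := (piece (i - 1)).union_of_isClosed (piece i) isClosed_Icc isClosed_Icc
  refine h2.continuousAt ?_
  refine Filter.mem_of_superset (Ioo_mem_nhds (a := (i - 1) * (Real.pi / 3)) (by nlinarith) h1) ?_
  intro t ht
  push_cast
  rw [sub_add_cancel]
  rcases le_total t (i * (Real.pi / 3)) with h | h
  · exact .inl ⟨ht.1.le, h⟩
  · exact .inr ⟨h, ht.2.le⟩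

theorem v_add_mul (h : BoundaryOrbit occ m v ctr) (i z : ℤ) : v (i + z * m) = v i :=
  (h.eq_iff _ _).2 ⟨z, by ring⟩

theorem ctr_eq (h : BoundaryOrbit occ m v ctr) (hocc : IsTight occ) {i j : ℤ} (e : v i = v j) :
    ctr i = ctr j :=
  (hocc.step_unique (h.step i) (e ▸ h.step j)).1

theorem curve_mem (h : BoundaryOrbit occ m v ctr) (hocc : IsTight occ) (hd : 0 < d) (τ : ℝ) :
    boundaryCurve d v ctr τ ∈ edgeFollowingPath d occ := by
  obtain ⟨i, h0, h1, -⟩ := exists_time_step τ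
  rw [h.curve_eq i h0 h1.le]
  exact (h.step i).arcPoint_mem hocc hd (by linarith) (by linarith)

theorem exists_curve_eq (h : BoundaryOrbit occ m v ctr) (hocc : IsTight occ) (hd : 0 < d) {w : ℂ}
    (hw : w ∈ edgeFollowingPath d occ) : ∃ τ, boundaryCurve d v ctr τ = w := by
  obtain ⟨x, c, x', u, hs, hu0, hu1, rfl⟩ := exists_step_of_mem_path hocc hd hw
  obtain ⟨i, rfl⟩ := h.exhaust x hs.mem_left
  refine ⟨i * (Real.pi / 3) + u, ?_⟩
  rw [h.curve_eq i (by linarith) (by linarith), add_sub_cancel_left,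
    (hocc.step_unique (h.step i) hs).1]

theorem curve_eq_iff (h : BoundaryOrbit occ m v ctr) (hocc : IsTight occ) (hd : 0 < d) (τ τ' : ℝ) :
    boundaryCurve d v ctr τ = boundaryCurve d v ctr τ' ↔
      ∃ z : ℤ, τ - τ' = z * (m * (Real.pi / 3)) := by
  obtain ⟨i, h0, h1, -⟩ := exists_time_step τ
  obtain ⟨j, h0', h1', -⟩ := exists_time_step τ'
  constructor
  · intro he
    rw [h.curve_eq i h0 h1.le, h.curve_eq j h0' h1'.le] at he
    obtain ⟨hv, hu⟩ := arcPoint_inj hd (h.step i) (h.step j) (by linarith) (by linarith)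
      (by linarith) (by linarith) he
    obtain ⟨z, hz⟩ := (h.eq_iff _ _).1 hv
    have hz' : (i : ℝ) - j = m * z := by exact_mod_cast hz
    exact ⟨z, by linear_combination hu + (Real.pi / 3) * hz'⟩
  · rintro ⟨z, hz⟩
    have e : v (j + z * m) = v j := h.v_add_mul j z
    have e' : ctr (j + z * m) = ctr j := h.ctr_eq hocc e
    rw [h.curve_eq j h0' h1'.le, h.curve_eq (j + z * m) (by push_cast; linarith)
      (by push_cast; linarith), e, e']
    congr 1
    push_cast
    linarith

theorem nonempty_homeomorph_circle (h : BoundaryOrbit occ m v ctr) (hocc : IsTight occ)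
    (hd : 0 < d) : Nonempty (edgeFollowingPath d occ ≃ₜ Circle) := by
  have hpi : 0 < Real.pi / 3 := by positivity
  have hm : (0 : ℝ) < m := by exact_mod_cast h.pos_length
  have hL : 0 < m * (Real.pi / 3) := by positivity
  have : Fact (0 < m * (Real.pi / 3)) := ⟨hL⟩
  set g : ℝ → edgeFollowingPath d occ := fun τ => ⟨boundaryCurve d v ctr τ, h.curve_mem hocc hd τ⟩
    with hg
  have hgc : Continuous g := h.continuous_curve.subtype_mk _
  have hper : Function.Periodic g (m * (Real.pi / 3)) := by
    intro τ
    exact Subtype.ext ((h.curve_eq_iff hocc hd _ _).2 ⟨1, by push_cast; ring⟩)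
  let f : AddCircle (m * (Real.pi / 3)) → edgeFollowingPath d occ := hper.lift
  have hf : ∀ τ : ℝ, f (τ : AddCircle (m * (Real.pi / 3))) = g τ := fun τ => hper.lift_coe τ
  have hfc : Continuous f := continuous_quot_lift _ hgc
  have hbij : Function.Bijective f := by
    constructor
    · intro p q
      induction p using QuotientAddGroup.induction_on with | _ τ
      induction q using QuotientAddGroup.induction_on with | _ τ'
      intro he
      rw [hf, hf] at he
      obtain ⟨z, hz⟩ := (h.curve_eq_iff hocc hd _ _).1 (congrArg Subtype.val he)
      refine sub_eq_zero.1 ((AddCircle.coe_sub (p := m * (Real.pi / 3)) τ τ').symm.trans ?_)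
      exact (AddCircle.coe_eq_zero_iff _).2 ⟨z, by rw [zsmul_eq_mul, hz]⟩
    · rintro ⟨w, hw⟩
      obtain ⟨τ, rfl⟩ := h.exists_curve_eq hocc hd hw
      exact ⟨τ, hf τ⟩
  have e := Continuous.homeoOfEquivCompactToT2 (f := Equiv.ofBijective f hbij) hfc
  exact ⟨e.symm.trans (AddCircle.homeomorphCircle hL.ne')⟩

/-! ### Assembly paths -/

theorem isEdgeFollowing_curve (h : BoundaryOrbit occ m v ctr) (hocc : IsTight occ) (hd : 0 < d)
    (ℓ : ℝ) : IsEdgeFollowing d occ ℓ (boundaryCurve d v ctr) where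
  continuousOn := h.continuous_curve.continuousOn
  mem_path τ _ := h.curve_mem hocc hd τ
  rotates := by
    intro τ _
    obtain ⟨i, h0, h1, -⟩ := exists_time_step τ
    refine ⟨ctr i, (h.step i).2.2.1, ?_, (i + 1) * (Real.pi / 3) - τ, by linarith, ?_⟩
    · rw [h.curve_eq i h0 h1.le, dist_arcPoint_centre]
      exact (dist_pos_eq_iff hd).2 (h.step i).2.2.2.1
    · intro u hu _
      rw [h.curve_eq i h0 h1.le, h.curve_eq i (by linarith [hu.1]) (by linarith [hu.2]),
        ← arcPoint_add]
      congr 1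
      ring

/-- Edge-following is determined by its starting point: when a robot is at a point of the boundary
curve, the occupied point around which it rotates is the one prescribed by the curve, since a
rotation around any other one would leave the edge-following path at once. -/
theorem eqOn_curve (h : BoundaryOrbit occ m v ctr) (hocc : IsTight occ) (hd : 0 < d) {ℓ : ℝ}
    {γ : ℝ → ℂ} (hγ : IsEdgeFollowing d occ ℓ γ) (h0 : γ 0 = boundaryCurve d v ctr 0) :
    EqOn γ (boundaryCurve d v ctr) (Icc 0 ℓ) := by
  have hpi : 0 < Real.pi / 3 := by positivity
  refine IsClosed.Icc_subset_of_forall_mem_nhdsWithin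
    (s := {τ | γ τ = boundaryCurve d v ctr τ}) ?_ h0 ?_
  · have hsub := hγ.continuousOn.sub (h.continuous_curve (d := d)).continuousOn
    have hc := hsub.preimage_isClosed_of_isClosed isClosed_Icc (isClosed_singleton (x := (0 : ℂ)))
    convert hc using 1
    ext τ
    simp only [mem_inter_iff, mem_ofPred_eq, mem_preimage, Pi.sub_apply, mem_singleton_iff,
      sub_eq_zero]
    tauto
  · rintro τ ⟨hτ : γ τ = _, hτℓ⟩
    obtain ⟨c, hc, hdist, ε, hε, hrot⟩ := hγ.rotates τ hτℓ
    obtain ⟨i, hi0, hi1, -⟩ := exists_time_step τ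
    have hcurve := h.curve_eq (d := d) i hi0 hi1.le
    have hs := h.step i
    rw [hτ, hcurve] at hdist
    have hci : c = ctr i := by
      rcases hi0.eq_or_lt with hi0' | hi0'
      · rw [← hi0', sub_self, arcPoint_zero, dist_pos_eq_iff hd] at hdist
        obtain ⟨u, hu0, hu⟩ : ∃ u, 0 < u ∧ u ≤ min ε (min (ℓ - τ) (Real.pi / 6)) :=
          ⟨_, lt_min hε (lt_min (by linarith [hτℓ.2]) (by positivity)), le_rfl⟩
        have hu1 : u ≤ ε := hu.trans (min_le_left _ _)
        have hu2 : u ≤ ℓ - τ := hu.trans ((min_le_right _ _).trans (min_le_left _ _))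
        have hu3 : u ≤ Real.pi / 6 := hu.trans ((min_le_right _ _).trans (min_le_right _ _))
        have hmem := hγ.mem_path (τ + u) ⟨by linarith [hτℓ.1], by linarith⟩
        rw [hrot u ⟨hu0.le, hu1⟩ (by linarith), hτ, hcurve, ← hi0', sub_self, arcPoint_zero] at hmem
        exact (hocc.step_unique hs
          (stepAround_of_arcPoint_mem hd hc hdist hu0 (by linarith) hmem)).1.symm
      · exact eq_centre_of_dist_eq hd hs.2.2.2.1 (by linarith) (by linarith) hdist
    rw [mem_nhdsGT_iff_exists_Ioc_subset]
    refine ⟨τ + min ε (min (ℓ - τ) ((i + 1) * (Real.pi / 3) - τ)), ?_, ?_⟩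
    · exact lt_add_of_pos_right _ (lt_min hε (lt_min (by linarith [hτℓ.2]) (by linarith)))
    · rintro t ⟨ht0, ht⟩
      have hu : t - τ ≤ min ε (min (ℓ - τ) ((i + 1) * (Real.pi / 3) - τ)) := by linarith
      have hu1 := hu.trans (min_le_left _ _)
      have hu2 := hu.trans ((min_le_right _ _).trans (min_le_left _ _))
      have hu3 := hu.trans ((min_le_right _ _).trans (min_le_right _ _))
      have e := hrot (t - τ) ⟨by linarith, hu1⟩ (by linarith)
      rw [add_sub_cancel] at e
      rw [mem_ofPred_eq, e, hτ, hcurve, hci, ← arcPoint_add,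
        h.curve_eq i (by linarith) (by linarith)]
      congr 1
      ring

end BoundaryOrbit

/-- Two different points of the edge-following set of a tight configuration whose boundary is one
cycle are joined by exactly one assembly path, and it is unobstructed. -/
theorem exists_unique_assemblyPath {occ : Set LPt} {r d : ℝ} (hr : 0 < r)
    (hd : d = 2 * r / (Real.sqrt 3 - 1)) (hocc : IsTight occ) (hcyc : IsCycle occ) {a b : LPt}
    (ha : a ∈ edgeFollowingSet occ) (hb : b ∈ edgeFollowingSet occ) (hab : a ≠ b) :
    ∃ (ℓ : ℝ) (γ : ℝ → ℂ), IsAssemblyPath d occ a b ℓ γ ∧ IsUnobstructed d r occ ℓ γ ∧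
      ∀ (ℓ' : ℝ) (γ' : ℝ → ℂ), IsAssemblyPath d occ a b ℓ' γ' →
        ℓ' = ℓ ∧ Set.EqOn γ' γ (Set.Icc 0 ℓ) := by
  have hpi : 0 < Real.pi / 3 := by positivity
  have h3 : 1 < Real.sqrt 3 := by rw [Real.lt_sqrt] <;> norm_num
  have h3' : Real.sqrt 3 < 2 := by rw [Real.sqrt_lt'] <;> norm_num
  have hrd : r + r < d := by
    rw [hd, lt_div_iff₀ (by linarith)]
    nlinarith
  have hd0 : 0 < d := by linarith
  obtain ⟨m, v, ctr, h, rfl⟩ := exists_boundaryOrbit hocc hcyc ha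
  have hm : (0 : ℤ) < m := by exact_mod_cast h.pos_length
  obtain ⟨k, hk0, hkm, rfl⟩ : ∃ k : ℤ, 0 < k ∧ k < m ∧ v k = b := by
    obtain ⟨j, rfl⟩ := h.exhaust b hb
    have e : v (j % m) = v j :=
      (h.eq_iff _ _).2 ⟨-(j / m), by linear_combination Int.emod_add_mul_ediv j m⟩
    refine ⟨j % m, lt_of_le_of_ne (Int.emod_nonneg _ hm.ne') fun e0 => hab ?_,
      Int.emod_lt_of_pos _ hm, e⟩
    rw [← e, ← e0]
  have hk0' : (0 : ℝ) < k := by exact_mod_cast hk0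
  have hkm' : (k : ℝ) < m := by exact_mod_cast hkm
  have hm' : (0 : ℝ) < m := by linarith
  have hkL : k * (Real.pi / 3) < m * (Real.pi / 3) := by nlinarith
  have hk1 : 0 < k * (Real.pi / 3) := by positivity
  have hstart : boundaryCurve d v ctr 0 = pos d (v 0) := by
    have := h.curve_int (d := d) 0
    rwa [Int.cast_zero, zero_mul] at this
  -- the curve is injective on time intervals shorter than a period
  have small : ∀ τ τ' : ℝ, boundaryCurve d v ctr τ = boundaryCurve d v ctr τ' →
      |τ - τ'| < m * (Real.pi / 3) → τ = τ' := by
    intro τ τ' e hlt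
    obtain ⟨z, hz⟩ := (h.curve_eq_iff hocc hd0 _ _).1 e
    have hL : 0 < m * (Real.pi / 3) := by positivity
    rw [hz, abs_mul, abs_of_pos hL] at hlt
    have : |(z : ℝ)| < 1 := by nlinarith
    have : |z| < 1 := by exact_mod_cast this
    rw [Int.abs_lt_one_iff] at this
    rw [this, Int.cast_zero, zero_mul] at hz
    linarith
  refine ⟨k * (Real.pi / 3), boundaryCurve d v ctr,
    ⟨hk1, h.isEdgeFollowing_curve hocc hd0 _, hstart, h.curve_int k, ?_⟩, ?_, ?_⟩
  · intro τ hτ τ' hτ' e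
    refine small τ τ' e (abs_lt.2 ⟨?_, ?_⟩) <;> linarith [hτ.1, hτ.2, hτ'.1, hτ'.2]
  · intro τ _ c hc
    exact Metric.closedBall_disjoint_closedBall (hrd.trans_le ((h.curve_mem hocc hd0 τ).2 c hc))
  · intro ℓ' γ' hγ'
    have heq := h.eqOn_curve hocc hd0 hγ'.follows (hγ'.source.trans hstart.symm)
    have hℓ := hγ'.pos_time
    have hlt : ℓ' < m * (Real.pi / 3) := by
      by_contra! hcon
      have hL : 0 < m * (Real.pi / 3) := by positivity
      have e : γ' (m * (Real.pi / 3)) = γ' 0 := by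
        rw [heq ⟨hL.le, hcon⟩, heq ⟨le_rfl, hℓ.le⟩]
        exact (h.curve_eq_iff hocc hd0 _ _).2 ⟨1, by push_cast; ring⟩
      exact hL.ne' (hγ'.injOn ⟨hL.le, hcon⟩ ⟨le_rfl, hℓ.le⟩ e)
    have hfin : ℓ' = k * (Real.pi / 3) := by
      refine small _ _ ?_ (abs_lt.2 ⟨by linarith, by linarith⟩)
      rw [← heq ⟨hℓ.le, le_rfl⟩, hγ'.target, h.curve_int]
    exact ⟨hfin, hfin ▸ heq⟩

/-! ### The epochs -/

theorem Ico_one_eq_Icc_pred {n : ℕ} (hn : 1 ≤ n) : Ico 1 n = Icc 1 (n - 1) := by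
  ext k
  simp only [mem_Ico, mem_Icc]
  omega

/-- The facts about one configuration that follow from its being tight and having one boundary
cycle. -/
theorem boundary_facts {occ : Set LPt} {d : ℝ} (hd : 0 < d) (hocc : IsTight occ)
    (hcyc : IsCycle occ) (hne : (edgeFollowingSet occ).Nonempty) :
    IsProperBoundary occ ∧ Nonempty (edgeFollowingPath d occ ≃ₜ Circle) ∧
      pos d '' edgeFollowingSet occ ⊆ edgeFollowingPath d occ := by
  obtain ⟨a, ha⟩ := hne
  obtain ⟨m, v, ctr, h, -⟩ := exists_boundaryOrbit hocc hcyc ha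
  refine ⟨hocc.isProperBoundary, h.nonempty_homeomorph_circle hocc hd, ?_⟩
  rintro _ ⟨x, hx, rfl⟩
  exact (pos_mem_edgeFollowingPath_iff hd).2 hx

theorem mainTheorem5 (r d : ℝ) (hr : 0 < r) (hd : d = 2 * r / (Real.sqrt 3 - 1))
    (S I : Finset LPt)
    (hS : IsProperRibbonization (S : Set LPt)) (hS' : NoLatticeHoles (S : Set LPt))
    (hI : IsIdlePlacement (I : Set LPt)) (hIS : S.card ≤ I.card)
    (lt : Set LPt → Set LPt → Prop) (hlt : IsCompleteTreeOrder (S : Set LPt) lt) :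
    (∃ s, IsActivationSequence (I : Set LPt) S.card s) ∧
    (∃ t, IsAssemblySequence (S : Set LPt) lt S.card t) ∧
    ∀ s t : ℕ → LPt, IsActivationSequence (I : Set LPt) S.card s →
      IsAssemblySequence (S : Set LPt) lt S.card t →
      -- sub-epochs `n⁺`, from the initial configuration `n = 0` on
      (∀ n ≤ S.card,
        IsProperBoundary (occPlus I s t n) ∧
        Nonempty (edgeFollowingPath d (occPlus I s t n) ≃ₜ Circle) ∧
        pos d '' edgeFollowingSet (occPlus I s t n) ⊆ edgeFollowingPath d (occPlus I s t n)) ∧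
      -- sub-epochs `n⁻`
      (∀ n, 1 ≤ n → n ≤ S.card →
        IsProperBoundary (occMinus I s t n) ∧
        Nonempty (edgeFollowingPath d (occMinus I s t n) ≃ₜ Circle) ∧
        pos d '' edgeFollowingSet (occMinus I s t n) ⊆ edgeFollowingPath d (occMinus I s t n) ∧
        s n ∈ edgeFollowingSet (occMinus I s t n) ∧
        t n ∈ edgeFollowingSet (occMinus I s t n) ∧
        -- the assembly path of `u_n` exists, is unobstructed, and is unique
        ∃ (ℓ : ℝ) (γ : ℝ → ℂ),
          IsAssemblyPath d (occMinus I s t n) (s n) (t n) ℓ γ ∧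
          IsUnobstructed d r (occMinus I s t n) ℓ γ ∧
          ∀ (ℓ' : ℝ) (γ' : ℝ → ℂ), IsAssemblyPath d (occMinus I s t n) (s n) (t n) ℓ' γ' →
            ℓ' = ℓ ∧ Set.EqOn γ' γ (Set.Icc 0 ℓ)) := by
  have hfree : HoleFree (S : Set LPt) := holeFree_shape hS S.finite_toSet hS'
  have hI' := hI.isInitial
  have hd0 : 0 < d := by
    have h3 : 1 < Real.sqrt 3 := by rw [Real.lt_sqrt] <;> norm_num
    rw [hd]
    exact div_pos (by linarith) (by linarith)
  refine ⟨exists_descending holeFree_idle isCompleteTreeOrder_idle hI.subset_H₂ I.finite_toSet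
    (by rwa [Set.ncard_coe_finset]), exists_ascending hfree hlt subset_rfl S.finite_toSet
    (by rw [Set.ncard_coe_finset]), fun s t hs ht => ?_⟩
  have hAinit : ∀ n ≤ S.card, IsInitial H₂ (TreeLT H₂) ((I : Set LPt) \ s '' Icc 1 n) := fun n hn =>
    isInitial_descending holeFree_idle isCompleteTreeOrder_idle hI' hs hn
  have hTinit : ∀ n ≤ S.card, IsInitial (S : Set LPt) lt (t '' Icc 1 n) := fun n hn =>
    isInitial_ascending hfree hlt ht hn
  have hTfin : ∀ n, (t '' Icc 1 n).Finite := fun n => (finite_Icc 1 n).image t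
  have hAfin : ∀ n, ((I : Set LPt) \ s '' Icc 1 n).Finite := fun n => I.finite_toSet.sdiff
  -- the point `p₃` is always in the edge-following set
  have hp₃ : ∀ A T : Set LPt, A ⊆ H₂ → T ⊆ S →
      ((1, 0) : LPt) ∈ edgeFollowingSet (seeds ∪ A ∪ T) := by
    intro A T hA hT
    refine ⟨?_, (0, 0), .inl (.inl (by simp [seeds])), by rw [adj_iff]; decide⟩
    rintro ((h | h) | h)
    · simp [seeds] at h
    · have := hA h
      simp [H₂] at this
    · have := hS.subset_H₁ (hT h)
      simp [H₁] at this
  constructor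
  · intro n hn
    exact boundary_facts hd0 (isTight_occ hS hfree hlt (hAinit n hn) (hTinit n hn))
      (isCycle_occ hS hfree hlt (hAinit n hn) (hTinit n hn) (hAfin n) (hTfin n))
      ⟨_, hp₃ _ _ (hAinit n hn).1 (hTinit n hn).1⟩
  · intro n hn1 hn
    have hIco := Ico_one_eq_Icc_pred hn1
    have hT := hTinit (n - 1) (by omega)
    have hocc : occMinus I s t n = seeds ∪ ((I : Set LPt) \ s '' Icc 1 n) ∪ t '' Icc 1 (n - 1) := by
      rw [occMinus, hIco]
    have htight := isTight_occ hS hfree hlt (hAinit n hn) hT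
    have hcyc := isCycle_occ hS hfree hlt (hAinit n hn) hT (hAfin n) (hTfin _)
    have hnonempty := hp₃ _ _ (hAinit n hn).1 hT.1
    rw [← hocc] at htight hcyc hnonempty
    obtain ⟨h1, h2, h3⟩ := boundary_facts hd0 htight hcyc ⟨_, hnonempty⟩
    have hsn := (hs n hn1 hn).1
    have htn := (ht n hn1 hn).1
    have hsrow : (s n).2 ≤ -2 := hI.subset_H₂ hsn.1
    have htrow : 2 ≤ (t n).2 := hS.subset_H₁ htn.1
    have hsE : s n ∈ edgeFollowingSet (occMinus I s t n) := by
      constructor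
      · rintro ((h | h) | h)
        · have := row_of_mem_seeds h; omega
        · exact h.2 ⟨n, ⟨hn1, le_rfl⟩, rfl⟩
        · obtain ⟨k, hk, e⟩ := h
          have : 2 ≤ (t k).2 := hS.subset_H₁ (ht k hk.1 (hk.2.le.trans hn)).1.1
          rw [e] at this
          omega
      · rw [hIco] at hsn
        obtain ⟨y, hy, hmem⟩ :=
          (hAinit (n - 1) (by omega)).adj_mem holeFree_idle isCompleteTreeOrder_idle hsn
        refine ⟨y, .inl (hmem.imp id fun h => ⟨h.1, ?_⟩), hy⟩
        rintro ⟨k, hk, rfl⟩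
        rcases hk.2.eq_or_lt with rfl | hlt
        · exact hy.ne rfl
        · exact h.2 ⟨k, ⟨hk.1, by omega⟩, rfl⟩
    have htE : t n ∈ edgeFollowingSet (occMinus I s t n) := by
      constructor
      · rintro ((h | h) | h)
        · have := row_of_mem_seeds h; omega
        · have : (t n).2 ≤ -2 := hI.subset_H₂ h.1
          omega
        · exact htn.2 h
      · obtain ⟨y, hy, hmem⟩ := (hTinit n hn).adj_mem hfree hlt ⟨n, ⟨hn1, le_rfl⟩, rfl⟩
        rcases hmem with h | ⟨k, hk, rfl⟩
        · exact ⟨y, .inl (.inl h), hy⟩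
        · refine ⟨t k, .inr ⟨k, ⟨hk.1, lt_of_le_of_ne hk.2 ?_⟩, rfl⟩, hy⟩
          rintro rfl
          exact hy.ne rfl
    have hne : s n ≠ t n := fun e => by rw [e] at hsrow; omega
    exact ⟨h1, h2, h3, hsE, htE, exists_unique_assemblyPath hr hd htight hcyc hsE htE hne⟩
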